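/- Let $K$ be an algebraically closed field, $\Gamma$ a finite quiver, $I\subseteq K\Gamma$ an admissible ideal, $\Lambda=K\Gamma/I$ with Jacobson radical $J$ and Loewy length $L+1$. Products of paths are read as $pq=$ "first $q$, then $p$". Let $T=\bigoplus_{r=1}^t S_{e(r)}$ be a semisimple left $\Lambda$-module, where $e(1),\dots,e(t)$ are vertices and $S_{v}=\Lambda v/Jv$; put $P=\bigoplus_{r}\Lambda z_r$ with $\Lambda z_r=\Lambda e(r)$, and $\widehat P=\bigoplus_r K\Gamma\,\widehat z_r$ with $K\Gamma\,\widehat z_r=K\Gamma e(r)$. A path in $\widehat P$ is an element $p\widehat z_r$ with $p$ a path starting in $e(r)$; its length and end vertex are those of $p$. An abstract $d$-dimensional skeleton with top $T$ is a set $\sigma$ of $d$ paths in $\widehat P$ of length at most $L$ that contains all $\widehat z_r$ and is closed under initial subpaths. It is a skeleton of a left $\Lambda$-module $M$ relative to elements $x_1,\dots,x_t\in M$ if each $x_r$ lies outside $JM$ and is fixed by some vertex idempotent, the $x_r$ generate $M$ and are linearly independent modulo $JM$, and there is a $K\Gamma$-epimorphism $f:\widehat P\to M$ with $f(\widehat z_r)=x_r$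 such that for every $l\le L$ the family $f(q)$, $q\in\sigma$ of length $l$, lies in $J^lM$ and induces a $K$-basis of $J^lM/J^{l+1}M$. It is a skeleton of $M$ if this holds for some $x_1,\dots,x_t$. Let $\mathfrak{Grass}(\sigma)$ be the set of $\Lambda$-submodules $C\subseteq JP$ with $\dim_K C=\dim_K P-d$ such that $\sigma$ is a skeleton of $P/C$ relative to $z_1+C,\dots,z_t+C$, with the Zariski topology and the regular functions induced from the Grassmannian $\mathrm{Gr}(\dim P-d,\,JP)$. A path $x=\alpha p\widehat z_r\notin\sigma$ with $\alpha$ an arrow and $p\widehat z_r\in\sigma$ is called $\sigma$-critical; its $\sigma$-set $\sigma(x)$ consists of the paths in $\sigma$ that are at least as long as $x$ and end in the same vertex. Let $N$ be the (finite) set of pairs $(x,q)$ with $x$ $\sigma$-critical and $q\in\sigma(x)$, and $K[X]=K[X_\nu\mid\nu\in N]$. A path $p\widehat z_r$ is also read as the element $pz_r$ of $P$. For a set $R$ of left ideal generators of $I$, let $I(\sigma)=I(\sigma,R)\subseteq K[X]$ be the ideal generated by all coefficients $\tau_q$ that occur when the elements $\rho\widehat z_r$ ($\rho\in R$, $r\le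 t$) of $\bigoplus_r K[X]\Gamma\,\widehat z_r$ are written as $K[X]$-linear combinations $\sum_{q\in\sigma}\tau_q\,q$ modulo the $K[X]\Gamma$-submodule generated by the differences $x-\sum_{q\in\sigma(x)}X_{(x,q)}\,q$, $x$ $\sigma$-critical. **Theorem.** Let $\sigma\subseteq\widehat P$ be an abstract $d$-dimensional skeleton with top $T$. (a) For each $C\in\mathfrak{Grass}(\sigma)$ there is a unique $\psi(C)=(c_{(x,q)})\in\mathbb A^N$ with $x+C=\sum_{q\in\sigma(x)}c_{(x,q)}\,q+C$ in $P/C$ for every $\sigma$-critical path $x$. The image of $\psi$ is closed in $\mathbb A^N$, and $\psi:\mathfrak{Grass}(\sigma)\to\operatorname{Im}\psi$ is an isomorphism of varieties, whose inverse sends $c$ to the $\Lambda$-submodule $U(c)\subseteq JP$ generated by the differences $x-\sum_{q\in\sigma(x)}c_{(x,q)}\,q$, $x$ $\sigma$-critical. (b) Let $\varphi$ send $C\in\mathfrak{Grass}(\sigma)$ to the isomorphism class of $P/C$, and let $\chi$ send $c\in\operatorname{Im}\psi$ to the isomorphism class of $P/U(c)$. Both are maps to the set of isomorphism classes of left $\Lambda$-modules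 with skeleton $\sigma$, $\chi=\varphi\circ\psi^{-1}$, and $\chi$ is onto. (c) For every set $R$ of left ideal generators of $I$, $\operatorname{Im}\psi$ is the zero locus of $I(\sigma,R)$; if $R\subseteq K_0\Gamma$ for a subfield $K_0$ of $K$, then $I(\sigma,R)$ is generated by polynomials with coefficients in $K_0$. (d) There is one algorithm (a Turing computable function), the same for all $K,\Gamma,I,T,\sigma$, with the following property. Its input is $\Gamma$, the list $e(1),\dots,e(t)$, a list of the paths in $\sigma$, and finitely many left ideal generators of $I$, each written as a formal sum of terms $a_kp$ with paths $p$ and symbols $a_k$ standing for scalars in $K$. Its output is a finite list of polynomials in the variables $X_\nu$ whose coefficients are integer polynomials in the symbols $a_k$. When the symbols are given their values in $K$, these polynomials generate $I(\sigma,R)$ for the given set $R$ of generators, and their set of common zeros is $\operatorname{Im}\psi$; if the values of all $a_k$ lie in a subfield $K_0$, the polynomials have coefficients in $K_0$. -/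

import Mathlib

open scoped Quiver

namespace SkeletonGrass

noncomputable section

/-! ## Path algebras -/

/-- The paths of a quiver (with their starting points and end points). -/
abbrev QPath (V : Type*) [Quiver V] := Σ a b : V, Quiver.Path a b

/-- The path of length zero at a vertex. -/
def vertexPath {V : Type*} [Quiver V] (v : V) : QPath V := ⟨v, v, Quiver.Path.nil⟩

/-- The path algebra `AΓ` of a quiver with coefficients in `A`: the free `A`-module on the paths.
The multiplication is defined below. -/
def PathAlgebra (A V : Type*) [CommRing A] [Quiver V] := QPath V →₀ A

section PathAlgebra

variable (A : Type*) [CommRing A] {V : Type*} [Quiver V]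

instance : AddCommGroup (PathAlgebra A V) := inferInstanceAs (AddCommGroup (QPath V →₀ A))

instance : Module A (PathAlgebra A V) := inferInstanceAs (Module A (QPath V →₀ A))

/-- A path as an element of the path algebra. -/
def ofPath (p : QPath V) : PathAlgebra A V := Finsupp.single p (1 : A)

variable {A} in
/-- The coefficient of a path in an element of the path algebra. -/
def coeff (x : PathAlgebra A V) (p : QPath V) : A :=
  let y : QPath V →₀ A := x
  y p

open Classical in
/-- The product `pq` of two paths: "first `q`, then `p`"; it is zero unless `q` ends where `p`
starts. -/
def pathMul (p q : QPath V) : PathAlgebra A V :=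
  if h : q.2.1 = p.1 then
    ofPath A ⟨q.1, p.2.1, q.2.2.comp (p.2.2.cast h.symm rfl)⟩
  else 0

/-- The bilinear extension of the product of paths. -/
def mulLin : PathAlgebra A V →ₗ[A] PathAlgebra A V →ₗ[A] PathAlgebra A V :=
  Finsupp.linearCombination A fun p : QPath V =>
    (Finsupp.linearCombination A fun q : QPath V => pathMul A p q :
      (QPath V →₀ A) →ₗ[A] PathAlgebra A V)

instance : Mul (PathAlgebra A V) := ⟨fun x y => mulLin A x y⟩

instance [Fintype V] : One (PathAlgebra A V) := ⟨∑ v : V, ofPath A (vertexPath v)⟩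

variable {A}

theorem mul_def (x y : PathAlgebra A V) : x * y = mulLin A x y := rfl

theorem ofPath_mul_ofPath (p q : QPath V) : ofPath A p * ofPath A q = pathMul A p q := by
  rw [mul_def, mulLin, ofPath, ofPath]
  erw [Finsupp.linearCombination_single, one_smul, Finsupp.linearCombination_single, one_smul]

theorem pathMul_of_eq {a b c : V} (p : Quiver.Path b c) (q : Quiver.Path a b) :
    pathMul A (⟨b, c, p⟩ : QPath V) ⟨a, b, q⟩ = ofPath A ⟨a, c, q.comp p⟩ := by
  simp [pathMul]

theorem pathMul_of_ne {p q : QPath V} (h : q.2.1 ≠ p.1) : pathMul A p q = 0 := by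
  simp [pathMul, h]

theorem induction_on {P : PathAlgebra A V → Prop} (x : PathAlgebra A V) (h0 : P 0)
    (hadd : ∀ x y, P x → P y → P (x + y)) (hs : ∀ (a : A) (p : QPath V), P (a • ofPath A p)) :
    P x := by
  refine Finsupp.induction_linear (motive := P) x h0 hadd fun p a => ?_
  have := hs a p
  rw [ofPath] at this
  erw [Finsupp.smul_single, smul_eq_mul, mul_one] at this
  exact this

theorem smul_mul_aux (a : A) (x y : PathAlgebra A V) : (a • x) * y = a • (x * y) := by
  simp [mul_def]

theorem mul_smul_aux (a : A) (x y : PathAlgebra A V) : x * (a • y) = a • (x * y) := by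
  simp [mul_def]

theorem add_mul_aux (x y z : PathAlgebra A V) : (x + y) * z = x * z + y * z := by
  simp [mul_def]

theorem mul_add_aux (x y z : PathAlgebra A V) : x * (y + z) = x * y + x * z := by
  simp [mul_def]

theorem zero_mul_aux (x : PathAlgebra A V) : 0 * x = 0 := by simp [mul_def]

theorem mul_zero_aux (x : PathAlgebra A V) : x * 0 = 0 := by simp [mul_def]

theorem sum_mul_aux {ι : Type*} (s : Finset ι) (f : ι → PathAlgebra A V) (x : PathAlgebra A V) :
    (∑ i ∈ s, f i) * x = ∑ i ∈ s, f i * x := by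
  simp [mul_def]

theorem mul_sum_aux {ι : Type*} (s : Finset ι) (f : ι → PathAlgebra A V) (x : PathAlgebra A V) :
    x * (∑ i ∈ s, f i) = ∑ i ∈ s, x * f i := by
  simp [mul_def]

theorem assoc_ofPath (p q r : QPath V) :
    ofPath A p * ofPath A q * ofPath A r = ofPath A p * (ofPath A q * ofPath A r) := by
  obtain ⟨a, b, p⟩ := p
  obtain ⟨c, d, q⟩ := q
  obtain ⟨f, g, r⟩ := r
  by_cases h1 : d = a
  · subst h1
    by_cases h2 : g = c
    · subst h2
      simp only [ofPath_mul_ofPath, pathMul_of_eq, Quiver.Path.comp_assoc]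
    · rw [ofPath_mul_ofPath, pathMul_of_eq, ofPath_mul_ofPath, pathMul_of_ne (by exact h2),
        ofPath_mul_ofPath, pathMul_of_ne (by exact h2), mul_zero_aux]
  · rw [ofPath_mul_ofPath, pathMul_of_ne (by exact h1), zero_mul_aux]
    by_cases h2 : g = c
    · subst h2
      rw [ofPath_mul_ofPath, pathMul_of_eq, ofPath_mul_ofPath, pathMul_of_ne (by exact h1)]
    · rw [ofPath_mul_ofPath, pathMul_of_ne (by exact h2), mul_zero_aux]

theorem mul_assoc_aux (x y z : PathAlgebra A V) : x * y * z = x * (y * z) := by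
  induction x using induction_on with
  | h0 => simp only [zero_mul_aux]
  | hadd x x' hx hx' => simp only [add_mul_aux, hx, hx']
  | hs a p =>
    induction y using induction_on with
    | h0 => simp only [zero_mul_aux, mul_zero_aux]
    | hadd y y' hy hy' => simp only [add_mul_aux, mul_add_aux, hy, hy']
    | hs b q =>
      induction z using induction_on with
      | h0 => simp only [mul_zero_aux]
      | hadd z z' hz hz' => simp only [mul_add_aux, hz, hz']
      | hs c r => simp only [smul_mul_aux, mul_smul_aux, assoc_ofPath]

theorem one_mul_aux [Fintype V] (x : PathAlgebra A V) : 1 * x = x := by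
  change (∑ v : V, ofPath A (vertexPath v)) * x = x
  induction x using induction_on with
  | h0 => rw [mul_zero_aux]
  | hadd x y hx hy => rw [mul_add_aux, hx, hy]
  | hs a p =>
    obtain ⟨b, c, p⟩ := p
    rw [mul_smul_aux, sum_mul_aux, Finset.sum_eq_single c]
    · rw [ofPath_mul_ofPath, vertexPath, pathMul_of_eq, Quiver.Path.comp_nil]
    · intro v _ hv
      rw [ofPath_mul_ofPath, pathMul_of_ne (by exact hv.symm)]
    · simp

theorem mul_one_aux [Fintype V] (x : PathAlgebra A V) : x * 1 = x := by
  change x * (∑ v : V, ofPath A (vertexPath v)) = x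
  induction x using induction_on with
  | h0 => rw [zero_mul_aux]
  | hadd x y hx hy => rw [add_mul_aux, hx, hy]
  | hs a p =>
    obtain ⟨b, c, p⟩ := p
    rw [smul_mul_aux, mul_sum_aux, Finset.sum_eq_single b]
    · rw [ofPath_mul_ofPath, vertexPath, pathMul_of_eq, Quiver.Path.nil_comp]
    · intro v _ hv
      rw [ofPath_mul_ofPath, pathMul_of_ne (by exact hv)]
    · simp

instance [Fintype V] : Ring (PathAlgebra A V) :=
  { (inferInstance : AddCommGroup (PathAlgebra A V)) with
    mul := (· * ·)
    one := 1
    left_distrib := mul_add_aux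
    right_distrib := add_mul_aux
    zero_mul := zero_mul_aux
    mul_zero := mul_zero_aux
    mul_assoc := mul_assoc_aux
    one_mul := one_mul_aux
    mul_one := mul_one_aux }

instance [Fintype V] : Algebra A (PathAlgebra A V) :=
  Algebra.ofModule smul_mul_aux mul_smul_aux

/-- Extension of scalars `AΓ → BΓ` along `A → B`. -/
def mapCoeff {B : Type*} [CommRing B] (f : A →+* B) (x : PathAlgebra A V) : PathAlgebra B V :=
  Finsupp.mapRange f (map_zero f) (x : QPath V →₀ A)

end PathAlgebra

/-! ## The algebra `Λ = KΓ/I`, radical powers, Loewy length -/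

/-- An ideal `I` of `KΓ` is admissible if it contains all paths of length at least `m`, for some
`m`, and is contained in the span of the paths of length at least two. -/
def IsAdmissible {K V : Type*} [Field K] [Fintype V] [Quiver V] (I : Ideal (PathAlgebra K V)) :
    Prop :=
  (∃ m : ℕ, ∀ p : QPath V, m ≤ p.2.2.length → ofPath K p ∈ I) ∧
    ∀ x ∈ I, ∀ p : QPath V, p.2.2.length < 2 → coeff x p = 0

section Lam

variable {K V : Type*} [Field K] [Fintype V] [Quiver V] (I : Ideal (PathAlgebra K V))
  [I.IsTwoSided]

/-- The algebra `Λ = KΓ/I`. -/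
def Lam := PathAlgebra K V ⧸ I

instance : Ring (Lam I) := inferInstanceAs (Ring (PathAlgebra K V ⧸ I))

instance : Algebra K (Lam I) := inferInstanceAs (Algebra K (PathAlgebra K V ⧸ I))

/-- The canonical epimorphism `KΓ → Λ`. -/
def toLam : PathAlgebra K V →+* Lam I := Ideal.Quotient.mk I

end Lam

/-- The submodule `J^l M`, where `J` is the Jacobson radical of the ring. -/
def radPow (Λ : Type*) [Ring Λ] (M : Type*) [AddCommGroup M] [Module Λ M] (l : ℕ) :
    Submodule Λ M :=
  (Ring.jacobson Λ) ^ l • (⊤ : Submodule Λ M)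

/-- The Loewy length of a ring with nilpotent Jacobson radical `J`: the least `m` with
`J^m = 0`. -/
def loewyLength (Λ : Type*) [Ring Λ] : ℕ := sInf {m : ℕ | (Ring.jacobson Λ) ^ m = ⊥}

/-! ## Paths in the projective modules, skeleta, critical paths -/

/-- The paths `p ẑ_r` in `P̂ = ⨁_r KΓ ẑ_r`, where `ẑ_r` is normed by the vertex `e r`: pairs
consisting of an index `r` and a path `p` starting in `e r`. -/
abbrev TopPath {V : Type*} [Quiver V] {t : ℕ} (e : Fin t → V) :=
  Σ (r : Fin t) (b : V), Quiver.Path (e r) b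

section Paths

variable {V : Type*} [Quiver V] {t : ℕ} {e : Fin t → V}

/-- The length of `p ẑ_r`. -/
def TopPath.length (x : TopPath e) : ℕ := x.2.2.length

/-- The end point of `p ẑ_r`. -/
def TopPath.endpoint (x : TopPath e) : V := x.2.1

/-- The path `p` of `p ẑ_r`. -/
def TopPath.toQPath (x : TopPath e) : QPath V := ⟨e x.1, x.2.1, x.2.2⟩

/-- An abstract skeleton in `P̂`, with top `T = ⨁_r S_{e r}`: a set of paths of length at most `L`
which contains all `ẑ_r` and is closed under initial subpaths. -/
structure IsAbstractSkeleton (L : ℕ) (σ : Finset (TopPath e)) : Prop where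
  length_le : ∀ x ∈ σ, TopPath.length x ≤ L
  nil_mem : ∀ r : Fin t, (⟨r, e r, Quiver.Path.nil⟩ : TopPath e) ∈ σ
  initial_mem : ∀ (r : Fin t) (a b : V) (p₁ : Quiver.Path (e r) a) (p₂ : Quiver.Path a b),
    (⟨r, b, p₁.comp p₂⟩ : TopPath e) ∈ σ → (⟨r, a, p₁⟩ : TopPath e) ∈ σ

/-- The `σ`-critical paths: the paths `α p ẑ_r` outside `σ` such that `α` is an arrow and `p ẑ_r`
is in `σ`.  If `σ` consists of paths of length at most `L`, the critical paths have length at most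
`L + 1`; those of length `L + 1` have an empty `σ`-set and vanish in `P`. -/
def IsCritical (σ : Finset (TopPath e)) (x : TopPath e) : Prop :=
  x ∉ σ ∧ ∃ (r : Fin t) (a b : V) (p : Quiver.Path (e r) a) (α : a ⟶ b),
    (⟨r, a, p⟩ : TopPath e) ∈ σ ∧ x = ⟨r, b, p.cons α⟩

open Classical in
/-- The `σ`-set of a path `x`: the paths in `σ` which are at least as long as `x` and end in the
same vertex. -/
def sigmaSet (σ : Finset (TopPath e)) (x : TopPath e) : Finset (TopPath e) :=
  σ.filter fun q => TopPath.length x ≤ TopPath.length q ∧ TopPath.endpoint q = TopPath.endpoint x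

/-- The index set `N`: the pairs consisting of a critical path and an element of its `σ`-set. -/
abbrev CoordIndex (σ : Finset (TopPath e)) :=
  Σ x : {x : TopPath e // IsCritical σ x}, {q : TopPath e // q ∈ sigmaSet σ x.1}

end Paths

section Modules

variable (A : Type*) [CommRing A] {V : Type*} [Fintype V] [Quiver V] {t : ℕ} (e : Fin t → V)

/-- The projective module `P̂(A) = ⨁_r AΓ ẑ_r`, with `AΓ ẑ_r = AΓ e(r)`. -/
def PHat :=
  ∀ r : Fin t, ↥(Ideal.span {ofPath A (vertexPath (e r))} : Ideal (PathAlgebra A V))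

instance : AddCommGroup (PHat A e) := inferInstanceAs (AddCommGroup
  (∀ r : Fin t, ↥(Ideal.span {ofPath A (vertexPath (e r))} : Ideal (PathAlgebra A V))))

instance : Module (PathAlgebra A V) (PHat A e) := inferInstanceAs (Module (PathAlgebra A V)
  (∀ r : Fin t, ↥(Ideal.span {ofPath A (vertexPath (e r))} : Ideal (PathAlgebra A V))))

instance : Module A (PHat A e) := inferInstanceAs (Module A
  (∀ r : Fin t, ↥(Ideal.span {ofPath A (vertexPath (e r))} : Ideal (PathAlgebra A V))))

instance : IsScalarTower A (PathAlgebra A V) (PHat A e) :=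
  inferInstanceAs (IsScalarTower A (PathAlgebra A V)
    (∀ r : Fin t, ↥(Ideal.span {ofPath A (vertexPath (e r))} : Ideal (PathAlgebra A V))))

/-- The distinguished top element `ẑ_r`. -/
def zHat (r : Fin t) : PHat A e :=
  Pi.single (M := fun r => ↥(Ideal.span {ofPath A (vertexPath (e r))} :
    Ideal (PathAlgebra A V))) r ⟨ofPath A (vertexPath (e r)), Ideal.subset_span rfl⟩

/-- The path `p ẑ_r` as an element of `P̂(A)`. -/
def pathHat {e : Fin t → V} (x : TopPath e) : PHat A e :=
  ofPath A (TopPath.toQPath x) • zHat A e x.1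

variable {K : Type*} [Field K] (I : Ideal (PathAlgebra K V)) [I.IsTwoSided]

/-- The distinguished projective cover `P = ⨁_r Λ z_r` of `T = ⨁_r S_{e r}` over `Λ = KΓ/I`, with
`Λ z_r = Λ e(r)`. -/
def PCover :=
  ∀ r : Fin t, ↥(Ideal.span {toLam I (ofPath K (vertexPath (e r)))} : Ideal (Lam I))

instance : AddCommGroup (PCover e I) := inferInstanceAs (AddCommGroup
  (∀ r : Fin t, ↥(Ideal.span {toLam I (ofPath K (vertexPath (e r)))} : Ideal (Lam I))))

instance : Module (Lam I) (PCover e I) := inferInstanceAs (Module (Lam I)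
  (∀ r : Fin t, ↥(Ideal.span {toLam I (ofPath K (vertexPath (e r)))} : Ideal (Lam I))))

instance : Module K (PCover e I) := inferInstanceAs (Module K
  (∀ r : Fin t, ↥(Ideal.span {toLam I (ofPath K (vertexPath (e r)))} : Ideal (Lam I))))

instance : IsScalarTower K (Lam I) (PCover e I) := inferInstanceAs (IsScalarTower K (Lam I)
  (∀ r : Fin t, ↥(Ideal.span {toLam I (ofPath K (vertexPath (e r)))} : Ideal (Lam I))))

/-- The distinguished top element `z_r` of `P`. -/
def zTop (r : Fin t) : PCover e I :=
  Pi.single (M := fun r => ↥(Ideal.span {toLam I (ofPath K (vertexPath (e r)))} :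
    Ideal (Lam I))) r ⟨toLam I (ofPath K (vertexPath (e r))), Ideal.subset_span rfl⟩

/-- The element `p z_r` of `P`. -/
def pathTop {e : Fin t → V} (x : TopPath e) : PCover e I :=
  toLam I (ofPath K (TopPath.toQPath x)) • zTop e I x.1

end Modules

section Skeleton

variable {K V : Type*} [Field K] [Fintype V] [Quiver V] (I : Ideal (PathAlgebra K V))
  [I.IsTwoSided] {t : ℕ} {e : Fin t → V}
  (M : Type*) [AddCommGroup M] [Module K M] [Module (Lam I) M]
  [IsScalarTower K (Lam I) M]

/-- The number `L`, where `L + 1` is the Loewy length of `Λ = KΓ/I`. -/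
def maxLength : ℕ := loewyLength (Lam I) - 1

variable {M} in
/-- A full sequence of top elements of `M`: elements outside `JM`, each normed by a vertex, which
generate `M` and are linearly independent modulo `JM`. -/
structure IsFullSequence (x : Fin t → M) : Prop where
  not_mem : ∀ r, x r ∉ radPow (Lam I) M 1
  normed : ∀ r, ∃ v : V, toLam I (ofPath K (vertexPath v)) • x r = x r
  span_eq : Submodule.span (Lam I) (Set.range x) = ⊤
  indep : LinearIndependent K fun r => (radPow (Lam I) M 1).mkQ (x r)

variable {M} in
/-- `σ` is a skeleton of `M` relative to the full sequence `x` of top elements: there is a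
`KΓ`-epimorphism `f : P̂ → M` with `f ẑ_r = x_r` such that, for each `l ≤ L`, the elements `f q`,
where `q` runs through the paths of length `l` in `σ`, lie in `J^l M` and induce a `K`-basis of
`J^l M / J^(l+1) M`. -/
def IsSkeletonRel (σ : Finset (TopPath e)) (x : Fin t → M) : Prop :=
  IsFullSequence I x ∧
    ∃ f : PHat K e →ₛₗ[toLam I] M,
      Function.Surjective f ∧ (∀ r, f (zHat K e r) = x r) ∧
      ∀ l ≤ maxLength I,
        ∃ h : ∀ q : {q // q ∈ σ ∧ TopPath.length q = l},
            f (pathHat K q.1) ∈ radPow (Lam I) M l,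
          LinearIndependent K (fun q : {q // q ∈ σ ∧ TopPath.length q = l} =>
            ((radPow (Lam I) M (l + 1)).submoduleOf
              (radPow (Lam I) M l)).mkQ ⟨f (pathHat K q.1), h q⟩) ∧
          Submodule.span K (Set.range fun q : {q // q ∈ σ ∧ TopPath.length q = l} =>
            ((radPow (Lam I) M (l + 1)).submoduleOf
              (radPow (Lam I) M l)).mkQ ⟨f (pathHat K q.1), h q⟩) = ⊤

/-- `σ` is a skeleton of `M`. -/
def IsSkeletonOf (σ : Finset (TopPath e)) : Prop := ∃ x : Fin t → M, IsSkeletonRel I σ x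

end Skeleton

/-! ## Varieties as spaces with functions -/

/-- A space with functions over `K`: a topology together with a notion of `K`-valued functions
which are regular on a set `U` (used for open `U`; the values outside `U` are irrelevant). -/
structure SpaceWithFunctions (K X : Type*) where
  topology : TopologicalSpace X
  IsRegularOn : Set X → (X → K) → Prop

/-- A morphism of spaces with functions: a continuous map which pulls back regular functions on
open sets to regular functions. -/
def IsMorphism {K X Y : Type*} (S : SpaceWithFunctions K X) (T : SpaceWithFunctions K Y)
    (φ : X → Y) : Prop :=
  @Continuous X Y S.topology T.topology φ ∧
    ∀ U : Set Y, @IsOpen Y T.topology U → ∀ f : Y → K, T.IsRegularOn U f →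
      S.IsRegularOn (φ ⁻¹' U) (f ∘ φ)

/-- The space with functions given by a family of pairs `(D, f)`, where `f` is a function with
domain of definition `D`: the sets `D` generate the topology, and the regular functions are those
which agree, near every point, with a member of the family. -/
def ofFractions {K X : Type*} (F : Set (Set X × (X → K))) : SpaceWithFunctions K X where
  topology := TopologicalSpace.generateFrom (Prod.fst '' F)
  IsRegularOn U f := ∀ x ∈ U, ∃ p ∈ F, x ∈ p.1 ∧ ∀ y ∈ U ∩ p.1, f y = p.2 y

/-- Restriction of a family of partial functions along a map (the inclusion of a subset). -/
def pullFractions {K X Y : Type*} (j : Y → X) (F : Set (Set X × (X → K))) :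
    Set (Set Y × (Y → K)) :=
  (fun p => (j ⁻¹' p.1, p.2 ∘ j)) '' F

/-- The fractions `g/h` of polynomials on the affine space `A^N`, with domain `h ≠ 0`. -/
def affineFractions (K N : Type*) [Field K] : Set (Set (N → K) × ((N → K) → K)) :=
  {p | ∃ g h : MvPolynomial N K,
    p.1 = {x | MvPolynomial.eval x h ≠ 0} ∧
    p.2 = fun x => MvPolynomial.eval x g / MvPolynomial.eval x h}

/-- The affine space `A^N` with its Zariski topology and its regular functions. -/
def affineSpace (K N : Type*) [Field K] : SpaceWithFunctions K (N → K) :=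
  ofFractions (affineFractions K N)

/-- A subset of affine space, with the induced Zariski topology and regular functions. -/
def affineSubset {K N : Type*} [Field K] (Y : Set (N → K)) : SpaceWithFunctions K Y :=
  ofFractions (pullFractions Subtype.val (affineFractions K N))

/-- The classical Grassmannian of `m`-dimensional subspaces of `W`. -/
abbrev Gr (K : Type*) [Field K] (m : ℕ) (W : Type*) [AddCommGroup W] [Module K W] :=
  {C : Submodule K W // Module.finrank K C = m}

/-- The vectors of homogeneous Plücker coordinates of a subspace `C` of `W`, one for each basis
`v` of `C`.  The coordinates `det (φ_i (v_j))` are taken for all `m`-tuples `φ` of linear forms on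
`W`, so that no basis of `W` has to be chosen; those formed from a basis of the dual space
determine the others linearly. -/
def pluckerVectors {K : Type*} [Field K] {m : ℕ} {W : Type*} [AddCommGroup W] [Module K W]
    (C : Gr K m W) : Set ((Fin m → Module.Dual K W) → K) :=
  {w | ∃ v : Fin m → W, LinearIndependent K v ∧ Submodule.span K (Set.range v) = C.1 ∧
    w = fun φ => Matrix.det (Matrix.of fun i j => φ i (v j))}

/-- The fractions `g/h` on the Grassmannian, where `g` and `h` are homogeneous polynomials of the
same degree in the Plücker coordinates, with domain `h ≠ 0`. -/
def grassFractions (K : Type*) [Field K] (m : ℕ) (W : Type*) [AddCommGroup W] [Module K W] :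
    Set (Set (Gr K m W) × (Gr K m W → K)) :=
  {p | ∃ (k : ℕ) (g h : MvPolynomial (Fin m → Module.Dual K W) K),
    g.IsHomogeneous k ∧ h.IsHomogeneous k ∧
    p.1 = {C | ∃ w ∈ pluckerVectors C, MvPolynomial.eval w h ≠ 0} ∧
    ∀ C, ∀ w ∈ pluckerVectors C, MvPolynomial.eval w h ≠ 0 →
      p.2 C = MvPolynomial.eval w g / MvPolynomial.eval w h}

/-! ## The varieties `Grass(σ)` -/

section Grass

variable {K V : Type*} [Field K] [Fintype V] [Quiver V] (I : Ideal (PathAlgebra K V))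
  [I.IsTwoSided] {t : ℕ} {e : Fin t → V}

variable (e) in
/-- The submodule `JP` of `P`. -/
abbrev JP : Submodule (Lam I) (PCover e I) := radPow (Lam I) (PCover e I) 1

variable (e) in
/-- The set of all `Λ`-submodules `C` of `JP` with `dim C = dim P - d`. -/
def GrassTop (d : ℕ) : Set (Submodule (Lam I) (PCover e I)) :=
  {C | C ≤ JP I e ∧ Module.finrank K C + d = Module.finrank K (PCover e I)}

/-- `Grass(σ)`: the points `C` such that `σ` is a distinguished skeleton of `P/C`, that is, a
skeleton relative to the sequence `z_1 + C, …, z_t + C`. -/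
def Grass (σ : Finset (TopPath e)) (d : ℕ) :
    Set (Submodule (Lam I) (PCover e I)) :=
  {C | C ∈ GrassTop I e d ∧ IsSkeletonRel I σ fun r => C.mkQ (zTop e I r)}

theorem finrank_comap {d : ℕ} {C : Submodule (Lam I) (PCover e I)}
    (h : C ∈ GrassTop I e d) :
    Module.finrank K ((C.comap (JP I e).subtype).restrictScalars K) =
      Module.finrank K (PCover e I) - d := by
  rw [← h.2, Nat.add_sub_cancel]
  exact LinearEquiv.finrank_eq
    ((Submodule.comapSubtypeEquivOfLe h.1).restrictScalars K)

/-- `Grass(σ)` as a subset of the classical Grassmannian `Gr(dim P - d, JP)`. -/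
def toGr (σ : Finset (TopPath e)) (d : ℕ) (C : Grass I σ d) :
    Gr K (Module.finrank K (PCover e I) - d) (JP I e) :=
  ⟨(C.1.comap (JP I e).subtype).restrictScalars K, finrank_comap I C.2.1⟩

/-- `Grass(σ)` with the Zariski topology and the regular functions induced by the Grassmannian
`Gr(dim P - d, JP)`. -/
def grassVariety (σ : Finset (TopPath e)) (d : ℕ) : SpaceWithFunctions K (Grass I σ d) :=
  ofFractions (pullFractions (toGr I σ d)
    (grassFractions K (Module.finrank K (PCover e I) - d) (JP I e)))

/-- The difference `x - ∑ c_{x,q} q` in `P`, for a critical path `x`; the sum extends over the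
`σ`-set of `x`. -/
def critDiff (σ : Finset (TopPath e)) (c : CoordIndex σ → K)
    (x : {x : TopPath e // IsCritical σ x}) : PCover e I :=
  pathTop I x.1 - ∑ q : {q : TopPath e // q ∈ sigmaSet σ x.1}, c ⟨x, q⟩ • pathTop I q.1

/-- The family `c` expresses the critical paths modulo `C` through their `σ`-sets. -/
def IsCoeffFamily (σ : Finset (TopPath e)) (C : Submodule (Lam I) (PCover e I))
    (c : CoordIndex σ → K) : Prop :=
  ∀ x : {x : TopPath e // IsCritical σ x},
    C.mkQ (pathTop I x.1) =
      C.mkQ (∑ q : {q : TopPath e // q ∈ sigmaSet σ x.1}, c ⟨x, q⟩ • pathTop I q.1)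

/-- The submodule `U(c)` of `P` generated by the differences `x - ∑ c_{x,q} q`. -/
def USub (σ : Finset (TopPath e)) (c : CoordIndex σ → K) :
    Submodule (Lam I) (PCover e I) :=
  Submodule.span _ (Set.range (critDiff I σ c))

end Grass

/-! ## Isomorphism classes -/

section IsoClasses

universe u v w

variable {K : Type u} {V : Type v} [Field K] [Fintype V] [Quiver.{w} V]
  (I : Ideal (PathAlgebra K V)) [I.IsTwoSided] {t : ℕ} {e : Fin t → V}

/-- Isomorphism classes of left `Λ`-modules. -/
abbrev IsoType :=
  Quotient (CategoryTheory.isIsomorphicSetoid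
    (ModuleCat.{max u v w} (Lam I)))

/-- The isomorphism class of a left `Λ`-module. -/
def isoType (M : Type (max u v w)) [AddCommGroup M] [Module (Lam I) M] :
    IsoType I :=
  Quotient.mk _ (ModuleCat.of (Lam I) M)

/-- The isomorphism classes of left `Λ`-modules with skeleton `σ`. -/
def skeletonIsoTypes (σ : Finset (TopPath e)) : Set (IsoType I) :=
  {X | ∃ (M : Type (max u v w)) (_ : AddCommGroup M) (_ : Module K M)
      (_ : Module (Lam I) M) (_ : IsScalarTower K (Lam I) M),
    IsSkeletonOf I M σ ∧ X = isoType I M}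

end IsoClasses

/-! ## The ideal of polynomials attached to a skeleton -/

section SkeletonIdeal

variable {K V : Type*} [Field K] [Fintype V] [Quiver V] {t : ℕ} {e : Fin t → V}

/-- The submodule of `P̂(K[X]) = ⨁_r K[X]Γ ẑ_r`, where `X = (X_ν)_{ν ∈ N}`, generated over
`K[X]Γ` by the differences `x - ∑ X_{x,q} q`, where `x` runs through the critical paths. -/
def genericSub (K : Type*) [Field K] (σ : Finset (TopPath e)) :
    Submodule (PathAlgebra (MvPolynomial (CoordIndex σ) K) V)
      (PHat (MvPolynomial (CoordIndex σ) K) e) :=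
  Submodule.span _ (Set.range fun x : {x : TopPath e // IsCritical σ x} =>
    pathHat (MvPolynomial (CoordIndex σ) K) x.1 -
      ∑ q : {q : TopPath e // q ∈ sigmaSet σ x.1},
        (MvPolynomial.X ⟨x, q⟩ : MvPolynomial (CoordIndex σ) K) •
          pathHat (MvPolynomial (CoordIndex σ) K) q.1)

/-- The ideal `I(σ)` of `K[X]` attached to a set `R` of elements of `KΓ`: it is generated by the
coefficients `τ_q` which occur when the elements `ρ ẑ_r`, with `ρ ∈ R`, are expressed as
`K[X]`-linear combinations `∑ τ_q q` of the elements `q` of `σ` modulo `genericSub`. -/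
def skeletonIdeal (σ : Finset (TopPath e)) (R : Set (PathAlgebra K V)) :
    Ideal (MvPolynomial (CoordIndex σ) K) :=
  Ideal.span {g | ∃ ρ ∈ R, ∃ (r : Fin t) (τ : {q // q ∈ σ} → MvPolynomial (CoordIndex σ) K),
    mapCoeff (MvPolynomial.C : K →+* MvPolynomial (CoordIndex σ) K) ρ •
        zHat (MvPolynomial (CoordIndex σ) K) e r -
      ∑ q : {q // q ∈ σ}, τ q • pathHat (MvPolynomial (CoordIndex σ) K) q.1 ∈
        genericSub K σ ∧
    ∃ q, g = τ q}

end SkeletonIdeal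

/-! ## Input and output of the algorithm -/

section Codes

/-- The code of a path: its starting point (for paths in `P̂`: the index of the top element) and
the list of its arrows, in the order in which they are traversed. -/
abbrev PathCode := ℕ × List ℕ

/-- Inputs: the quiver (number of vertices, and the list of the pairs of starting point and end
point of the arrows), the list of the vertices `e(1), …, e(t)`, a list of paths in `P̂`, and a list
of elements of the path algebra; each of the latter is a formal sum of terms `a_k p`, given by the
number `k` of a symbol `a_k` and a path `p`. -/
abbrev AlgInput :=
  (ℕ × List (ℕ × ℕ)) × List ℕ × List PathCode × List (List (ℕ × PathCode))

/-- Outputs: lists of polynomials; a polynomial is a list of terms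
`z · a_{k_1} ⋯ a_{k_i} · X_{ν_1} ⋯ X_{ν_j}`, with an integer `z`, symbols `a_k` and variables `X_ν`,
where `ν` is given by a pair of paths in `P̂`. -/
abbrev AlgOutput := List (List (ℤ × List ℕ × List (PathCode × PathCode)))

variable {V : Type*} [Quiver V] {n m : ℕ}

/-- The list of the numbers of the arrows of a path, in the order of traversal. -/
def arrowWord (numA : (Σ a b : V, a ⟶ b) ≃ Fin m) {a : V} : {b : V} → Quiver.Path a b → List ℕ
  | _, Quiver.Path.nil => []
  | _, Quiver.Path.cons p α => arrowWord numA p ++ [(numA ⟨_, _, α⟩).val]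

/-- The code of a path of the quiver. -/
def codePath (numV : V ≃ Fin n) (numA : (Σ a b : V, a ⟶ b) ≃ Fin m) (p : QPath V) : PathCode :=
  ((numV p.1).val, arrowWord numA p.2.2)

/-- The code of a path in `P̂`. -/
def codeTopPath (numA : (Σ a b : V, a ⟶ b) ≃ Fin m) {t : ℕ} {e : Fin t → V} (x : TopPath e) :
    PathCode :=
  (x.1.val, arrowWord numA x.2.2)

/-- The code of the quiver. -/
def codeQuiver (numV : V ≃ Fin n) (numA : (Σ a b : V, a ⟶ b) ≃ Fin m) : ℕ × List (ℕ × ℕ) :=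
  (n, List.ofFn fun i : Fin m =>
    ((numV (numA.symm i).1).val, (numV (numA.symm i).2.1).val))

/-- The input made of a quiver, the vertices `e(r)`, a list of paths in `P̂` and a list of formal
sums of terms `a_k p`. -/
def codeInput (numV : V ≃ Fin n) (numA : (Σ a b : V, a ⟶ b) ≃ Fin m) {t : ℕ} (e : Fin t → V)
    (s : List (TopPath e)) {k : ℕ} (gens : List (List (Fin k × QPath V))) : AlgInput :=
  (codeQuiver numV numA, List.ofFn (fun r => (numV (e r)).val), s.map (codeTopPath numA),
    gens.map fun ρ => ρ.map fun T => (T.1.val, codePath numV numA T.2))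

/-- The element `∑ a_k p` of the path algebra represented by a formal sum, for given values of the
symbols `a_k`. -/
def evalGen {K : Type*} [Field K] {k : ℕ} (a : Fin k → K) (ρ : List (Fin k × QPath V)) :
    PathAlgebra K V :=
  (ρ.map fun T => a T.1 • ofPath K T.2).sum

/-- Formal polynomials in the variables `X_ν`, whose coefficients are integer polynomials in the
symbols `a_1, …, a_k`. -/
abbrev FormalPoly (k : ℕ) (N : Type*) := List (ℤ × List (Fin k) × List N)

/-- The polynomial over `K` represented by a formal polynomial, for given values of the symbols. -/
def evalPoly {K : Type*} [Field K] {k : ℕ} {N : Type*} (a : Fin k → K) (g : FormalPoly k N) :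
    MvPolynomial N K :=
  (g.map fun T => MvPolynomial.C ((T.1 : K) * (T.2.1.map a).prod) *
    (T.2.2.map MvPolynomial.X).prod).sum

/-- The code of a formal polynomial in the variables `X_ν`, `ν ∈ N`. -/
def codePoly (numA : (Σ a b : V, a ⟶ b) ≃ Fin m) {t : ℕ} {e : Fin t → V}
    {σ : Finset (TopPath e)} {k : ℕ} (g : FormalPoly k (CoordIndex σ)) :
    List (ℤ × List ℕ × List (PathCode × PathCode)) :=
  g.map fun T => (T.1, T.2.1.map Fin.val,
    T.2.2.map fun ν => (codeTopPath numA ν.1.1, codeTopPath numA ν.2.1))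

end Codes

end

end SkeletonGrass

open SkeletonGrass

universe u v w

namespace SkeletonGrass

noncomputable section

/-! ## The path algebra as a linear span of paths -/

section PathAlgebraFacts

variable {A V : Type*} [CommRing A] [Quiver V]

/-! Over any commutative ring A, a family c of coefficients indexed by N turns the free module A^σ
into a representation of the quiver: an arrow α sends the basis vector q ∈ σ to αq if αq ∈ σ, and to
∑ c_{(αq,q')} q' if αq is critical (`act`). There is nothing to verify, since arrows may act in any
way. The critical relations with coefficients c hold in this module (`relations_act`), and it maps
to every module over the path algebra in which these relations hold (`realize_act`).

A filtration argument (`isSkeletonRel_iff`) shows that σ is a skeleton of M relative to x exactly if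
x_r = e(r)x_r, the paths in σ applied to x form a K-basis of M, and each critical path is a
combination of its σ-set. Hence for C in Grass(σ) the quotient P/C is the representation K^σ
attached to ψ(C). Conversely, K^σ with the structure given by c is such a quotient as soon as I
annihilates it. So Im ψ is the set `annihilated I σ` (`exists_grass_iff`), and C is recovered as
U(c) because σ spans P/U(c) and is independent in P/C (`USub_eq_of_grass`).

Over K[X], with the variables as coefficients, the same construction shows that P̂(K[X]) modulo the
critical differences is free on σ. The τ_q are therefore unique: they are the coordinates of ρ ẑ_r
in the generic representation (`skeletonIdeal_eq`). Specialising X to c gives the coordinates for c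
(`eval_coordPoly`), so the zero locus of I(σ,R) is again `annihilated I σ`
(`zeroLocus_skeletonIdeal`). The construction commutes with ring homomorphisms, whence the statement
on subfields. It is also effective: the algorithm lets the arrows of ρ act one after another on
formal sums of monomials.

For the geometry, every C in Grass(σ) is a complement in P of the span of σ. After the choice of a
base point C₀ a single Plücker coordinate is therefore nonzero on all of Grass(σ), and Cramer's rule
writes the coordinates of ψ as quotients by it (`isMorphism_coeff`). In the other direction,
projecting a basis of C₀ into U(c) along σ gives a basis of U(c) which is polynomial in c
(`isMorphism_USub`). -/

theorem ofPath_eq_single (p : QPath V) :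
    ofPath A p = (Finsupp.single p (1 : A) : QPath V →₀ A) := rfl

theorem coeff_ofPath [DecidableEq (QPath V)] (p q : QPath V) :
    coeff (ofPath A p) q = if p = q then 1 else 0 := by
  change (Finsupp.single p (1 : A) : QPath V →₀ A) q = _
  rw [Finsupp.single_apply]

theorem coeff_add (x y : PathAlgebra A V) (p : QPath V) :
    coeff (x + y) p = coeff x p + coeff y p := rfl

theorem coeff_smul (a : A) (x : PathAlgebra A V) (p : QPath V) :
    coeff (a • x) p = a * coeff x p := rfl

theorem coeff_zero (p : QPath V) : coeff (0 : PathAlgebra A V) p = 0 := rfl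

theorem eq_sum_coeff (x : PathAlgebra A V) :
    x = (Finsupp.sum (x : QPath V →₀ A) fun p a => a • (ofPath A p : PathAlgebra A V)) := by
  refine (Finsupp.sum_single (x : QPath V →₀ A)).symm.trans ?_
  refine Finsupp.sum_congr fun p _ => ?_
  rw [ofPath_eq_single]
  exact (Finsupp.smul_single_one p _).symm

theorem mapCoeff_ofPath {B : Type*} [CommRing B] (f : A →+* B) (p : QPath V) :
    mapCoeff f (ofPath A p) = ofPath B p := by
  change Finsupp.mapRange f (map_zero f) (Finsupp.single p (1 : A)) = _
  rw [Finsupp.mapRange_single, map_one]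
  rfl

theorem mapCoeff_add {B : Type*} [CommRing B] (f : A →+* B) (x y : PathAlgebra A V) :
    mapCoeff f (x + y) = mapCoeff f x + mapCoeff f y :=
  Finsupp.mapRange_add (map_add f) _ _

theorem mapCoeff_smul {B : Type*} [CommRing B] (f : A →+* B) (a : A) (x : PathAlgebra A V) :
    mapCoeff f (a • x) = f a • mapCoeff f x := by
  refine Finsupp.ext fun p => ?_
  exact map_mul f _ _

theorem mapCoeff_zero {B : Type*} [CommRing B] (f : A →+* B) :
    mapCoeff f (0 : PathAlgebra A V) = 0 :=
  Finsupp.mapRange_zero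

theorem ofPath_comp {a b c : V} (p : Quiver.Path a b) (q : Quiver.Path b c) :
    ofPath A (⟨a, c, p.comp q⟩ : QPath V) = ofPath A ⟨b, c, q⟩ * ofPath A ⟨a, b, p⟩ := by
  rw [ofPath_mul_ofPath, pathMul_of_eq]

theorem ofPath_cons {a b c : V} (p : Quiver.Path a b) (α : b ⟶ c) :
    ofPath A (⟨a, c, p.cons α⟩ : QPath V) =
      ofPath A ⟨b, c, α.toPath⟩ * ofPath A ⟨a, b, p⟩ :=
  ofPath_comp p α.toPath

theorem vertex_mul_ofPath {a b : V} (p : Quiver.Path a b) :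
    ofPath A (vertexPath b) * ofPath A (⟨a, b, p⟩ : QPath V) = ofPath A ⟨a, b, p⟩ := by
  rw [vertexPath, ofPath_mul_ofPath, pathMul_of_eq, Quiver.Path.comp_nil]

end PathAlgebraFacts

/-! ## The representation of the quiver attached to a family of coefficients -/

section Action

variable {V : Type*} [Quiver V] {t : ℕ} {e : Fin t → V}

/-- The path `α p ẑ_r`. -/
def TopPath.snoc (q : TopPath e) {a b : V} (h : q.2.1 = a) (α : a ⟶ b) : TopPath e :=
  ⟨q.1, b, (q.2.2.cast rfl h).cons α⟩

/-- The path `ẑ_r`. -/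
def topVertex (e : Fin t → V) (r : Fin t) : TopPath e := ⟨r, e r, Quiver.Path.nil⟩

theorem isCritical_snoc {σ : Finset (TopPath e)} {q : TopPath e} (hq : q ∈ σ) {a b : V}
    (h : q.2.1 = a) (α : a ⟶ b) (hs : q.snoc h α ∉ σ) : IsCritical σ (q.snoc h α) := by
  subst h
  exact ⟨hs, q.1, q.2.1, b, q.2.2, α, hq, rfl⟩

variable {A : Type*} [CommRing A] {σ : Finset (TopPath e)}

theorem mem_sigmaSet {x q : TopPath e} :
    q ∈ sigmaSet σ x ↔ q ∈ σ ∧ x.length ≤ q.length ∧ q.endpoint = x.endpoint := by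
  classical
  rw [sigmaSet, Finset.mem_filter]

theorem mem_of_mem_sigmaSet {x q : TopPath e} (h : q ∈ sigmaSet σ x) : q ∈ σ :=
  (mem_sigmaSet.1 h).1

theorem length_le_of_mem_sigmaSet {x q : TopPath e} (h : q ∈ sigmaSet σ x) :
    x.length ≤ q.length :=
  (mem_sigmaSet.1 h).2.1

theorem endpoint_of_mem_sigmaSet {x q : TopPath e} (h : q ∈ sigmaSet σ x) :
    q.2.1 = x.2.1 :=
  (mem_sigmaSet.1 h).2.2

open Classical in
/-- The combination of paths in `σ` by which a path in `σ`, or a critical path, is represented. -/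
def normalForm (c : CoordIndex σ → A) (y : TopPath e) : {q // q ∈ σ} → A :=
  if hy : y ∈ σ then Pi.single ⟨y, hy⟩ 1
  else if hc : IsCritical σ y then
    ∑ q : {q : TopPath e // q ∈ sigmaSet σ y},
      c ⟨⟨y, hc⟩, q⟩ • Pi.single ⟨q.1, mem_of_mem_sigmaSet q.2⟩ 1
  else 0

open Classical in
theorem normalForm_of_mem (c : CoordIndex σ → A) {y : TopPath e} (hy : y ∈ σ) :
    normalForm c y = Pi.single ⟨y, hy⟩ 1 := by
  simp [normalForm, hy]

open Classical in
theorem normalForm_of_critical (c : CoordIndex σ → A) {y : TopPath e} (hy : IsCritical σ y) :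
    normalForm c y = ∑ q : {q : TopPath e // q ∈ sigmaSet σ y},
      c ⟨⟨y, hy⟩, q⟩ • Pi.single ⟨q.1, mem_of_mem_sigmaSet q.2⟩ 1 := by
  simp [normalForm, hy, hy.1]

open Classical in
/-- The idempotent `e_a` on the free module on `σ`. -/
def vertexEnd (A : Type*) [CommRing A] (σ : Finset (TopPath e)) (a : V) :
    Module.End A ({q // q ∈ σ} → A) :=
  Fintype.linearCombination A fun q => if q.1.2.1 = a then Pi.single q 1 else 0

open Classical in
/-- The action of an arrow on the free module on `σ`. -/
def arrowEnd (c : CoordIndex σ → A) {a b : V} (α : a ⟶ b) : Module.End A ({q // q ∈ σ} → A) :=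
  Fintype.linearCombination A fun q =>
    if h : q.1.2.1 = a then normalForm c (q.1.snoc h α) else 0

/-- The action of a path on the free module on `σ`. -/
def pathEnd (c : CoordIndex σ → A) {a : V} : {b : V} → Quiver.Path a b →
    Module.End A ({q // q ∈ σ} → A)
  | _, Quiver.Path.nil => vertexEnd A σ a
  | _, Quiver.Path.cons p α => arrowEnd c α * pathEnd c p

open Classical in
theorem vertexEnd_single (a : V) (q : {q // q ∈ σ}) :
    vertexEnd A σ a (Pi.single q 1) = if q.1.2.1 = a then Pi.single q 1 else 0 := by
  rw [vertexEnd, Fintype.linearCombination_apply_single, one_smul]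

open Classical in
theorem arrowEnd_single (c : CoordIndex σ → A) {a b : V} (α : a ⟶ b) (q : {q // q ∈ σ}) :
    arrowEnd c α (Pi.single q 1) =
      if h : q.1.2.1 = a then normalForm c (q.1.snoc h α) else 0 := by
  rw [arrowEnd, Fintype.linearCombination_apply_single, one_smul]

open Classical in
theorem end_ext {M : Type*} [AddCommGroup M] [Module A M]
    {f g : ({q // q ∈ σ} → A) →ₗ[A] M}
    (h : ∀ q, f (Pi.single q 1) = g (Pi.single q 1)) : f = g :=
  (Pi.basisFun A _).ext fun q => by simpa using h q

theorem vertexEnd_normalForm (c : CoordIndex σ → A) (y : TopPath e) :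
    vertexEnd A σ y.2.1 (normalForm c y) = normalForm c y := by
  classical
  by_cases hy : y ∈ σ
  · rw [normalForm_of_mem c hy, vertexEnd_single, if_pos rfl]
  by_cases hc : IsCritical σ y
  · rw [normalForm_of_critical c hc, map_sum]
    refine Finset.sum_congr rfl fun q _ => ?_
    rw [map_smul, vertexEnd_single, if_pos (endpoint_of_mem_sigmaSet q.2)]
  · simp [normalForm, hy, hc]

theorem vertexEnd_mul_self (a : V) : vertexEnd A σ a * vertexEnd A σ a = vertexEnd A σ a := by
  classical
  refine end_ext fun q => ?_
  rw [Module.End.mul_apply, vertexEnd_single]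
  split_ifs with h
  · rw [vertexEnd_single, if_pos h]
  · rw [map_zero]

theorem vertexEnd_mul_of_ne {a b : V} (hab : a ≠ b) :
    vertexEnd A σ a * vertexEnd A σ b = 0 := by
  classical
  refine end_ext fun q => ?_
  rw [Module.End.mul_apply, vertexEnd_single]
  split_ifs with h
  · rw [vertexEnd_single, if_neg, LinearMap.zero_apply]
    rw [h]; exact hab.symm
  · rw [map_zero, LinearMap.zero_apply]

theorem arrowEnd_mul_vertexEnd (c : CoordIndex σ → A) {a b : V} (α : a ⟶ b) :
    arrowEnd c α * vertexEnd A σ a = arrowEnd c α := by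
  classical
  refine end_ext fun q => ?_
  rw [Module.End.mul_apply, vertexEnd_single]
  split_ifs with h
  · rfl
  · rw [map_zero, arrowEnd_single, dif_neg h]

theorem vertexEnd_mul_arrowEnd (c : CoordIndex σ → A) {a b : V} (α : a ⟶ b) :
    vertexEnd A σ b * arrowEnd c α = arrowEnd c α := by
  classical
  refine end_ext fun q => ?_
  rw [Module.End.mul_apply, arrowEnd_single]
  split_ifs with h
  · exact vertexEnd_normalForm c (q.1.snoc h α)
  · rw [map_zero]

theorem pathEnd_mul_vertexEnd (c : CoordIndex σ → A) {a b : V} (p : Quiver.Path a b) :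
    pathEnd c p * vertexEnd A σ a = pathEnd c p := by
  induction p with
  | nil => exact vertexEnd_mul_self a
  | cons p α ih => rw [pathEnd, mul_assoc, ih]

theorem vertexEnd_mul_pathEnd (c : CoordIndex σ → A) {a b : V} (p : Quiver.Path a b) :
    vertexEnd A σ b * pathEnd c p = pathEnd c p := by
  cases p with
  | nil => exact vertexEnd_mul_self a
  | cons p α => rw [pathEnd, ← mul_assoc, vertexEnd_mul_arrowEnd]

/-- A trivial path acts by an idempotent and not by the identity, so the case of a trivial second
factor rests on `vertexEnd_mul_pathEnd`. -/
theorem pathEnd_comp (c : CoordIndex σ → A) {a b d : V} (p : Quiver.Path a b)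
    (q : Quiver.Path b d) : pathEnd c (p.comp q) = pathEnd c q * pathEnd c p := by
  induction q with
  | nil => exact (vertexEnd_mul_pathEnd c p).symm
  | cons q α ih => rw [Quiver.Path.comp_cons, pathEnd, pathEnd, ih, mul_assoc]

theorem sum_vertexEnd [Fintype V] : ∑ a : V, vertexEnd A σ a = 1 := by
  classical
  refine end_ext fun q => ?_
  rw [LinearMap.sum_apply, Finset.sum_eq_single q.1.2.1]
  · rw [vertexEnd_single, if_pos rfl]; rfl
  · intro b _ hb
    rw [vertexEnd_single, if_neg hb.symm]
  · simp

/-- The linear extension of the action of the paths. -/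
def actLin (c : CoordIndex σ → A) : PathAlgebra A V →ₗ[A] Module.End A ({q // q ∈ σ} → A) :=
  (Finsupp.linearCombination A fun p : QPath V => pathEnd c p.2.2 :
    (QPath V →₀ A) →ₗ[A] Module.End A ({q // q ∈ σ} → A))

theorem actLin_ofPath (c : CoordIndex σ → A) (p : QPath V) :
    actLin c (ofPath A p) = pathEnd c p.2.2 := by
  rw [actLin, ofPath_eq_single]
  erw [Finsupp.linearCombination_single, one_smul]

theorem actLin_mul (c : CoordIndex σ → A) (x y : PathAlgebra A V) :
    actLin c (x * y) = actLin c x * actLin c y := by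
  induction x using induction_on with
  | h0 => simp only [zero_mul_aux, map_zero, zero_mul]
  | hadd x x' hx hx' => simp only [add_mul_aux, map_add, hx, hx', add_mul]
  | hs a p =>
    induction y using induction_on with
    | h0 => simp only [mul_zero_aux, map_zero, mul_zero]
    | hadd y y' hy hy' => simp only [mul_add_aux, map_add, hy, hy', mul_add]
    | hs b q =>
      simp only [smul_mul_aux, mul_smul_aux, map_smul, smul_mul_assoc, mul_smul_comm]
      congr 2
      obtain ⟨p1, p2, p⟩ := p
      obtain ⟨q1, q2, q⟩ := q
      rw [ofPath_mul_ofPath, actLin_ofPath, actLin_ofPath]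
      by_cases h : q2 = p1
      · subst h
        rw [pathMul_of_eq, actLin_ofPath]
        exact pathEnd_comp c q p
      -- If the paths cannot be composed, the idempotents of the two different vertices are inserted
      -- between them; their product is zero.
      · rw [pathMul_of_ne (by exact h), map_zero, ← pathEnd_mul_vertexEnd c p,
          ← vertexEnd_mul_pathEnd c q, mul_assoc, ← mul_assoc (vertexEnd A σ p1),
          vertexEnd_mul_of_ne (Ne.symm h), zero_mul, mul_zero]

/-- The free module on `σ` as a module over the path algebra, for given coefficients. -/
def act [Fintype V] (c : CoordIndex σ → A) :
    PathAlgebra A V →ₐ[A] Module.End A ({q // q ∈ σ} → A) :=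
  AlgHom.ofLinearMap (actLin c)
    (by
      change actLin c (∑ v : V, ofPath A (vertexPath v)) = 1
      simp only [map_sum, actLin_ofPath]
      exact sum_vertexEnd)
    (actLin_mul c)

theorem act_ofPath [Fintype V] (c : CoordIndex σ → A) (p : QPath V) :
    act c (ofPath A p) = pathEnd c p.2.2 := actLin_ofPath c p

/-- The image of `ẑ_r` in the free module on `σ`. -/
def topVec (c : CoordIndex σ → A) (r : Fin t) : {q // q ∈ σ} → A :=
  normalForm c (topVertex e r)

theorem act_vertex_topVec [Fintype V] (c : CoordIndex σ → A) (r : Fin t) :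
    act c (ofPath A (vertexPath (e r))) (topVec c r) = topVec c r := by
  rw [act_ofPath]
  exact vertexEnd_normalForm c (topVertex e r)

/-! ### Change of rings -/

/-- The representation is built from c by ring operations only, so it commutes with ring
homomorphisms. This serves both for the evaluation of the variables at a point and for the descent
to a subfield. -/
theorem normalForm_map {B : Type*} [CommRing B] (f : A →+* B) (c : CoordIndex σ → A)
    (y : TopPath e) (q : {q // q ∈ σ}) :
    normalForm (fun ν => f (c ν)) y q = f (normalForm c y q) := by
  classical
  by_cases hy : y ∈ σ
  · rw [normalForm_of_mem _ hy, normalForm_of_mem _ hy, Pi.single_apply, Pi.single_apply]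
    split_ifs <;> simp
  by_cases hc : IsCritical σ y
  · rw [normalForm_of_critical _ hc, normalForm_of_critical _ hc, Finset.sum_apply,
      Finset.sum_apply, map_sum]
    refine Finset.sum_congr rfl fun q' _ => ?_
    rw [Pi.smul_apply, Pi.smul_apply, smul_eq_mul, smul_eq_mul, map_mul, Pi.single_apply,
      Pi.single_apply]
    split_ifs <;> simp
  · simp [normalForm, hy, hc]

theorem pathEnd_map {B : Type*} [CommRing B] (f : A →+* B) (c : CoordIndex σ → A)
    {a b : V} (p : Quiver.Path a b) (v : {q // q ∈ σ} → A) (q : {q // q ∈ σ}) :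
    pathEnd (fun ν => f (c ν)) p (fun q => f (v q)) q = f (pathEnd c p v q) := by
  classical
  induction p generalizing q with
  | nil =>
    simp only [pathEnd, vertexEnd, Fintype.linearCombination_apply, Finset.sum_apply, map_sum,
      Pi.smul_apply, smul_eq_mul, map_mul]
    refine Finset.sum_congr rfl fun q' _ => ?_
    split_ifs
    · rw [Pi.single_apply, Pi.single_apply]
      split_ifs <;> simp
    · simp
  | cons p α ih =>
    rw [pathEnd, pathEnd, Module.End.mul_apply, Module.End.mul_apply, funext ih]
    simp only [arrowEnd, Fintype.linearCombination_apply, Finset.sum_apply, map_sum,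
      Pi.smul_apply, smul_eq_mul, map_mul]
    refine Finset.sum_congr rfl fun q' _ => ?_
    split_ifs
    · rw [normalForm_map]
    · simp

theorem act_map [Fintype V] {B : Type*} [CommRing B] (f : A →+* B) (c : CoordIndex σ → A)
    (a : PathAlgebra A V) (v : {q // q ∈ σ} → A) (q : {q // q ∈ σ}) :
    act (fun ν => f (c ν)) (mapCoeff f a) (fun q => f (v q)) q = f (act c a v q) := by
  induction a using induction_on with
  | h0 => simp [mapCoeff_zero]
  | hadd a b ha hb =>
    simp only [mapCoeff_add, map_add, LinearMap.add_apply, Pi.add_apply, ha, hb]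
  | hs a p =>
    simp only [mapCoeff_smul, mapCoeff_ofPath, map_smul, LinearMap.smul_apply, Pi.smul_apply,
      smul_eq_mul, map_mul, act_ofPath, pathEnd_map]

/-! ### Closure under initial subpaths -/

/-- The combinatorial conditions on a skeleton, without the bound on the length. -/
structure IsPathClosed (σ : Finset (TopPath e)) : Prop where
  top_mem : ∀ r : Fin t, topVertex e r ∈ σ
  init_mem : ∀ (r : Fin t) (a b : V) (p : Quiver.Path (e r) a) (α : a ⟶ b),
    (⟨r, b, p.cons α⟩ : TopPath e) ∈ σ → (⟨r, a, p⟩ : TopPath e) ∈ σ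

theorem IsAbstractSkeleton.isPathClosed {L : ℕ} (h : IsAbstractSkeleton L σ) :
    IsPathClosed σ where
  top_mem := h.nil_mem
  init_mem r a b p α hp := h.initial_mem r a b p α.toPath hp

/-! ### Modules generated by elements normed by vertices -/

variable {M : Type*} [AddCommGroup M] [Module A M] [Fintype V]

/-- The element `p x_r` of a module over the path algebra. -/
def pathAt (φ : PathAlgebra A V →ₐ[A] Module.End A M) (x : Fin t → M) (y : TopPath e) : M :=
  φ (ofPath A y.toQPath) (x y.1)

theorem pathAt_snoc (φ : PathAlgebra A V →ₐ[A] Module.End A M) (x : Fin t → M) (q : TopPath e)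
    {a b : V} (h : q.2.1 = a) (α : a ⟶ b) :
    pathAt φ x (q.snoc h α) = φ (ofPath A ⟨a, b, α.toPath⟩) (pathAt φ x q) := by
  subst h
  rw [pathAt, pathAt, ← Module.End.mul_apply, ← map_mul]
  exact congrArg (fun z => φ z (x q.1)) (ofPath_cons q.2.2 α)

theorem map_vertex_pathAt (φ : PathAlgebra A V →ₐ[A] Module.End A M) (x : Fin t → M)
    (q : TopPath e) : φ (ofPath A (vertexPath q.2.1)) (pathAt φ x q) = pathAt φ x q := by
  rw [pathAt, ← Module.End.mul_apply, ← map_mul]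
  exact congrArg (fun z => φ z (x q.1)) (vertex_mul_ofPath q.2.2)

theorem map_path_pathAt_of_ne (φ : PathAlgebra A V →ₐ[A] Module.End A M) (x : Fin t → M)
    (q : TopPath e) (p : QPath V) (h : q.2.1 ≠ p.1) :
    φ (ofPath A p) (pathAt φ x q) = 0 := by
  rw [pathAt, ← Module.End.mul_apply, ← map_mul, ofPath_mul_ofPath, pathMul_of_ne (by exact h),
    map_zero, LinearMap.zero_apply]

/-- The family `c` expresses the critical paths of a module through their `σ`-sets. -/
def Relations (φ : PathAlgebra A V →ₐ[A] Module.End A M) (x : Fin t → M)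
    (c : CoordIndex σ → A) : Prop :=
  ∀ y : {y : TopPath e // IsCritical σ y},
    pathAt φ x y.1 = ∑ q : {q : TopPath e // q ∈ sigmaSet σ y.1}, c ⟨y, q⟩ • pathAt φ x q.1

/-- The linear map which sends the basis elements `q ∈ σ` to the elements `q` of a module. -/
def realize (φ : PathAlgebra A V →ₐ[A] Module.End A M) (x : Fin t → M)
    (σ : Finset (TopPath e)) : ({q // q ∈ σ} → A) →ₗ[A] M :=
  Fintype.linearCombination A fun q => pathAt φ x q.1

open Classical in
theorem realize_single (φ : PathAlgebra A V →ₐ[A] Module.End A M) (x : Fin t → M)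
    (q : {q // q ∈ σ}) : realize φ x σ (Pi.single q 1) = pathAt φ x q.1 := by
  rw [realize, Fintype.linearCombination_apply_single, one_smul]

theorem realize_normalForm {φ : PathAlgebra A V →ₐ[A] Module.End A M} {x : Fin t → M}
    {c : CoordIndex σ → A} (hc : Relations φ x c) {y : TopPath e}
    (hy : y ∈ σ ∨ IsCritical σ y) : realize φ x σ (normalForm c y) = pathAt φ x y := by
  classical
  rcases hy with hy | hy
  · rw [normalForm_of_mem c hy, realize_single]
  · rw [normalForm_of_critical c hy, map_sum, hc ⟨y, hy⟩]
    refine Finset.sum_congr rfl fun q _ => ?_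
    rw [map_smul, realize_single]

/-- The relations say precisely that an arrow acts on the elements pathAt of M by the formula that
defines `arrowEnd`. No independence is needed. -/
theorem realize_pathEnd {φ : PathAlgebra A V →ₐ[A] Module.End A M} {x : Fin t → M}
    {c : CoordIndex σ → A} (hc : Relations φ x c) {a b : V} (p : Quiver.Path a b)
    (v : {q // q ∈ σ} → A) :
    realize φ x σ (pathEnd c p v) = φ (ofPath A ⟨a, b, p⟩) (realize φ x σ v) := by
  classical
  induction p with
  | nil =>
    suffices h : realize φ x σ ∘ₗ vertexEnd A σ a =
        φ (ofPath A (vertexPath a)) ∘ₗ realize φ x σ from LinearMap.congr_fun h v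
    refine end_ext fun q => ?_
    rw [LinearMap.comp_apply, LinearMap.comp_apply, vertexEnd_single, realize_single]
    split_ifs with h
    · subst h
      rw [realize_single, map_vertex_pathAt]
    · rw [map_zero, map_path_pathAt_of_ne φ x q.1 _ (by exact h)]
  | cons p α ih =>
    rename_i b d
    rw [pathEnd, Module.End.mul_apply, ofPath_cons, map_mul, Module.End.mul_apply, ← ih]
    generalize pathEnd c p v = u
    suffices h : realize φ x σ ∘ₗ arrowEnd c α =
        φ (ofPath A ⟨b, d, α.toPath⟩) ∘ₗ realize φ x σ from LinearMap.congr_fun h u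
    refine end_ext fun q => ?_
    rw [LinearMap.comp_apply, LinearMap.comp_apply, arrowEnd_single, realize_single]
    split_ifs with h
    · rw [← pathAt_snoc φ x q.1 h α]
      refine realize_normalForm hc ?_
      by_cases hs : q.1.snoc h α ∈ σ
      · exact Or.inl hs
      · exact Or.inr (isCritical_snoc q.2 h α hs)
    · rw [map_zero, map_path_pathAt_of_ne φ x q.1 _ (by exact h)]

theorem realize_act {φ : PathAlgebra A V →ₐ[A] Module.End A M} {x : Fin t → M}
    {c : CoordIndex σ → A} (hc : Relations φ x c) (a : PathAlgebra A V)
    (v : {q // q ∈ σ} → A) :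
    realize φ x σ (act c a v) = φ a (realize φ x σ v) := by
  induction a using induction_on with
  | h0 => simp only [map_zero, LinearMap.zero_apply]
  | hadd a b ha hb => simp only [map_add, LinearMap.add_apply, ha, hb]
  | hs a p =>
    simp only [map_smul, LinearMap.smul_apply, act_ofPath]
    rw [realize_pathEnd hc]

theorem realize_topVec {φ : PathAlgebra A V →ₐ[A] Module.End A M} {x : Fin t → M}
    (hσ : IsPathClosed σ) (c : CoordIndex σ → A)
    (hx : ∀ r, φ (ofPath A (vertexPath (e r))) (x r) = x r) (r : Fin t) :
    realize φ x σ (topVec c r) = x r := by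
  classical
  rw [topVec, normalForm_of_mem c (hσ.top_mem r), realize_single]
  exact hx r

/-- All initial subpaths of a path in σ belong to σ, so the critical case of the arrow action never
occurs on the way. -/
theorem pathAt_act_of_mem (hσ : IsPathClosed σ) (c : CoordIndex σ → A) {y : TopPath e}
    (hy : y ∈ σ) : pathAt (act c) (topVec c) y = normalForm c y := by
  classical
  obtain ⟨r, b, p⟩ := y
  induction p with
  | nil => exact act_vertex_topVec c r
  | cons p α ih =>
    rename_i a b
    have hp := hσ.init_mem r a b p α hy
    have h := pathAt_snoc (act c) (topVec c) (⟨r, a, p⟩ : TopPath e) rfl α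
    refine h.trans ?_
    rw [ih hp, normalForm_of_mem c hp, act_ofPath]
    change arrowEnd c α (vertexEnd A σ a _) = _
    rw [← Module.End.mul_apply, arrowEnd_mul_vertexEnd, arrowEnd_single, dif_pos rfl]
    rfl

theorem pathAt_act_of_critical (hσ : IsPathClosed σ) (c : CoordIndex σ → A) {y : TopPath e}
    (hy : IsCritical σ y) : pathAt (act c) (topVec c) y = normalForm c y := by
  classical
  obtain ⟨hyσ, r, a, b, p, α, hp, rfl⟩ := hy
  refine (pathAt_snoc (act c) (topVec c) (⟨r, a, p⟩ : TopPath e) rfl α).trans ?_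
  rw [pathAt_act_of_mem hσ c hp, normalForm_of_mem c hp, act_ofPath]
  change arrowEnd c α (vertexEnd A σ a _) = _
  rw [← Module.End.mul_apply, arrowEnd_mul_vertexEnd, arrowEnd_single, dif_pos rfl]
  rfl

open Classical in
theorem pathAt_act_single (hσ : IsPathClosed σ) (c : CoordIndex σ → A) (q : {q // q ∈ σ}) :
    pathAt (act c) (topVec c) q.1 = Pi.single q 1 := by
  rw [pathAt_act_of_mem hσ c q.2, normalForm_of_mem c q.2]

/-- Every family c thus occurs as coefficients of a module over the path algebra; only the ideal I
imposes conditions on c. -/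
theorem relations_act (hσ : IsPathClosed σ) (c : CoordIndex σ → A) :
    Relations (act c) (topVec c) c := by
  classical
  intro y
  rw [pathAt_act_of_critical hσ c y.2, normalForm_of_critical c y.2]
  refine Finset.sum_congr rfl fun q _ => ?_
  rw [pathAt_act_single hσ c ⟨q.1, mem_of_mem_sigmaSet q.2⟩]

end Action

/-! ## The radical of `Λ` and of its modules -/

section Radical

variable {K V : Type*} [Field K] [Fintype V] [Quiver V] (I : Ideal (PathAlgebra K V))
  [I.IsTwoSided]

/-- The canonical epimorphism `KΓ → Λ` as a homomorphism of algebras. -/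
def toLamAlg : PathAlgebra K V →ₐ[K] Lam I := Ideal.Quotient.mkₐ K I

theorem toLam_surjective : Function.Surjective (toLam I) := Ideal.Quotient.mk_surjective

theorem toLam_eq_zero_iff (x : PathAlgebra K V) : toLam I x = 0 ↔ x ∈ I :=
  Ideal.Quotient.eq_zero_iff_mem

/-- The span in `Λ` of the paths of length at least `l`. -/
def pathSpan (l : ℕ) : Submodule K (Lam I) :=
  Submodule.span K {y | ∃ p : QPath V, l ≤ p.2.2.length ∧ y = toLamAlg I (ofPath K p)}

theorem toLam_mem_of_forall {N : Submodule K (Lam I)} (x : PathAlgebra K V)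
    (h : ∀ p, coeff x p ≠ 0 → toLamAlg I (ofPath K p) ∈ N) : toLamAlg I x ∈ N := by
  rw [eq_sum_coeff x]
  unfold Finsupp.sum
  rw [map_sum]
  refine Submodule.sum_mem _ fun p hp => ?_
  rw [map_smul]
  exact N.smul_mem _ (h p (Finsupp.mem_support_iff.1 hp))

theorem pathSpan_zero : pathSpan I 0 = ⊤ := by
  refine eq_top_iff.2 fun y _ => ?_
  obtain ⟨x, rfl⟩ := toLam_surjective I y
  exact toLam_mem_of_forall I x fun p _ => Submodule.subset_span ⟨p, Nat.zero_le _, rfl⟩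

theorem mul_mem_pathSpan {j l : ℕ} {x y : Lam I} (hx : x ∈ pathSpan I j)
    (hy : y ∈ pathSpan I l) : x * y ∈ pathSpan I (j + l) := by
  refine Submodule.span_induction₂ (p := fun x y _ _ => x * y ∈ pathSpan I (j + l)) ?_ ?_ ?_ ?_ ?_ ?_ ?_ hx hy
  · rintro _ _ ⟨⟨p1, p2, p⟩, hp, rfl⟩ ⟨⟨q1, q2, q⟩, hq, rfl⟩
    rw [← map_mul, ofPath_mul_ofPath]
    by_cases h : q2 = p1
    · subst h
      rw [pathMul_of_eq]
      refine Submodule.subset_span ⟨_, ?_, rfl⟩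
      dsimp only at hp hq ⊢
      rw [Quiver.Path.length_comp]
      omega
    · rw [pathMul_of_ne (by exact h), map_zero]
      exact Submodule.zero_mem _
  · intro y _; rw [zero_mul]; exact Submodule.zero_mem _
  · intro y _; rw [mul_zero]; exact Submodule.zero_mem _
  · intro x y z _ _ _ h1 h2; rw [add_mul]; exact Submodule.add_mem _ h1 h2
  · intro x y z _ _ _ h1 h2; rw [mul_add]; exact Submodule.add_mem _ h1 h2
  · intro r x y _ _ h; rw [smul_mul_assoc]; exact Submodule.smul_mem _ _ h
  · intro r x y _ _ h; rw [mul_smul_comm]; exact Submodule.smul_mem _ _ h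

-- A composite of two paths is trivial only if both are trivial at the same vertex. So the
-- coefficient of a trivial path is a character of the path algebra, which separates the vertices
-- from the radical.
omit [Fintype V] in
theorem coeff_vertex_mul (v : V) (x y : PathAlgebra K V) :
    coeff (x * y) (vertexPath v) = coeff x (vertexPath v) * coeff y (vertexPath v) := by
  classical
  induction x using induction_on with
  | h0 => rw [zero_mul_aux, coeff_zero, zero_mul]
  | hadd x x' hx hx' => rw [add_mul_aux, coeff_add, coeff_add, hx, hx', add_mul]
  | hs a p =>
    induction y using induction_on with
    | h0 => rw [mul_zero_aux, coeff_zero, mul_zero]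
    | hadd y y' hy hy' => rw [mul_add_aux, coeff_add, coeff_add, hy, hy', mul_add]
    | hs b q =>
      simp only [smul_mul_aux, mul_smul_aux, coeff_smul, coeff_ofPath, ofPath_mul_ofPath]
      have key : coeff (pathMul K p q) (vertexPath v) =
          (if p = vertexPath v then 1 else 0) * (if q = vertexPath v then 1 else 0) := by
        by_cases hq : q = vertexPath v
        · subst hq
          rw [if_pos rfl, mul_one]
          obtain ⟨p1, p2, p⟩ := p
          by_cases h : v = p1
          · subst h
            rw [vertexPath, pathMul_of_eq, Quiver.Path.nil_comp, coeff_ofPath]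
          · rw [pathMul_of_ne (by exact h), coeff_zero, if_neg]
            intro h'
            exact h (congrArg Sigma.fst h').symm
        · rw [if_neg hq, mul_zero]
          obtain ⟨p1, p2, p⟩ := p
          obtain ⟨q1, q2, q⟩ := q
          by_cases h : q2 = p1
          · subst h
            rw [pathMul_of_eq, coeff_ofPath, if_neg]
            intro h'
            apply hq
            have hl : (q.comp p).length = 0 :=
              congrArg (fun z : QPath V => z.2.2.length) h'
            rw [Quiver.Path.length_comp] at hl
            have hq0 : q.length = 0 := by omega
            have hv : q1 = v := congrArg Sigma.fst h'
            subst hv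
            obtain rfl := Quiver.Path.eq_of_length_zero q hq0
            rw [Quiver.Path.eq_nil_of_length_zero q hq0, vertexPath]
          · rw [pathMul_of_ne (by exact h), coeff_zero]
      rw [key]
      ring

theorem coeff_vertex_one (v : V) : coeff (1 : PathAlgebra K V) (vertexPath v) = 1 := by
  classical
  have h := coeff_vertex_mul v (ofPath K (vertexPath v)) 1
  rw [mul_one_aux, coeff_ofPath, if_pos rfl, one_mul] at h
  exact h.symm

variable {I} (hI : IsAdmissible I)

include hI

theorem exists_pathSpan_eq_bot : ∃ m, pathSpan I m = ⊥ := by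
  obtain ⟨m, hm⟩ := hI.1
  refine ⟨m, ?_⟩
  rw [pathSpan, Submodule.span_eq_bot]
  rintro _ ⟨p, hp, rfl⟩
  exact (toLam_eq_zero_iff I _).2 (hm p hp)

/-- The character descends to Λ because the elements of I involve only paths of length at least two.
A surjective ring homomorphism carries the radical into the radical, and that of the field K is
zero. -/
theorem toLam_coeff_vertex_eq_zero {x : PathAlgebra K V}
    (hx : toLam I x ∈ Ring.jacobson (Lam I)) (v : V) : coeff x (vertexPath v) = 0 := by
  let g : PathAlgebra K V →+* K :=
    { toFun := fun x => coeff x (vertexPath v)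
      map_one' := coeff_vertex_one v
      map_mul' := coeff_vertex_mul v
      map_zero' := coeff_zero _
      map_add' := fun x y => coeff_add x y _ }
  have hg : ∀ x ∈ I, g x = 0 := fun x hx => hI.2 x hx (vertexPath v) Nat.zero_lt_two
  let f : Lam I →+* K := Ideal.Quotient.lift I g hg
  have hf : Function.Surjective f := fun a => by
    classical
    refine ⟨toLam I (a • ofPath K (vertexPath v)), ?_⟩
    change coeff (a • ofPath K (vertexPath v)) (vertexPath v) = a
    rw [coeff_smul, coeff_ofPath, if_pos rfl, mul_one]
  have : RingHomSurjective f := ⟨hf⟩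
  have h := Ring.le_comap_jacobson f hx
  rw [IsSemisimpleRing.jacobson_eq_bot] at h
  exact h

/-- By the characters at the vertices, an element of J has no term of length zero. Conversely, every
left multiple of a path of positive length is nilpotent: its k-th power lies in `pathSpan I k`,
which is zero for large k. -/
theorem jacobson_eq_pathSpan : (Ring.jacobson (Lam I)).restrictScalars K = pathSpan I 1 := by
  refine le_antisymm ?_ (Submodule.span_le.2 ?_)
  · intro y hy
    obtain ⟨x, rfl⟩ := toLam_surjective I y
    refine toLam_mem_of_forall I x fun p hp => Submodule.subset_span ⟨p, ?_, rfl⟩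
    by_contra hlt
    obtain ⟨a, b, p⟩ := p
    have h0 : p.length = 0 := Nat.lt_one_iff.1 (not_le.1 hlt)
    obtain rfl := Quiver.Path.eq_of_length_zero p h0
    rw [Quiver.Path.eq_nil_of_length_zero p h0] at hp
    exact hp (toLam_coeff_vertex_eq_zero hI hy a)
  · rintro _ ⟨p, hp, rfl⟩
    rw [SetLike.mem_coe, Submodule.restrictScalars_mem, ← Ideal.jacobson_bot,
      Ideal.mem_jacobson_iff]
    intro y
    have h1 : y * toLamAlg I (ofPath K p) ∈ pathSpan I 1 := by
      have h0 : y ∈ pathSpan I 0 := by rw [pathSpan_zero]; trivial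
      have := mul_mem_pathSpan I h0 (Submodule.subset_span ⟨p, hp, rfl⟩)
      rwa [zero_add] at this
    have hpow : ∀ k, (y * toLamAlg I (ofPath K p)) ^ k ∈ pathSpan I k := by
      intro k
      induction k with
      | zero => rw [pathSpan_zero]; trivial
      | succ k ih => rw [pow_succ]; exact mul_mem_pathSpan I ih h1
    obtain ⟨m, hm⟩ := exists_pathSpan_eq_bot hI
    have hnil : IsNilpotent (y * toLamAlg I (ofPath K p)) :=
      ⟨m, by simpa [hm] using hpow m⟩
    obtain ⟨z, hz⟩ := hnil.isUnit_add_one.exists_left_inv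
    refine ⟨z, ?_⟩
    rw [Submodule.mem_bot, sub_eq_zero, ← hz, mul_assoc, mul_add, mul_one]

theorem jacobson_pow_eq_pathSpan (l : ℕ) :
    ((Ring.jacobson (Lam I)) ^ l).restrictScalars K = pathSpan I l := by
  refine le_antisymm ?_ (Submodule.span_le.2 ?_)
  · induction l with
    | zero => rw [pathSpan_zero]; exact le_top
    | succ l ih =>
      intro y hy
      rw [Submodule.restrictScalars_mem, Submodule.pow_succ, ← Ideal.smul_eq_mul] at hy
      refine Submodule.smul_induction_on hy (fun a ha b hb => ?_)
        fun a b ha hb => Submodule.add_mem _ ha hb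
      refine mul_mem_pathSpan I (ih ha) ?_
      rw [← jacobson_eq_pathSpan hI]
      exact hb
  · rintro _ ⟨⟨a, b, p⟩, hp, rfl⟩
    rw [SetLike.mem_coe, Submodule.restrictScalars_mem]
    refine Ideal.pow_le_pow_right hp ?_
    clear hp
    induction p with
    | nil =>
      rw [Quiver.Path.length_nil, Submodule.pow_zero, Ideal.one_eq_top]
      exact Submodule.mem_top
    | cons p α ih =>
      rename_i b d
      have hα : toLamAlg I (ofPath K ⟨b, d, α.toPath⟩) ∈ Ring.jacobson (Lam I) := by
        rw [← Submodule.restrictScalars_mem K, jacobson_eq_pathSpan hI]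
        exact Submodule.subset_span ⟨_, le_rfl, rfl⟩
      change _ ∈ Ring.jacobson (Lam I) ^ (p.length + 1)
      rw [ofPath_cons, map_mul]
      -- The splitting of a power of J from the left is used for nonzero exponents only. A trivial p
      -- is absorbed because J is two-sided.
      by_cases h0 : p.length = 0
      · rw [h0, Submodule.pow_succ, Submodule.pow_zero, Submodule.one_mul]
        exact Ideal.mul_mem_right _ _ hα
      · rw [Submodule.pow_succ' _ h0]
        exact Ideal.mul_mem_mul hα ih

theorem jacobson_pow_maxLength : (Ring.jacobson (Lam I)) ^ (maxLength I + 1) = ⊥ := by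
  have hne : {m : ℕ | (Ring.jacobson (Lam I)) ^ m = ⊥}.Nonempty := by
    obtain ⟨m, hm⟩ := exists_pathSpan_eq_bot hI
    refine ⟨m, ?_⟩
    rw [← jacobson_pow_eq_pathSpan hI] at hm
    exact (Submodule.restrictScalars_eq_bot_iff _ _ _).1 hm
  have h : (Ring.jacobson (Lam I)) ^ loewyLength (Lam I) = ⊥ := Nat.sInf_mem hne
  -- Only the inequality between the Loewy length and `maxLength I + 1` is needed. It also holds for
  -- Λ = 0, where the truncated subtraction gives `maxLength I = 0`.
  refine eq_bot_iff.2 ((Ideal.pow_le_pow_right ?_).trans h.le)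
  unfold maxLength
  omega

variable {M : Type*} [AddCommGroup M] [Module (Lam I) M]

theorem smul_mem_radPow {l : ℕ} (p : QPath V) (hp : l ≤ p.2.2.length) (m : M) :
    toLam I (ofPath K p) • m ∈ radPow (Lam I) M l := by
  refine Submodule.smul_mem_smul ?_ Submodule.mem_top
  rw [← Submodule.restrictScalars_mem K, jacobson_pow_eq_pathSpan hI]
  exact Submodule.subset_span ⟨p, hp, rfl⟩

omit hI in
theorem radPow_zero : radPow (Lam I) M 0 = ⊤ := by
  rw [radPow, Submodule.pow_zero, Ideal.one_eq_top, Submodule.top_smul]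

theorem radPow_maxLength : radPow (Lam I) M (maxLength I + 1) = ⊥ := by
  rw [radPow, jacobson_pow_maxLength hI, Submodule.bot_smul]

variable [Module K M] [IsScalarTower K (Lam I) M]

/-- Here N is merely a K-subspace, such as a span of paths, and need not be known to be a
Λ-submodule. Testing on paths suffices because they span J^l over K. -/
theorem radPow_le {l : ℕ} {N : Submodule K M}
    (h : ∀ p : QPath V, l ≤ p.2.2.length → ∀ m : M, toLam I (ofPath K p) • m ∈ N) :
    (radPow (Lam I) M l).restrictScalars K ≤ N := by
  intro y hy
  have hy' : y ∈ (Ring.jacobson (Lam I)) ^ l • (⊤ : Submodule (Lam I) M) := hy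
  refine Submodule.smul_induction_on hy' (fun a ha m _ => ?_) fun a b ha hb => N.add_mem ha hb
  rw [← Submodule.restrictScalars_mem K, jacobson_pow_eq_pathSpan hI] at ha
  refine Submodule.span_induction (p := fun a _ => a • m ∈ N) ?_ ?_ ?_ ?_ ha
  · rintro _ ⟨p, hp, rfl⟩
    exact h p hp m
  · rw [zero_smul]; exact N.zero_mem
  · intro a b _ _ ha hb; rw [add_smul]; exact N.add_mem ha hb
  · intro k a _ ha; rw [smul_assoc]; exact N.smul_mem _ ha

end Radical

/-! ## A basis criterion for skeleta -/

section Criterion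

variable {K V : Type*} [Field K] [Fintype V] [Quiver V] {I : Ideal (PathAlgebra K V)}
  [I.IsTwoSided] {t : ℕ} {e : Fin t → V} {σ : Finset (TopPath e)}
  {M : Type*} [AddCommGroup M] [Module K M] [Module (Lam I) M] [IsScalarTower K (Lam I) M]

variable (I M) in
/-- The action of the path algebra on a module over `Λ`. -/
def lamAct : PathAlgebra K V →ₐ[K] Module.End K M :=
  (Algebra.lsmul K K M).comp (toLamAlg I)

theorem lamAct_apply (a : PathAlgebra K V) (m : M) : lamAct I M a m = toLam I a • m := rfl

theorem pathAt_lamAct (x : Fin t → M) (y : TopPath e) :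
    pathAt (lamAct I M) x y = toLam I (ofPath K y.toQPath) • x y.1 := rfl

/-- The elements `p x_r`, for `p ẑ_r ∈ σ`, form a basis of `M` which is compatible with the
structure of `M`. -/
structure IsSkeletonBasis (σ : Finset (TopPath e)) (x : Fin t → M) : Prop where
  normed : ∀ r, lamAct I M (ofPath K (vertexPath (e r))) (x r) = x r
  indep : LinearIndependent K fun q : {q // q ∈ σ} => pathAt (lamAct I M) x q.1
  span_eq : Submodule.span K
    (Set.range fun q : {q // q ∈ σ} => pathAt (lamAct I M) x q.1) = ⊤
  relations : ∃ c : CoordIndex σ → K, Relations (lamAct I M) x c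

/-- The span of the elements `p x_r`, where `p ẑ_r` has length at least `l`. -/
def lengthSpan (σ : Finset (TopPath e)) (x : Fin t → M) (l : ℕ) : Submodule K M :=
  Submodule.span K ((fun q : {q // q ∈ σ} => pathAt (lamAct I M) x q.1) ''
    {q | l ≤ q.1.length})

instance (l : ℕ) : Fintype {q // q ∈ σ ∧ TopPath.length q = l} :=
  Fintype.subtype (σ.filter fun q => q.length = l) fun _ => Finset.mem_filter

theorem pathAt_mem_lengthSpan {x : Fin t → M} {l : ℕ} {q : TopPath e} (hq : q ∈ σ)
    (hl : l ≤ q.length) : pathAt (lamAct I M) x q ∈ lengthSpan (I := I) σ x l :=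
  Submodule.subset_span ⟨⟨q, hq⟩, hl, rfl⟩

theorem lengthSpan_zero (x : Fin t → M) : lengthSpan (I := I) σ x 0 =
    Submodule.span K (Set.range fun q : {q // q ∈ σ} => pathAt (lamAct I M) x q.1) := by
  rw [lengthSpan]
  congr 1
  ext m
  simp

/-- An arrow prolongs a path of σ to a longer path of σ or to a critical path. The latter is
replaced by its σ-set, whose members are at least as long; hence the length condition in the
definition of σ-sets. -/
theorem arrow_smul_mem_lengthSpan {x : Fin t → M} {c : CoordIndex σ → K}
    (hc : Relations (lamAct I M) x c) {l : ℕ} {a b : V} (α : a ⟶ b) {m : M}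
    (hm : m ∈ lengthSpan (I := I) σ x l) :
    lamAct I M (ofPath K ⟨a, b, α.toPath⟩) m ∈ lengthSpan (I := I) σ x (l + 1) := by
  refine Submodule.span_induction (p := fun m _ => lamAct I M (ofPath K ⟨a, b, α.toPath⟩) m ∈
    lengthSpan (I := I) σ x (l + 1)) ?_ ?_ ?_ ?_ hm
  · rintro _ ⟨q, hq, rfl⟩
    dsimp only
    by_cases h : q.1.2.1 = a
    · rw [← pathAt_snoc _ x q.1 h α]
      have hlen : l + 1 ≤ (q.1.snoc h α).length := Nat.succ_le_succ (by
        have : l ≤ q.1.length := hq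
        subst h
        exact this)
      by_cases hs : q.1.snoc h α ∈ σ
      · exact pathAt_mem_lengthSpan hs hlen
      · rw [hc ⟨_, isCritical_snoc q.2 h α hs⟩]
        exact Submodule.sum_mem _ fun q' _ => Submodule.smul_mem _ _
          (pathAt_mem_lengthSpan (mem_of_mem_sigmaSet q'.2)
            (hlen.trans (length_le_of_mem_sigmaSet q'.2)))
    · rw [map_path_pathAt_of_ne _ x q.1 _ (by exact h)]
      exact Submodule.zero_mem _
  · rw [map_zero]; exact Submodule.zero_mem _
  · intro m n _ _ hm hn; rw [map_add]; exact Submodule.add_mem _ hm hn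
  · intro k m _ hm; rw [map_smul]; exact Submodule.smul_mem _ _ hm

theorem path_smul_mem_lengthSpan {x : Fin t → M} {c : CoordIndex σ → K}
    (hc : Relations (lamAct I M) x c) {l : ℕ} {a b : V} (p : Quiver.Path a b) {m : M}
    (hm : m ∈ lengthSpan (I := I) σ x l) :
    lamAct I M (ofPath K ⟨a, b, p⟩) m ∈ lengthSpan (I := I) σ x (l + p.length) := by
  induction p with
  | nil =>
    refine Submodule.span_induction (p := fun m _ => lamAct I M (ofPath K (vertexPath a)) m ∈
      lengthSpan (I := I) σ x l) ?_ ?_ ?_ ?_ hm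
    · rintro _ ⟨q, hq, rfl⟩
      by_cases h : q.1.2.1 = a
      · subst h
        rw [map_vertex_pathAt]
        exact pathAt_mem_lengthSpan q.2 hq
      · rw [map_path_pathAt_of_ne _ x q.1 _ (by exact h)]
        exact Submodule.zero_mem _
    · rw [map_zero]; exact Submodule.zero_mem _
    · intro m n _ _ hm hn; rw [map_add]; exact Submodule.add_mem _ hm hn
    · intro k m _ hm; rw [map_smul]; exact Submodule.smul_mem _ _ hm
  | cons p α ih =>
    rw [ofPath_cons, map_mul, Module.End.mul_apply]
    exact arrow_smul_mem_lengthSpan hc α ih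

theorem pathAt_mem_radPow (hI : IsAdmissible I) (x : Fin t → M) {l : ℕ} {y : TopPath e}
    (hl : l ≤ y.length) : pathAt (lamAct I M) x y ∈ radPow (Lam I) M l :=
  smul_mem_radPow hI _ hl _

theorem lengthSpan_le_radPow (hI : IsAdmissible I) (x : Fin t → M) (l : ℕ) :
    lengthSpan (I := I) σ x l ≤ (radPow (Lam I) M l).restrictScalars K := by
  refine Submodule.span_le.2 ?_
  rintro _ ⟨q, hq, rfl⟩
  exact pathAt_mem_radPow hI x hq

/-- A path of length l carries M, the span of all of σ, into the span of the paths of length at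
least l. So the relations force the radical filtration to be the filtration by length. -/
theorem radPow_eq_lengthSpan (hI : IsAdmissible I) {x : Fin t → M} {c : CoordIndex σ → K}
    (hc : Relations (lamAct I M) x c)
    (hs : Submodule.span K
      (Set.range fun q : {q // q ∈ σ} => pathAt (lamAct I M) x q.1) = ⊤) (l : ℕ) :
    (radPow (Lam I) M l).restrictScalars K = lengthSpan (I := I) σ x l := by
  refine le_antisymm (radPow_le hI fun p hp m => ?_) (lengthSpan_le_radPow hI x l)
  have hm : m ∈ lengthSpan (I := I) σ x 0 := by rw [lengthSpan_zero, hs]; trivial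
  have := path_smul_mem_lengthSpan hc p.2.2 hm
  rw [zero_add] at this
  refine Submodule.span_mono (Set.image_mono fun q hq => ?_) this
  exact hp.trans hq

theorem vertex_smul_zHat (r : Fin t) :
    ofPath K (vertexPath (e r)) • zHat K e r = zHat K e r := by
  refine funext fun s => ?_
  by_cases h : s = r
  · subst h
    refine Subtype.ext ?_
    change ofPath K (vertexPath (e s)) * (zHat K e s s).1 = (zHat K e s s).1
    rw [zHat, Pi.single_eq_same]
    exact vertex_mul_ofPath Quiver.Path.nil
  · refine Subtype.ext ?_
    change ofPath K (vertexPath (e r)) * (zHat K e r s).1 = (zHat K e r s).1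
    rw [zHat, Pi.single_eq_of_ne h]
    exact mul_zero_aux _

theorem map_pathHat {f : PHat K e →ₛₗ[toLam I] M} {x : Fin t → M}
    (hf : ∀ r, f (zHat K e r) = x r) (q : TopPath e) :
    f (pathHat K q) = pathAt (lamAct I M) x q := by
  rw [pathHat, map_smulₛₗ, hf, pathAt_lamAct]

/-- Bases of the layers J^l M/J^(l+1) M assemble to a basis of M since J^(L+1) M = 0. A critical
path of length l lies in J^l M, which is spanned by the paths of σ of length at least l; this yields
its relation. -/
theorem IsSkeletonRel.isSkeletonBasis (hI : IsAdmissible I)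
    (hσ : IsAbstractSkeleton (maxLength I) σ) {x : Fin t → M} (h : IsSkeletonRel I σ x) :
    IsSkeletonBasis (I := I) σ x := by
  classical
  obtain ⟨-, f, -, hf, hb⟩ := h
  have hfq : ∀ q : TopPath e, f (pathHat K q) = pathAt (lamAct I M) x q := map_pathHat hf
  have hnormed : ∀ r, lamAct I M (ofPath K (vertexPath (e r))) (x r) = x r := fun r => by
    rw [lamAct_apply, ← hf, ← map_smulₛₗ, vertex_smul_zHat]
  -- Descending induction on the exponent l = L + 1 - j, starting from J^(L+1) M = 0.
  have hrad : ∀ j ≤ maxLength I + 1, (radPow (Lam I) M (maxLength I + 1 - j)).restrictScalars K ≤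
      lengthSpan (I := I) σ x (maxLength I + 1 - j) := by
    intro j
    induction j with
    | zero =>
      intro _
      rw [Nat.sub_zero, radPow_maxLength hI]
      exact bot_le
    | succ j ih =>
      intro hj m hm
      obtain ⟨l, hl, hl'⟩ : ∃ l, maxLength I + 1 - (j + 1) = l ∧ maxLength I + 1 - j = l + 1 :=
        ⟨_, rfl, by omega⟩
      rw [hl'] at ih
      rw [hl] at hm ⊢
      obtain ⟨hmem, -, hspan⟩ := hb l (by omega)
      have hm' : ((radPow (Lam I) M (l + 1)).submoduleOf (radPow (Lam I) M l)).mkQ ⟨m, hm⟩ ∈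
          (⊤ : Submodule K _) := trivial
      rw [← hspan] at hm'
      obtain ⟨a, ha⟩ := (Submodule.mem_span_range_iff_exists_fun K).1 hm'
      let f' : radPow (Lam I) M l →ₗ[K] _ :=
        (((radPow (Lam I) M (l + 1)).submoduleOf (radPow (Lam I) M l)).mkQ).restrictScalars K
      -- Subtracting the combination of the paths of length l which represents the class of m leaves
      -- an element of J^(l+1) M.
      have hz : f' (⟨m, hm⟩ - ∑ q : {q // q ∈ σ ∧ TopPath.length q = l},
          a q • ⟨f (pathHat K q.1), hmem q⟩) = 0 := by
        rw [map_sub, map_sum, sub_eq_zero]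
        refine ha.symm.trans (Finset.sum_congr rfl fun q _ => ?_)
        exact (map_smul f' _ _).symm
      have hz' := (Submodule.Quotient.mk_eq_zero _).1 hz
      have hz'' : m - ∑ q : {q // q ∈ σ ∧ TopPath.length q = l}, a q • f (pathHat K q.1) ∈
          radPow (Lam I) M (l + 1) := by
        have := Submodule.mem_comap.1 hz'
        simpa using this
      have h1 := ih (by omega) hz''
      have h2 : lengthSpan (I := I) σ x (l + 1) ≤ lengthSpan (I := I) σ x l :=
        Submodule.span_mono (Set.image_mono fun q hq => (Nat.le_succ l).trans hq)
      rw [← sub_add_cancel m (∑ q : {q // q ∈ σ ∧ TopPath.length q = l},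
        a q • f (pathHat K q.1))]
      refine Submodule.add_mem _ (h2 h1) (Submodule.sum_mem _ fun q _ => ?_)
      rw [hfq]
      exact Submodule.smul_mem _ _ (pathAt_mem_lengthSpan q.2.1 q.2.2.ge)
  have hrad' : ∀ l ≤ maxLength I + 1, (radPow (Lam I) M l).restrictScalars K ≤
      lengthSpan (I := I) σ x l := fun l hl => by
    have := hrad (maxLength I + 1 - l) (by omega)
    rwa [Nat.sub_sub_self hl] at this
  refine ⟨hnormed, ?_, ?_, ?_⟩
  · rw [Fintype.linearIndependent_iff]
    intro a ha
    -- The coefficients of shorter paths already vanish and those of longer paths do not matter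
    -- modulo J^(l+1) M. What remains is a relation among the basis elements of one layer.
    suffices h : ∀ l, ∀ q : {q // q ∈ σ}, q.1.length = l → a q = 0 from fun q => h _ q rfl
    intro l
    induction l using Nat.strong_induction_on with
    | _ l ih =>
      intro q hq
      have hlL : l ≤ maxLength I := hq ▸ hσ.length_le q.1 q.2
      obtain ⟨hmem, hli, -⟩ := hb l hlL
      rw [Fintype.linearIndependent_iff] at hli
      refine hli (fun q => a ⟨q.1, q.2.1⟩) ?_ ⟨q.1, q.2, hq⟩
      let f' : radPow (Lam I) M l →ₗ[K] _ :=
        (((radPow (Lam I) M (l + 1)).submoduleOf (radPow (Lam I) M l)).mkQ).restrictScalars K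
      have hz : f' (∑ q : {q // q ∈ σ ∧ TopPath.length q = l},
          a ⟨q.1, q.2.1⟩ • ⟨f (pathHat K q.1), hmem q⟩) = 0 := by
        refine (Submodule.Quotient.mk_eq_zero _).2 ?_
        refine Submodule.mem_comap.2 ?_
        rw [Submodule.subtype_apply]
        have e1 : ((∑ q : {q // q ∈ σ ∧ TopPath.length q = l},
            a ⟨q.1, q.2.1⟩ • (⟨f (pathHat K q.1), hmem q⟩ : radPow (Lam I) M l) :
              radPow (Lam I) M l) : M) =
            ∑ q : {q // q ∈ σ}, if q.1.length = l then
              a q • pathAt (lamAct I M) x q.1 else 0 := by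
          rw [← Finset.sum_filter, Submodule.coe_sum]
          refine Finset.sum_bij' (fun q _ => ⟨q.1, q.2.1⟩)
            (fun q hq => ⟨q.1, q.2, (Finset.mem_filter.1 hq).2⟩) ?_ ?_ ?_ ?_ ?_
          · intro q _; simpa using q.2.2
          · intro q _; simp
          · intro q _; rfl
          · intro q _; rfl
          · intro q _
            rw [← hfq]
            rfl
        have e2 : (∑ q : {q // q ∈ σ}, if q.1.length = l then
              a q • pathAt (lamAct I M) x q.1 else 0) =
            - ∑ q : {q // q ∈ σ}, if l + 1 ≤ q.1.length then
              a q • pathAt (lamAct I M) x q.1 else 0 := by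
          rw [eq_neg_iff_add_eq_zero, ← Finset.sum_add_distrib]
          refine Eq.trans ?_ ha
          refine Finset.sum_congr rfl fun q _ => ?_
          rcases lt_trichotomy q.1.length l with h | h | h
          · rw [ih _ h q rfl, if_neg (by omega), if_neg (by omega)]
            simp
          · rw [if_pos h, if_neg (by omega), add_zero]
          · rw [if_neg (by omega), if_pos (by omega), zero_add]
        rw [e1, e2]
        refine Submodule.neg_mem _ (Submodule.sum_mem _ fun q _ => ?_)
        split_ifs with h
        · exact ((radPow (Lam I) M (l + 1)).restrictScalars K).smul_mem _
            (pathAt_mem_radPow hI x h)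
        · exact Submodule.zero_mem _
      rw [map_sum] at hz
      refine Eq.trans (Finset.sum_congr rfl fun q _ => ?_) hz
      exact (map_smul f' _ _).symm
  · rw [← lengthSpan_zero, eq_top_iff]
    intro m _
    refine hrad' 0 (Nat.zero_le _) ?_
    rw [radPow_zero]
    trivial
  · have hex : ∀ y : {y : TopPath e // IsCritical σ y},
        ∃ a : {q : TopPath e // q ∈ sigmaSet σ y.1} → K,
          ∑ q, a q • pathAt (lamAct I M) x q.1 = pathAt (lamAct I M) x y.1 := by
      rintro ⟨y, hy⟩
      refine (Submodule.mem_span_range_iff_exists_fun K).1 ?_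
      -- A critical path is one arrow longer than a path in σ. The extreme length L + 1 is harmless
      -- because `hrad'` includes the zero term of the filtration.
      have hlen : y.length ≤ maxLength I + 1 := by
        obtain ⟨-, r, a, b, p, α, hp, rfl⟩ := hy
        exact Nat.succ_le_succ (hσ.length_le _ hp)
      have hmem : pathAt (lamAct I M) x y ∈ lengthSpan (I := I) σ x y.length :=
        hrad' _ hlen (pathAt_mem_radPow hI x le_rfl)
      -- Applying the idempotent of the end vertex removes the paths which end elsewhere and so
      -- leaves exactly the σ-set.
      rw [← map_vertex_pathAt (lamAct I M) x y]
      refine Submodule.span_induction (p := fun m _ => lamAct I M (ofPath K (vertexPath y.2.1)) m ∈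
        Submodule.span K (Set.range fun q : {q : TopPath e // q ∈ sigmaSet σ y} =>
          pathAt (lamAct I M) x q.1)) ?_ ?_ ?_ ?_ hmem
      · rintro _ ⟨q, hq, rfl⟩
        by_cases h : q.1.2.1 = y.2.1
        · refine Submodule.subset_span ⟨⟨q.1, mem_sigmaSet.2 ⟨q.2, hq, h⟩⟩, ?_⟩
          change _ = lamAct I M (ofPath K (vertexPath y.2.1)) (pathAt (lamAct I M) x q.1)
          rw [← h, map_vertex_pathAt]
        · change lamAct I M (ofPath K (vertexPath y.2.1)) (pathAt (lamAct I M) x q.1) ∈ _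
          rw [map_path_pathAt_of_ne _ x q.1 _ (by exact h)]
          exact Submodule.zero_mem _
      · rw [map_zero]; exact Submodule.zero_mem _
      · intro m n _ _ hm hn; rw [map_add]; exact Submodule.add_mem _ hm hn
      · intro k m _ hm; rw [map_smul]; exact Submodule.smul_mem _ _ hm
    choose a ha using hex
    exact ⟨fun ν => a ν.1 ν.2, fun y => (ha y).symm⟩

/-- The basis is adapted to the radical filtration: J^l M is spanned by the members of length at
least l, so those of length exactly l give a basis of the l-th layer. -/
theorem IsSkeletonBasis.isSkeletonRel (hI : IsAdmissible I)
    (hσ : IsAbstractSkeleton (maxLength I) σ) {x : Fin t → M}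
    (h : IsSkeletonBasis (I := I) σ x) : IsSkeletonRel I σ x := by
  classical
  obtain ⟨hn, hli, hs, c, hc⟩ := h
  have hrad := radPow_eq_lengthSpan hI hc hs
  -- This is the independence modulo J^(l+1) M. The case l = 0 is used for the top elements, which
  -- are the paths of length zero.
  have hdisj : ∀ l : ℕ, Disjoint
      (Submodule.span K ((fun q : {q // q ∈ σ} => pathAt (lamAct I M) x q.1) ''
        {q | q.1.length = l}))
      ((radPow (Lam I) M (l + 1)).restrictScalars K) := fun l => by
    rw [hrad]
    refine hli.disjoint_span_image (Set.disjoint_left.2 fun q hq hq' => ?_)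
    have h1 : q.1.length = l := hq
    have h2 : l + 1 ≤ q.1.length := hq'
    omega
  have hxtop : ∀ r, x r = pathAt (lamAct I M) x (topVertex e r) := fun r => (hn r).symm
  have hind : LinearIndependent K fun r => (radPow (Lam I) M 1).mkQ (x r) := by
    have hx : LinearIndependent K x := by
      have := hli.comp (fun r : Fin t => (⟨topVertex e r, hσ.isPathClosed.top_mem r⟩ :
        {q // q ∈ σ})) fun r s hrs => congrArg (fun q : {q // q ∈ σ} => q.1.1) hrs
      convert! this using 1
      exact funext hxtop
    have hle : Submodule.span K (Set.range x) ≤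
        Submodule.span K ((fun q : {q // q ∈ σ} => pathAt (lamAct I M) x q.1) ''
          {q | q.1.length = 0}) := by
      refine Submodule.span_le.2 ?_
      rintro _ ⟨r, rfl⟩
      exact Submodule.subset_span ⟨⟨topVertex e r, hσ.isPathClosed.top_mem r⟩, rfl,
        (hxtop r).symm⟩
    refine hx.map (f := ((radPow (Lam I) M 1).mkQ).restrictScalars K)
      ((hdisj 0).mono hle fun m hm => ?_)
    exact (Submodule.Quotient.mk_eq_zero _).1 hm
  refine ⟨⟨fun r hr => hind.ne_zero r ((Submodule.Quotient.mk_eq_zero _).2 hr),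
    fun r => ⟨e r, hn r⟩, ?_, hind⟩, ?_⟩
  · rw [eq_top_iff, ← Submodule.restrictScalars_le (R := Lam I) (S := K),
      Submodule.restrictScalars_top, ← hs]
    refine Submodule.span_le.2 ?_
    rintro _ ⟨q, rfl⟩
    change toLam I (ofPath K q.1.toQPath) • x q.1.1 ∈ Submodule.span (Lam I) (Set.range x)
    exact Submodule.smul_mem _ _ (Submodule.subset_span ⟨q.1.1, rfl⟩)
  -- The components of an element of P̂ lie in the left ideals KΓe(r) and act on x_r; the equation
  -- e(r)x_r = x_r makes ẑ_r go to x_r.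
  · let f : PHat K e →ₛₗ[toLam I] M :=
      { toFun := fun y => ∑ r, toLam I (y r).1 • x r
        map_add' := fun y z => by
          rw [← Finset.sum_add_distrib]
          refine Finset.sum_congr rfl fun r _ => ?_
          rw [← add_smul, ← map_add]
          rfl
        map_smul' := fun a y => by
          rw [Finset.smul_sum]
          refine Finset.sum_congr rfl fun r _ => ?_
          rw [smul_smul, ← map_mul]
          rfl }
    have hf : ∀ r, f (zHat K e r) = x r := fun r => by
      change ∑ s, toLam I (zHat K e r s).1 • x s = x r
      rw [Finset.sum_eq_single r]
      · rw [zHat, Pi.single_eq_same]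
        exact hn r
      · intro s _ hs
        rw [zHat, Pi.single_eq_of_ne hs]
        change toLam I 0 • x s = 0
        rw [map_zero, zero_smul]
      · simp
    have hfq : ∀ q : TopPath e, f (pathHat K q) = pathAt (lamAct I M) x q := map_pathHat hf
    refine ⟨f, ?_, hf, ?_⟩
    · intro m
      have hm : m ∈ (⊤ : Submodule K M) := trivial
      rw [← hs] at hm
      obtain ⟨a, ha⟩ := (Submodule.mem_span_range_iff_exists_fun K).1 hm
      refine ⟨∑ q : {q // q ∈ σ}, algebraMap K (PathAlgebra K V) (a q) • pathHat K q.1, ?_⟩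
      rw [map_sum, ← ha]
      refine Finset.sum_congr rfl fun q _ => ?_
      rw [map_smulₛₗ, hfq]
      exact algebraMap_smul (Lam I) (a q) (pathAt (lamAct I M) x q.1)
    · intro l _
      have hmem : ∀ q : {q // q ∈ σ ∧ TopPath.length q = l},
          f (pathHat K q.1) ∈ radPow (Lam I) M l := fun q => by
        rw [hfq]
        exact pathAt_mem_radPow hI x q.2.2.ge
      refine ⟨hmem, ?_, ?_⟩
      · have h1 : LinearIndependent K (fun q : {q // q ∈ σ ∧ TopPath.length q = l} =>
            (⟨f (pathHat K q.1), hmem q⟩ : radPow (Lam I) M l)) := by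
          refine LinearIndependent.of_comp
            (((radPow (Lam I) M l).subtype).restrictScalars K) ?_
          have := hli.comp (fun q : {q // q ∈ σ ∧ TopPath.length q = l} =>
            (⟨q.1, q.2.1⟩ : {q // q ∈ σ})) fun q q' hqq =>
              Subtype.ext (congrArg (fun z : {q // q ∈ σ} => z.1) hqq)
          convert! this using 1
          exact funext fun q => hfq q.1
        refine h1.map (f := (((radPow (Lam I) M (l + 1)).submoduleOf
          (radPow (Lam I) M l)).mkQ).restrictScalars K) ?_
        rw [Submodule.disjoint_def]
        intro m hm hm'
        have hm2 : m ∈ (radPow (Lam I) M (l + 1)).submoduleOf (radPow (Lam I) M l) :=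
          (Submodule.Quotient.mk_eq_zero _).1 hm'
        refine Subtype.ext (Submodule.disjoint_def.1 (hdisj l) m.1 ?_ hm2)
        have h3 := Submodule.mem_map_of_mem
          (f := ((radPow (Lam I) M l).subtype).restrictScalars K) hm
        rw [Submodule.map_span] at h3
        refine Submodule.span_mono ?_ h3
        rintro _ ⟨_, ⟨q, rfl⟩, rfl⟩
        exact ⟨⟨q.1, q.2.1⟩, q.2.2, (hfq q.1).symm⟩
      · rw [eq_top_iff]
        intro y _
        obtain ⟨⟨m, hm⟩, rfl⟩ := Submodule.mkQ_surjective _ y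
        have hm' : m ∈ (radPow (Lam I) M l).restrictScalars K := hm
        rw [hrad] at hm'
        let f' : radPow (Lam I) M l →ₗ[K] _ :=
          (((radPow (Lam I) M (l + 1)).submoduleOf (radPow (Lam I) M l)).mkQ).restrictScalars K
        let T := (Submodule.span K (Set.range fun q : {q // q ∈ σ ∧ TopPath.length q = l} =>
          f' ⟨f (pathHat K q.1), hmem q⟩)).comap f'
        -- T consists of the elements of J^l M whose class lies in the span of the paths of length
        -- l. Longer paths of σ belong to it because their class is zero.
        have hT : lengthSpan (I := I) σ x l ≤
            T.map (((radPow (Lam I) M l).subtype).restrictScalars K) := by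
          refine Submodule.span_le.2 ?_
          rintro _ ⟨q, hq, rfl⟩
          refine ⟨⟨_, pathAt_mem_radPow hI x hq⟩, ?_, rfl⟩
          rcases (show l ≤ q.1.length from hq).eq_or_lt with h' | h'
          · refine Submodule.subset_span ⟨⟨q.1, q.2, h'.symm⟩, ?_⟩
            exact congrArg f' (Subtype.ext (hfq q.1))
          · have hz : f' ⟨pathAt (lamAct I M) x q.1, pathAt_mem_radPow hI x hq⟩ = 0 :=
              (Submodule.Quotient.mk_eq_zero _).2 (pathAt_mem_radPow hI x h')
            refine Submodule.mem_comap.2 ?_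
            rw [hz]
            exact Submodule.zero_mem _
        obtain ⟨z, hz, hzm⟩ := hT hm'
        obtain rfl : z = ⟨m, hm⟩ := Subtype.ext hzm
        exact hz

theorem isSkeletonRel_iff (hI : IsAdmissible I) (hσ : IsAbstractSkeleton (maxLength I) σ)
    {x : Fin t → M} : IsSkeletonRel I σ x ↔ IsSkeletonBasis (I := I) σ x :=
  ⟨fun h => h.isSkeletonBasis hI hσ, fun h => h.isSkeletonRel hI hσ⟩

end Criterion

/-! ## The ideal attached to a skeleton -/

section IdealFacts

theorem mapCoeff_mapCoeff {A B D V : Type*} [CommRing A] [CommRing B] [CommRing D] [Quiver V]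
    (g : B →+* D) (f : A →+* B) (x : PathAlgebra A V) :
    mapCoeff g (mapCoeff f x) = mapCoeff (g.comp f) x :=
  Finsupp.ext fun _ => rfl

theorem mapCoeff_id {A V : Type*} [CommRing A] [Quiver V] (x : PathAlgebra A V) :
    mapCoeff (RingHom.id A) x = x :=
  Finsupp.ext fun _ => rfl

variable {V : Type*} [Fintype V] [Quiver V] {t : ℕ} {e : Fin t → V}

/-! ### Coordinates on P̂ with respect to σ -/

section PHatFacts

variable {A : Type*} [CommRing A] {σ : Finset (TopPath e)}

/-- The coordinates of the elements of `P̂` with respect to `σ`, for given coefficients of the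
critical paths. -/
def hatCoord (c : CoordIndex σ → A) : PHat A e →ₗ[A] ({q // q ∈ σ} → A) where
  toFun y := ∑ r, act c (y r).1 (topVec c r)
  map_add' y z := by
    rw [← Finset.sum_add_distrib]
    refine Finset.sum_congr rfl fun r _ => ?_
    rw [← LinearMap.add_apply, ← map_add]
    rfl
  map_smul' a y := by
    rw [Finset.smul_sum]
    refine Finset.sum_congr rfl fun r _ => ?_
    rw [← LinearMap.smul_apply, RingHom.id_apply, ← map_smul]
    rfl

theorem hatCoord_smul (c : CoordIndex σ → A) (a : PathAlgebra A V) (y : PHat A e) :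
    hatCoord c (a • y) = act c a (hatCoord c y) := by
  change ∑ r, act c (a * (y r).1) (topVec c r) = act c a (∑ r, act c (y r).1 (topVec c r))
  rw [map_sum]
  refine Finset.sum_congr rfl fun r _ => ?_
  rw [map_mul, Module.End.mul_apply]

theorem hatCoord_zHat (c : CoordIndex σ → A) (r : Fin t) :
    hatCoord c (zHat A e r) = topVec c r := by
  change ∑ s, act c (zHat A e r s).1 (topVec c s) = topVec c r
  rw [Finset.sum_eq_single r]
  · rw [zHat, Pi.single_eq_same]
    exact act_vertex_topVec c r
  · intro s _ hs
    rw [zHat, Pi.single_eq_of_ne hs]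
    change act c 0 (topVec c s) = 0
    rw [map_zero, LinearMap.zero_apply]
  · simp

theorem hatCoord_pathHat (c : CoordIndex σ → A) (q : TopPath e) :
    hatCoord c (pathHat A q) = pathAt (act c) (topVec c) q := by
  rw [pathHat, hatCoord_smul, hatCoord_zHat]
  rfl

end PHatFacts

/-! ### The generic coordinates and the zero locus of I(σ, R) -/

section Ideal

variable {K : Type*} [Field K] {σ : Finset (TopPath e)}

/-- The coefficients of `ρ ẑ_r` with respect to `σ`, with variables as coefficients of the critical
paths. -/
def coordPoly {A : Type*} [CommRing A] (σ : Finset (TopPath e)) (ρ : PathAlgebra A V) (r : Fin t)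
    (q : {q // q ∈ σ}) : MvPolynomial (CoordIndex σ) A :=
  act MvPolynomial.X (mapCoeff MvPolynomial.C ρ) (topVec MvPolynomial.X r) q

theorem map_coordPoly {A B : Type*} [CommRing A] [CommRing B] (f : A →+* B) (ρ : PathAlgebra A V)
    (r : Fin t) (q : {q // q ∈ σ}) :
    MvPolynomial.map f (coordPoly σ ρ r q) = coordPoly σ (mapCoeff f ρ) r q := by
  have h := act_map (MvPolynomial.map f) (MvPolynomial.X : CoordIndex σ → _)
    (mapCoeff MvPolynomial.C ρ) (topVec MvPolynomial.X r) q
  rw [coordPoly, ← h, coordPoly, mapCoeff_mapCoeff, mapCoeff_mapCoeff]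
  have h1 : (fun ν => MvPolynomial.map f (MvPolynomial.X ν)) =
      (MvPolynomial.X : CoordIndex σ → MvPolynomial (CoordIndex σ) B) :=
    funext fun ν => MvPolynomial.map_X f ν
  have h2 : (MvPolynomial.map f).comp MvPolynomial.C =
      (MvPolynomial.C : B →+* MvPolynomial (CoordIndex σ) B).comp f :=
    RingHom.ext fun a => MvPolynomial.map_C f a
  have h3 : (fun q => MvPolynomial.map f (topVec (MvPolynomial.X : CoordIndex σ → _) r q)) =
      topVec (fun ν => MvPolynomial.map f (MvPolynomial.X ν)) r :=
    funext fun q => (normalForm_map _ _ _ q).symm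
  rw [h2, h3, h1]

/-- Specialising the variables turns the generic representation into the one attached to c; this
links the ideal with the points of affine space. -/
theorem eval_coordPoly {A : Type*} [CommRing A] (c : CoordIndex σ → A) (ρ : PathAlgebra A V)
    (r : Fin t) (q : {q // q ∈ σ}) :
    MvPolynomial.eval c (coordPoly σ ρ r q) = act c ρ (topVec c r) q := by
  have h := act_map (MvPolynomial.eval c) (MvPolynomial.X : CoordIndex σ → _)
    (mapCoeff MvPolynomial.C ρ) (topVec MvPolynomial.X r) q
  rw [coordPoly, ← h, mapCoeff_mapCoeff]
  have h1 : (fun ν => MvPolynomial.eval c (MvPolynomial.X ν)) = c :=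
    funext fun ν => MvPolynomial.eval_X ν
  have h2 : (MvPolynomial.eval c).comp MvPolynomial.C = RingHom.id A :=
    RingHom.ext fun a => MvPolynomial.eval_C a
  have h3 : (fun q => MvPolynomial.eval c (topVec (MvPolynomial.X : CoordIndex σ → _) r q)) =
      topVec (fun ν => MvPolynomial.eval c (MvPolynomial.X ν)) r :=
    funext fun q => (normalForm_map _ _ _ q).symm
  rw [h2, h3, h1, mapCoeff_id]

/-- The critical relations hold in the generic representation, so its coordinates are defined modulo
`genericSub`. This gives the uniqueness of the τ_q. -/
theorem hatCoord_eq_zero_of_mem_genericSub (hσ : IsPathClosed σ)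
    {y : PHat (MvPolynomial (CoordIndex σ) K) e} (hy : y ∈ genericSub K σ) :
    hatCoord (MvPolynomial.X : CoordIndex σ → MvPolynomial (CoordIndex σ) K) y = 0 := by
  refine Submodule.span_induction (p := fun y _ => hatCoord
    (MvPolynomial.X : CoordIndex σ → MvPolynomial (CoordIndex σ) K) y = 0) ?_ ?_ ?_ ?_ hy
  · rintro _ ⟨x, rfl⟩
    dsimp only
    rw [map_sub, map_sum, sub_eq_zero, hatCoord_pathHat, relations_act hσ MvPolynomial.X x]
    refine Finset.sum_congr rfl fun q _ => ?_
    rw [map_smul, hatCoord_pathHat]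
  · exact map_zero _
  · intro y z _ _ hy hz; rw [map_add, hy, hz, add_zero]
  · intro a y _ hy; rw [hatCoord_smul, hy, map_zero]

/-- This is the existence of the τ_q. The quotient of P̂(K[X]) by `genericSub` satisfies the generic
relations, so the generic representation maps to it; the image of the coordinate vector of ρ ẑ_r is
the class of ρ ẑ_r. -/
theorem sub_sum_mem_genericSub (hσ : IsPathClosed σ) (ρ : PathAlgebra K V) (r : Fin t) :
    mapCoeff (MvPolynomial.C : K →+* MvPolynomial (CoordIndex σ) K) ρ •
        zHat (MvPolynomial (CoordIndex σ) K) e r -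
      ∑ q : {q // q ∈ σ}, coordPoly σ ρ r q • pathHat (MvPolynomial (CoordIndex σ) K) q.1 ∈
        genericSub K σ := by
  let A := MvPolynomial (CoordIndex σ) K
  let W := genericSub K σ
  let φ : PathAlgebra A V →ₐ[A] Module.End A (PHat A e ⧸ W) := Algebra.lsmul A A (PHat A e ⧸ W)
  let g : PHat A e →ₗ[A] PHat A e ⧸ W := W.mkQ.restrictScalars A
  let x : Fin t → PHat A e ⧸ W := fun r => g (zHat A e r)
  have hx : ∀ q : TopPath e, pathAt φ x q = g (pathHat A q) := fun q =>
    (map_smul W.mkQ _ _).symm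
  have hrel : Relations φ x (MvPolynomial.X : CoordIndex σ → A) := by
    intro y
    rw [hx]
    have h1 : g (pathHat A y.1 - ∑ q : {q : TopPath e // q ∈ sigmaSet σ y.1},
        (MvPolynomial.X ⟨y, q⟩ : A) • pathHat A q.1) = 0 :=
      (Submodule.Quotient.mk_eq_zero _).2 (Submodule.subset_span ⟨y, rfl⟩)
    rw [map_sub, sub_eq_zero, map_sum] at h1
    rw [h1]
    refine Finset.sum_congr rfl fun q _ => ?_
    rw [map_smul, hx]
  have hnorm : ∀ r, φ (ofPath A (vertexPath (e r))) (x r) = x r := fun r => by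
    change W.mkQ _ = _
    refine congrArg W.mkQ ?_
    refine funext fun s => Subtype.ext ?_
    change ofPath A (vertexPath (e r)) * (zHat A e r s).1 = (zHat A e r s).1
    by_cases h : s = r
    · subst h
      rw [zHat, Pi.single_eq_same]
      exact vertex_mul_ofPath Quiver.Path.nil
    · rw [zHat, Pi.single_eq_of_ne h]
      exact mul_zero_aux _
  have h := realize_act hrel (mapCoeff MvPolynomial.C ρ) (topVec MvPolynomial.X r)
  rw [realize_topVec hσ _ hnorm, realize, Fintype.linearCombination_apply] at h
  refine (Submodule.Quotient.mk_eq_zero _).1 ?_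
  change g _ = 0
  rw [map_sub, sub_eq_zero, map_sum]
  refine Eq.trans ?_ (h.symm.trans (Finset.sum_congr rfl fun q _ => ?_))
  · exact map_smul W.mkQ _ _
  · rw [map_smul, hx]
    rfl

/-- P̂(K[X]) modulo `genericSub` is free on σ, so the expansion of ρ ẑ_r is unique and is given by
`coordPoly`. -/
theorem skeletonIdeal_eq (hσ : IsPathClosed σ) (R : Set (PathAlgebra K V)) :
    skeletonIdeal σ R = Ideal.span {g | ∃ ρ ∈ R, ∃ r q, g = coordPoly σ ρ r q} := by
  classical
  refine congrArg Ideal.span (Set.ext fun g => ⟨?_, ?_⟩)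
  · rintro ⟨ρ, hρ, r, τ, hτ, q, rfl⟩
    refine ⟨ρ, hρ, r, q, ?_⟩
    have h := hatCoord_eq_zero_of_mem_genericSub hσ hτ
    rw [map_sub, sub_eq_zero, hatCoord_smul, hatCoord_zHat, map_sum] at h
    have h' := congrFun h q
    rw [coordPoly, h', Finset.sum_apply, Finset.sum_eq_single q]
    · rw [map_smul, hatCoord_pathHat, pathAt_act_single hσ, Pi.smul_apply, Pi.single_eq_same,
        smul_eq_mul, mul_one]
    · intro q' _ hq'
      rw [map_smul, hatCoord_pathHat, pathAt_act_single hσ, Pi.smul_apply,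
        Pi.single_eq_of_ne hq'.symm, smul_zero]
    · simp
  · rintro ⟨ρ, hρ, r, q, rfl⟩
    exact ⟨ρ, hρ, r, fun q => coordPoly σ ρ r q, sub_sum_mem_genericSub hσ ρ r, q, rfl⟩

/-- The generators are the coordinate polynomials formed over K₀; by `map_coordPoly` extension of
scalars yields those over K. -/
theorem exists_span_map_eq_skeletonIdeal (hσ : IsPathClosed σ) (R : Set (PathAlgebra K V))
    (K₀ : Subfield K) (hR : ∀ ρ ∈ R, ∀ p : QPath V, coeff ρ p ∈ K₀) :
    ∃ S : Set (MvPolynomial (CoordIndex σ) K₀),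
      Ideal.span (MvPolynomial.map K₀.subtype '' S) = skeletonIdeal σ R := by
  refine ⟨{g | ∃ ρ : PathAlgebra K₀ V, mapCoeff K₀.subtype ρ ∈ R ∧ ∃ r q, g = coordPoly σ ρ r q},
    ?_⟩
  rw [skeletonIdeal_eq hσ]
  refine congrArg Ideal.span (Set.ext fun g => ⟨?_, ?_⟩)
  · rintro ⟨_, ⟨ρ, hρ, r, q, rfl⟩, rfl⟩
    exact ⟨_, hρ, r, q, map_coordPoly _ _ _ _⟩
  · rintro ⟨ρ, hρ, r, q, rfl⟩
    obtain ⟨ρ₀, rfl⟩ : ∃ ρ₀ : PathAlgebra K₀ V, mapCoeff K₀.subtype ρ₀ = ρ := by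
      refine ⟨(Finsupp.onFinset (ρ : QPath V →₀ K).support
        (fun p => (⟨coeff ρ p, hR ρ hρ p⟩ : K₀)) fun p hp => ?_ : QPath V →₀ K₀),
        Finsupp.ext fun p => rfl⟩
      exact Finsupp.mem_support_iff.2 fun h => hp (Subtype.ext h)
    exact ⟨_, ⟨ρ₀, hρ, r, q, rfl⟩, map_coordPoly _ _ _ _⟩

/-- The families of coefficients for which the free module on `σ` is a module over `KΓ/I`. -/
def annihilated (I : Ideal (PathAlgebra K V)) (σ : Finset (TopPath e)) :
    Set (CoordIndex σ → K) :=
  {c | ∀ a ∈ I, act c a = 0}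

/-- The polynomials vanish at c exactly if R annihilates the top vectors of the representation
attached to c. Then the left ideal I annihilates them, and since I is two-sided it annihilates
everything they generate. -/
theorem zeroLocus_skeletonIdeal (hσ : IsPathClosed σ) {I : Ideal (PathAlgebra K V)}
    [I.IsTwoSided] (R : Set (PathAlgebra K V)) (hR : Ideal.span R = I) :
    MvPolynomial.zeroLocus K (skeletonIdeal σ R) = annihilated I σ := by
  classical
  rw [skeletonIdeal_eq hσ, MvPolynomial.zeroLocus_span]
  ext c
  constructor
  · intro hc
    have h1 : ∀ a ∈ I, ∀ r, act c a (topVec c r) = 0 := by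
      intro a ha r
      rw [← hR] at ha
      refine Submodule.span_induction (p := fun a _ => act c a (topVec c r) = 0) ?_ ?_ ?_ ?_ ha
      · intro ρ hρ
        refine funext fun q => ?_
        rw [← eval_coordPoly]
        exact hc _ ⟨ρ, hρ, r, q, rfl⟩
      · rw [map_zero, LinearMap.zero_apply]
      · intro a b _ _ ha hb; rw [map_add, LinearMap.add_apply, ha, hb, add_zero]
      · intro b a _ ha; rw [smul_eq_mul, map_mul, Module.End.mul_apply, ha, map_zero]
    intro a ha
    refine end_ext fun q => ?_
    -- The basis vector q is a path p applied to a top vector, and ap lies in I with a.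
    rw [← pathAt_act_single hσ c q, pathAt, ← Module.End.mul_apply, ← map_mul,
      h1 _ (Ideal.mul_mem_right _ _ ha), LinearMap.zero_apply]
  · rintro hc _ ⟨ρ, hρ, r, q, rfl⟩
    rw [MvPolynomial.aeval_eq_eval]
    change MvPolynomial.eval c _ = 0
    rw [eval_coordPoly, hc ρ (hR ▸ Ideal.subset_span hρ)]
    rfl

end Ideal

end IdealFacts

/-! ## The points of `Grass(σ)` -/

/-! ### Finiteness of the index set N and of the paths of given length -/

section Finiteness

variable {V : Type*} [Finite V] [Quiver V] [∀ a b : V, Finite (a ⟶ b)]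

theorem finite_paths_of_length (l : ℕ) : {p : QPath V | p.2.2.length = l}.Finite := by
  induction l with
  | zero =>
    refine (Set.finite_range (vertexPath : V → QPath V)).subset ?_
    rintro ⟨a, b, p⟩ hp
    obtain rfl := Quiver.Path.eq_of_length_zero p hp
    obtain rfl := Quiver.Path.eq_nil_of_length_zero p hp
    exact ⟨a, rfl⟩
  | succ l ih =>
    refine (ih.biUnion fun p _ => Set.finite_range
      (fun α : Σ b : V, p.2.1 ⟶ b => (⟨p.1, α.1, p.2.2.cons α.2⟩ : QPath V))).subset ?_
    rintro ⟨a, b, p⟩ hp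
    cases p with
    | nil => cases hp
    | cons p α => exact Set.mem_biUnion (x := ⟨a, _, p⟩) (show p.length = l from Nat.succ_injective hp) ⟨⟨_, α⟩, rfl⟩

theorem finite_coordIndex {t : ℕ} {e : Fin t → V} (σ : Finset (TopPath e)) :
    Finite (CoordIndex σ) := by
  have h : {x : TopPath e | IsCritical σ x}.Finite := by
    refine (σ.finite_toSet.biUnion fun q _ => Set.finite_range
      (fun α : Σ b : V, q.2.1 ⟶ b => (⟨q.1, α.1, q.2.2.cons α.2⟩ : TopPath e))).subset ?_
    rintro _ ⟨-, r, a, b, p, α, hp, rfl⟩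
    exact Set.mem_biUnion (x := ⟨r, a, p⟩) hp ⟨⟨b, α⟩, rfl⟩
  have : Finite {x : TopPath e // IsCritical σ x} := h
  infer_instance

end Finiteness

/-! ### The projective module P, its quotients and their coefficient families -/

section Cover

variable {K V : Type*} [Field K] [Fintype V] [Quiver V] {I : Ideal (PathAlgebra K V)}
  [I.IsTwoSided] {t : ℕ} {e : Fin t → V} {σ : Finset (TopPath e)}

theorem finite_lam [∀ a b : V, Finite (a ⟶ b)] (hI : IsAdmissible I) :
    Module.Finite K (Lam I) := by
  obtain ⟨m, hm⟩ := hI.1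
  have hfin : {p : QPath V | p.2.2.length < m}.Finite := by
    refine ((Finset.range m).finite_toSet.biUnion fun l _ =>
      finite_paths_of_length (V := V) l).subset fun p hp => ?_
    exact Set.mem_biUnion (x := p.2.2.length) (Finset.mem_coe.2 (Finset.mem_range.2 hp)) rfl
  refine ⟨(Submodule.fg_def).2 ⟨(fun p => toLamAlg I (ofPath K p)) ''
    {p : QPath V | p.2.2.length < m}, hfin.image _, eq_top_iff.2 fun y _ => ?_⟩⟩
  obtain ⟨x, rfl⟩ := toLam_surjective I y
  refine toLam_mem_of_forall I x fun p _ => ?_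
  by_cases hp : p.2.2.length < m
  · exact Submodule.subset_span ⟨p, hp, rfl⟩
  · have : toLamAlg I (ofPath K p) = 0 := (toLam_eq_zero_iff I _).2 (hm p (not_lt.1 hp))
    rw [this]
    exact Submodule.zero_mem _

theorem finite_pCover [∀ a b : V, Finite (a ⟶ b)] (hI : IsAdmissible I) :
    Module.Finite K (PCover e I) := by
  have := finite_lam hI
  have h : ∀ N : Ideal (Lam I), Module.Finite K N := fun N =>
    inferInstanceAs (Module.Finite K (N.restrictScalars K))
  exact inferInstanceAs (Module.Finite K
    (∀ r : Fin t, ↥(Ideal.span {toLam I (ofPath K (vertexPath (e r)))} : Ideal (Lam I))))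

theorem vertex_mul_self (v : V) : toLam I (ofPath K (vertexPath v)) *
    toLam I (ofPath K (vertexPath v)) = toLam I (ofPath K (vertexPath v)) := by
  rw [← map_mul]
  exact congrArg (toLam I) (vertex_mul_ofPath Quiver.Path.nil)

theorem vertex_smul_zTop (r : Fin t) :
    toLam I (ofPath K (vertexPath (e r))) • zTop e I r = zTop e I r := by
  refine funext fun s => Subtype.ext ?_
  change toLam I (ofPath K (vertexPath (e r))) * (zTop e I r s).1 = (zTop e I r s).1
  by_cases h : s = r
  · subst h
    rw [zTop, Pi.single_eq_same]
    exact vertex_mul_self (e s)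
  · rw [zTop, Pi.single_eq_of_ne h]
    exact mul_zero _

theorem sum_smul_zTop (y : PCover e I) : ∑ r, (y r).1 • zTop e I r = y := by
  refine funext fun s => Subtype.ext ?_
  have h1 : (∑ r, (y r).1 • zTop e I r) s = ∑ r, (y r).1 • zTop e I r s :=
    Finset.sum_apply s _ _
  rw [h1, Finset.sum_eq_single s]
  · rw [zTop, Pi.single_eq_same]
    change (y s).1 * toLam I (ofPath K (vertexPath (e s))) = (y s).1
    obtain ⟨a, ha⟩ := Ideal.mem_span_singleton'.1 (y s).2
    rw [← ha, mul_assoc, vertex_mul_self]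
  · intro r _ hr
    rw [zTop, Pi.single_eq_of_ne hr.symm]
    exact smul_zero _
  · simp

/-- P is the sum of JP and the span of the z_r: paths of positive length act through J, and a
trivial path fixes or kills z_r. This serves to show that certain kernels lie in JP. -/
theorem exists_sub_mem_JP (hI : IsAdmissible I) (y : PCover e I) :
    ∃ k : Fin t → K, y - ∑ r, k r • zTop e I r ∈ JP I e := by
  classical
  suffices h : ∀ (a : Lam I) (r : Fin t), ∃ k : K, a • zTop e I r - k • zTop e I r ∈ JP I e by
    choose k hk using fun r => h (y r).1 r
    refine ⟨k, ?_⟩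
    have hy : y - ∑ r, k r • zTop e I r = ∑ r, ((y r).1 • zTop e I r - k r • zTop e I r) := by
      rw [Finset.sum_sub_distrib, sum_smul_zTop]
    rw [hy]
    refine Submodule.sum_mem _ fun r _ => ?_
    exact hk r
  intro a r
  obtain ⟨x, rfl⟩ := toLam_surjective I a
  induction x using induction_on with
  | h0 => exact ⟨0, by rw [map_zero, zero_smul, zero_smul, sub_zero]; exact Submodule.zero_mem _⟩
  | hadd x y hx hy =>
    obtain ⟨k, hk⟩ := hx
    obtain ⟨l, hl⟩ := hy
    refine ⟨k + l, ?_⟩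
    rw [map_add, add_smul, add_smul, add_sub_add_comm]
    exact Submodule.add_mem _ hk hl
  | hs b p =>
    have hb : ∀ z : PCover e I, toLam I (b • ofPath K p) • z = b • (toLam I (ofPath K p) • z) :=
      fun z => by rw [← smul_assoc]; rfl
    obtain ⟨c, d, p⟩ := p
    rw [hb]
    by_cases hp : 1 ≤ p.length
    · refine ⟨0, ?_⟩
      rw [zero_smul, sub_zero]
      exact ((JP I e).restrictScalars K).smul_mem _ (smul_mem_radPow hI ⟨c, d, p⟩ hp _)
    · have hp0 : p.length = 0 := by omega
      obtain rfl := Quiver.Path.eq_of_length_zero p hp0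
      obtain rfl := Quiver.Path.eq_nil_of_length_zero p hp0
      by_cases hc : c = e r
      · subst hc
        refine ⟨b, ?_⟩
        have := vertex_smul_zTop (I := I) (e := e) r
        rw [vertexPath] at this
        rw [this, sub_self]
        exact Submodule.zero_mem _
      · refine ⟨0, ?_⟩
        rw [← vertex_smul_zTop r, smul_smul, ← map_mul, ofPath_mul_ofPath,
          pathMul_of_ne (by exact Ne.symm hc), map_zero, zero_smul, smul_zero, zero_smul, sub_zero]
        exact Submodule.zero_mem _

section Lift

variable {M : Type*} [AddCommGroup M] [Module (Lam I) M]

/-- The homomorphism on `P` which sends `z_r` to given elements normed by the vertices `e r`. -/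
def liftTop (x : Fin t → M) : PCover e I →ₗ[Lam I] M where
  toFun y := ∑ r, (y r).1 • x r
  map_add' y z := by
    rw [← Finset.sum_add_distrib]
    refine Finset.sum_congr rfl fun r _ => ?_
    rw [← add_smul]
    rfl
  map_smul' a y := by
    rw [Finset.smul_sum]
    refine Finset.sum_congr rfl fun r _ => ?_
    rw [smul_smul]
    rfl

theorem liftTop_zTop {x : Fin t → M}
    (hx : ∀ r, toLam I (ofPath K (vertexPath (e r))) • x r = x r) (r : Fin t) :
    liftTop x (zTop e I r) = x r := by
  change ∑ s, (zTop e I r s).1 • x s = x r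
  rw [Finset.sum_eq_single r]
  · rw [zTop, Pi.single_eq_same]
    exact hx r
  · intro s _ hs
    rw [zTop, Pi.single_eq_of_ne hs]
    exact zero_smul _ _
  · simp

end Lift

theorem pathTop_eq_pathAt (q : TopPath e) :
    pathTop I q = pathAt (lamAct I (PCover e I)) (zTop e I) q := rfl

/-! ### Modules with a skeleton basis as quotients of P -/

section Modules

variable {M M' : Type*} [AddCommGroup M] [Module K M] [Module (Lam I) M] [IsScalarTower K (Lam I) M]
  [AddCommGroup M'] [Module K M'] [Module (Lam I) M'] [IsScalarTower K (Lam I) M']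

theorem map_pathAt (g : M →ₗ[Lam I] M') (x : Fin t → M) (q : TopPath e) :
    pathAt (lamAct I M') (fun r => g (x r)) q = g (pathAt (lamAct I M) x q) := by
  rw [pathAt_lamAct, pathAt_lamAct, map_smul]

theorem Relations.map (g : M →ₗ[Lam I] M') {x : Fin t → M} {c : CoordIndex σ → K}
    (h : Relations (lamAct I M) x c) : Relations (lamAct I M') (fun r => g (x r)) c := by
  intro y
  rw [map_pathAt, h y, map_sum]
  refine Finset.sum_congr rfl fun q _ => ?_
  rw [map_pathAt]
  exact map_smul (g.restrictScalars K) _ _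

theorem IsSkeletonBasis.map (g : M ≃ₗ[Lam I] M') {x : Fin t → M}
    (h : IsSkeletonBasis (I := I) σ x) : IsSkeletonBasis (I := I) σ fun r => g (x r) := by
  have hp : (fun q : {q // q ∈ σ} => pathAt (lamAct I M') (fun r => g (x r)) q.1) =
      (g.restrictScalars K) ∘ fun q : {q // q ∈ σ} => pathAt (lamAct I M) x q.1 :=
    funext fun q => map_pathAt g.toLinearMap x q.1
  refine ⟨fun r => ?_, ?_, ?_, ?_⟩
  · rw [lamAct_apply, ← map_smul, ← lamAct_apply, h.normed]
  · rw [hp]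
    exact h.indep.map' (g.restrictScalars K).toLinearMap (LinearEquiv.ker _)
  · rw [hp, Set.range_comp, ← LinearEquiv.coe_coe, Submodule.span_image, h.span_eq,
      Submodule.map_top, LinearEquiv.range]
  · obtain ⟨c, hc⟩ := h.relations
    exact ⟨c, hc.map g.toLinearMap⟩

theorem IsSkeletonBasis.relations_unique {x : Fin t → M} (h : IsSkeletonBasis (I := I) σ x)
    {c c' : CoordIndex σ → K} (hc : Relations (lamAct I M) x c)
    (hc' : Relations (lamAct I M) x c') : c = c' := by
  classical
  refine funext fun ν => ?_
  obtain ⟨y, q⟩ := ν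
  have h1 := (hc y).symm.trans (hc' y)
  rw [← sub_eq_zero, ← Finset.sum_sub_distrib] at h1
  simp only [← sub_smul] at h1
  have h2 := h.indep.comp (fun q : {q // q ∈ sigmaSet σ y.1} =>
    (⟨q.1, mem_of_mem_sigmaSet q.2⟩ : {q // q ∈ σ})) fun q q' hqq =>
      Subtype.ext (congrArg (fun z : {q // q ∈ σ} => z.1) hqq)
  exact sub_eq_zero.1 (Fintype.linearIndependent_iff.1 h2
    (fun q => c ⟨y, q⟩ - c' ⟨y, q⟩) h1 q)

theorem IsSkeletonBasis.realize_injective {x : Fin t → M} (h : IsSkeletonBasis (I := I) σ x) :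
    Function.Injective (realize (lamAct I M) x σ) :=
  linearIndependent_iff_injective_fintypeLinearCombination.1 h.indep

/-- The map `realize` identifies the representation attached to c with a subspace of the Λ-module M,
compatibly with the action, and I acts on M as zero. -/
theorem IsSkeletonBasis.mem_annihilated {x : Fin t → M} (h : IsSkeletonBasis (I := I) σ x)
    {c : CoordIndex σ → K} (hc : Relations (lamAct I M) x c) : c ∈ annihilated I σ := by
  intro a ha
  refine LinearMap.ext fun v => h.realize_injective ?_
  rw [realize_act hc, lamAct_apply, (toLam_eq_zero_iff I a).2 ha, zero_smul,
    LinearMap.zero_apply, map_zero]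

theorem IsSkeletonBasis.finrank_eq {x : Fin t → M} (h : IsSkeletonBasis (I := I) σ x) :
    Module.finrank K M = σ.card := by
  rw [Module.finrank_eq_card_basis (Module.Basis.mk h.indep h.span_eq.ge), Fintype.card_coe]

theorem IsSkeletonBasis.liftTop_surjective {x : Fin t → M}
    (h : IsSkeletonBasis (I := I) σ x) : Function.Surjective (liftTop (e := e) (I := I) x) := by
  intro m
  have hm : m ∈ (⊤ : Submodule K M) := trivial
  rw [← h.span_eq] at hm
  obtain ⟨a, rfl⟩ := (Submodule.mem_span_range_iff_exists_fun K).1 hm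
  refine ⟨∑ q : {q // q ∈ σ}, a q • pathTop I q.1, ?_⟩
  rw [map_sum]
  refine Finset.sum_congr rfl fun q _ => ?_
  have h1 : liftTop (e := e) (I := I) x (a q • pathTop I q.1) =
      a q • liftTop (e := e) (I := I) x (pathTop I q.1) :=
    map_smul ((liftTop (e := e) (I := I) x).restrictScalars K) _ _
  rw [h1, pathTop, map_smul, liftTop_zTop h.normed, pathAt_lamAct]

/-- A module with a skeleton is a quotient of `P` by a point of `Grass(σ)`. -/
theorem IsSkeletonBasis.exists_grass [∀ a b : V, Finite (a ⟶ b)] (hI : IsAdmissible I)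
    (hσ : IsAbstractSkeleton (maxLength I) σ) {x : Fin t → M}
    (h : IsSkeletonBasis (I := I) σ x) {d : ℕ} (hd : σ.card = d) :
    ∃ (C : Grass I σ d) (g : (PCover e I ⧸ C.1) ≃ₗ[Lam I] M),
      ∀ r, g (C.1.mkQ (zTop e I r)) = x r := by
  have := finite_pCover (e := e) hI
  let f := liftTop (e := e) (I := I) x
  let C := LinearMap.ker f
  let g : (PCover e I ⧸ C) ≃ₗ[Lam I] M := f.quotKerEquivOfSurjective h.liftTop_surjective
  have hg : ∀ r, g (C.mkQ (zTop e I r)) = x r := fun r => liftTop_zTop h.normed r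
  have hg' : (fun r => C.mkQ (zTop e I r)) = fun r => g.symm (x r) :=
    funext fun r => by rw [← hg, LinearEquiv.symm_apply_apply]
  have hsk : IsSkeletonBasis (I := I) σ fun r => C.mkQ (zTop e I r) := by
    rw [hg']
    exact h.map g.symm
  refine ⟨⟨C, ⟨?_, ?_⟩, (isSkeletonRel_iff hI hσ).2 hsk⟩, g, hg⟩
  -- Write y in the kernel as ∑ k_r z_r modulo JP. Applying f gives ∑ k_r x_r ∈ JM, so all k_r
  -- vanish by the independence of the x_r modulo JM.
  · intro y hy
    obtain ⟨k, hk⟩ := exists_sub_mem_JP hI y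
    have hind := ((isSkeletonRel_iff hI hσ).2 h).1.indep
    rw [Fintype.linearIndependent_iff] at hind
    have hk0 : ∀ r, k r = 0 := by
      refine hind k ?_
      have h1 : f (y - ∑ r, k r • zTop e I r) ∈ radPow (Lam I) M 1 := by
        have : Submodule.map f (JP I e) ≤ radPow (Lam I) M 1 := by
          rw [JP, radPow, Submodule.map_smul'']
          exact Submodule.smul_mono le_rfl le_top
        exact this (Submodule.mem_map_of_mem hk)
      have h2 : f (y - ∑ r, k r • zTop e I r) = - ∑ r, k r • x r := by
        rw [map_sub, show f y = 0 from hy, zero_sub, map_sum]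
        refine congrArg _ (Finset.sum_congr rfl fun r _ => ?_)
        exact (map_smul (f.restrictScalars K) _ _).trans
          (congrArg (fun m => k r • m) (liftTop_zTop h.normed r))
      rw [h2, Submodule.neg_mem_iff] at h1
      have h3 := (Submodule.Quotient.mk_eq_zero _).2 h1
      refine Eq.trans ?_ h3
      change _ = (radPow (Lam I) M 1).mkQ.restrictScalars K (∑ r, k r • x r)
      rw [map_sum]
      refine Finset.sum_congr rfl fun r _ => ?_
      rw [map_smul]
      rfl
    have : ∑ r, k r • zTop e I r = 0 :=
      Finset.sum_eq_zero fun r _ => by rw [hk0 r, zero_smul]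
    rwa [this, sub_zero] at hk
  · have h1 : Module.finrank K (PCover e I ⧸ C) = d := by rw [hsk.finrank_eq, hd]
    rw [← h1]
    have h2 := Submodule.finrank_quotient_add_finrank (C.restrictScalars K)
    rw [add_comm] at h2
    exact h2

end Modules

/-! ### The module attached to a family of coefficients -/

/-- The free module on `σ` as a module over `Λ`. -/
def CoeffModule {c : CoordIndex σ → K} (_ : c ∈ annihilated I σ) : Type _ := {q // q ∈ σ} → K

section CoeffModule

variable {c : CoordIndex σ → K} (hc : c ∈ annihilated I σ)

instance : AddCommGroup (CoeffModule hc) := inferInstanceAs (AddCommGroup ({q // q ∈ σ} → K))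

instance : Module K (CoeffModule hc) := inferInstanceAs (Module K ({q // q ∈ σ} → K))

/-- The action of `Λ` on the free module on `σ`. -/
def lamEnd : Lam I →ₐ[K] Module.End K ({q // q ∈ σ} → K) :=
  Ideal.Quotient.liftₐ I (act c) hc

instance : Module (Lam I) (CoeffModule hc) :=
  Module.compHom ({q // q ∈ σ} → K) (lamEnd hc).toRingHom

instance : IsScalarTower K (Lam I) (CoeffModule hc) where
  smul_assoc k a v := by
    exact LinearMap.congr_fun (map_smul (lamEnd hc) k a) v

theorem isSkeletonBasis_coeffModule (hσ : IsPathClosed σ) :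
    IsSkeletonBasis (I := I) (M := CoeffModule hc) σ (topVec c) ∧
      Relations (lamAct I (CoeffModule hc)) (topVec c) c := by
  classical
  have hp : ∀ q : TopPath e, pathAt (lamAct I (CoeffModule hc)) (topVec c) q =
      pathAt (act c) (topVec c) q := fun q => rfl
  have hb : (fun q : {q // q ∈ σ} => pathAt (lamAct I (CoeffModule hc)) (topVec c) q.1) =
      Pi.basisFun K {q // q ∈ σ} := by
    refine funext fun q => ?_
    rw [Pi.basisFun_apply]
    exact pathAt_act_single hσ c q
  refine ⟨⟨act_vertex_topVec c, ?_, ?_, c, relations_act hσ c⟩, relations_act hσ c⟩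
  · rw [hb]
    exact (Pi.basisFun K {q // q ∈ σ}).linearIndependent
  · rw [hb]
    exact (Pi.basisFun K {q // q ∈ σ}).span_eq

end CoeffModule

/-! ### Points and coefficients -/

theorem isCoeffFamily_iff (C : Submodule (Lam I) (PCover e I)) (c : CoordIndex σ → K) :
    IsCoeffFamily I σ C c ↔
      Relations (lamAct I (PCover e I ⧸ C)) (fun r => C.mkQ (zTop e I r)) c := by
  refine forall_congr' fun y => ?_
  rw [map_pathAt C.mkQ, ← pathTop_eq_pathAt, map_sum]
  have h : ∀ q : {q : TopPath e // q ∈ sigmaSet σ y.1},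
      C.mkQ (c ⟨y, q⟩ • pathTop I q.1) = c ⟨y, q⟩ •
        pathAt (lamAct I (PCover e I ⧸ C)) (fun r => C.mkQ (zTop e I r)) q.1 := fun q => by
    rw [map_pathAt C.mkQ]
    rfl
  rw [Finset.sum_congr rfl fun q _ => h q]

theorem isSkeletonBasis_of_grass (hI : IsAdmissible I) (hσ : IsAbstractSkeleton (maxLength I) σ)
    {d : ℕ} (C : Grass I σ d) :
    IsSkeletonBasis (I := I) σ fun r => C.1.mkQ (zTop e I r) :=
  (isSkeletonRel_iff hI hσ).1 C.2.2

theorem exists_coeffFamily (hI : IsAdmissible I) (hσ : IsAbstractSkeleton (maxLength I) σ)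
    {d : ℕ} (C : Grass I σ d) :
    ∃ c₀ : CoordIndex σ → K, ∀ c, IsCoeffFamily I σ C.1 c ↔ c = c₀ := by
  obtain ⟨c₀, h₀⟩ := (isSkeletonBasis_of_grass hI hσ C).relations
  refine ⟨c₀, fun c => ?_⟩
  rw [isCoeffFamily_iff]
  refine ⟨fun hc => (isSkeletonBasis_of_grass hI hσ C).relations_unique hc h₀, ?_⟩
  rintro rfl
  exact h₀

/-- For the construction of C from c, the free module on σ is a Λ-module with skeleton σ, hence a
quotient of P. The isomorphism matches the z_r with the top vectors, so the quotient has the same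
coefficients c. -/
theorem exists_grass_iff [∀ a b : V, Finite (a ⟶ b)] (hI : IsAdmissible I)
    (hσ : IsAbstractSkeleton (maxLength I) σ) {d : ℕ} (hd : σ.card = d)
    (c : CoordIndex σ → K) :
    (∃ C : Grass I σ d, IsCoeffFamily I σ C.1 c) ↔ c ∈ annihilated I σ := by
  constructor
  · rintro ⟨C, hC⟩
    exact (isSkeletonBasis_of_grass hI hσ C).mem_annihilated ((isCoeffFamily_iff _ _).1 hC)
  · intro hc
    obtain ⟨h1, h2⟩ := isSkeletonBasis_coeffModule hc hσ.isPathClosed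
    obtain ⟨C, g, hg⟩ := h1.exists_grass hI hσ hd
    refine ⟨C, (isCoeffFamily_iff _ _).2 ?_⟩
    have hg' : (fun r => C.1.mkQ (zTop e I r)) = fun r => g.symm (topVec c r) :=
      funext fun r => by rw [← hg, LinearEquiv.symm_apply_apply]
    rw [hg']
    exact h2.map g.symm.toLinearMap

theorem isCoeffFamily_USub (c : CoordIndex σ → K) : IsCoeffFamily I σ (USub I σ c) c := by
  intro y
  rw [← sub_eq_zero, ← map_sub]
  exact (Submodule.Quotient.mk_eq_zero _).2 (Submodule.subset_span ⟨y, rfl⟩)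

theorem USub_le {C : Submodule (Lam I) (PCover e I)} {c : CoordIndex σ → K}
    (h : IsCoeffFamily I σ C c) : USub I σ c ≤ C := by
  refine Submodule.span_le.2 ?_
  rintro _ ⟨y, rfl⟩
  refine (Submodule.Quotient.mk_eq_zero _).1 ?_
  change C.mkQ _ = 0
  rw [critDiff, map_sub, sub_eq_zero]
  exact h y

/-- Every element of `P` is, modulo a submodule, a combination of the paths in `σ` if the critical
paths are. -/
theorem exists_mkQ_eq_realize (hσ : IsPathClosed σ) {C : Submodule (Lam I) (PCover e I)}
    {c : CoordIndex σ → K} (h : IsCoeffFamily I σ C c) (y : PCover e I) :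
    ∃ v, C.mkQ y = realize (lamAct I (PCover e I ⧸ C)) (fun r => C.mkQ (zTop e I r)) σ v := by
  choose a ha using fun r => toLam_surjective I (y r).1
  have hn : ∀ r, lamAct I (PCover e I ⧸ C) (ofPath K (vertexPath (e r)))
      (C.mkQ (zTop e I r)) = C.mkQ (zTop e I r) := fun r => by
    rw [lamAct_apply, ← map_smul, vertex_smul_zTop]
  refine ⟨∑ r, act c (a r) (topVec c r), ?_⟩
  rw [map_sum]
  conv_lhs => rw [← sum_smul_zTop y]
  rw [map_sum]
  refine Finset.sum_congr rfl fun r _ => ?_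
  rw [realize_act ((isCoeffFamily_iff C c).1 h),
    realize_topVec (x := fun r => C.mkQ (zTop e I r)) hσ c hn, lamAct_apply, map_smul, ha]

/-- U(c) is contained in C, the paths in σ span P/U(c), and they remain independent in the smaller
quotient P/C. So no element of C can be nonzero modulo U(c). -/
theorem USub_eq_of_grass (hI : IsAdmissible I) (hσ : IsAbstractSkeleton (maxLength I) σ) {d : ℕ}
    (C : Grass I σ d) {c : CoordIndex σ → K} (hc : IsCoeffFamily I σ C.1 c) :
    USub I σ c = C.1 := by
  refine le_antisymm (USub_le hc) fun y hy => ?_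
  obtain ⟨v, hv⟩ := exists_mkQ_eq_realize hσ.isPathClosed (isCoeffFamily_USub c) y
  refine (Submodule.Quotient.mk_eq_zero _).1 (hv.trans ?_)
  suffices h : v = 0 by rw [h, map_zero]
  refine (isSkeletonBasis_of_grass hI hσ C).realize_injective ?_
  rw [map_zero]
  have h1 : ∀ N : Submodule (Lam I) (PCover e I),
      realize (lamAct I (PCover e I ⧸ N)) (fun r => N.mkQ (zTop e I r)) σ v =
        N.mkQ (∑ q : {q // q ∈ σ}, v q • pathTop I q.1) := fun N => by
    rw [realize, Fintype.linearCombination_apply, map_sum]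
    refine Finset.sum_congr rfl fun q _ => ?_
    rw [map_pathAt N.mkQ]
    rfl
  rw [h1] at hv ⊢
  refine (Submodule.Quotient.mk_eq_zero _).2 ?_
  have h2 := USub_le hc ((Submodule.Quotient.eq _).1 hv)
  have h3 := C.1.sub_mem hy h2
  rwa [sub_sub_cancel] at h3

end Cover

/-! ## Morphisms from and to subsets of the Grassmannian -/

section Geometry

/-- Topology and regular functions are both generated by the given fractions, so it suffices to pull
back single fractions, locally around each point. -/
theorem isMorphism_ofFractions {K X Y : Type*} {F : Set (Set X × (X → K))}
    {G : Set (Set Y × (Y → K))} {φ : X → Y}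
    (h : ∀ p ∈ G, ∀ x, φ x ∈ p.1 → ∃ p' ∈ F, x ∈ p'.1 ∧
      ∀ y ∈ p'.1, φ y ∈ p.1 ∧ p.2 (φ y) = p'.2 y) :
    IsMorphism (ofFractions F) (ofFractions G) φ := by
  constructor
  · let : TopologicalSpace X := (ofFractions F).topology
    refine continuous_generateFrom_iff.2 ?_
    rintro _ ⟨p, hp, rfl⟩
    refine isOpen_iff_forall_mem_open.2 fun x hx => ?_
    obtain ⟨p', hp', hx', hy⟩ := h p hp x hx
    exact ⟨p'.1, fun y hy' => (hy y hy').1,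
      TopologicalSpace.isOpen_generateFrom_of_mem ⟨p', hp', rfl⟩, hx'⟩
  · intro U _ f hf x hx
    obtain ⟨p, hp, hxp, hfp⟩ := hf (φ x) hx
    obtain ⟨p', hp', hx', hy⟩ := h p hp x hxp
    refine ⟨p', hp', hx', fun y hyU => ?_⟩
    have h1 := hy y hyU.2
    exact (hfp (φ y) ⟨hyU.1, h1.1⟩).trans h1.2

variable {K : Type*} [Field K]

theorem eval_smul_of_isHomogeneous {N : Type*} {g : MvPolynomial N K} {k : ℕ}
    (hg : g.IsHomogeneous k) (s : K) (w : N → K) :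
    MvPolynomial.eval (s • w) g = s ^ k * MvPolynomial.eval w g := by
  rw [MvPolynomial.eval_eq, MvPolynomial.eval_eq, Finset.mul_sum]
  refine Finset.sum_congr rfl fun d hd => ?_
  have hk : ∑ i ∈ d.support, d i = k :=
    (hg.degree_eq_sum_deg_support hd).symm
  simp only [Pi.smul_apply, smul_eq_mul, mul_pow, Finset.prod_mul_distrib]
  rw [Finset.prod_pow_eq_pow_sum, hk]
  ring

variable {m : ℕ} {W : Type*} [AddCommGroup W] [Module K W]

/-- The scalar is the determinant of the matrix of the change of basis. It is nonzero since the
matrices of the two changes of basis are inverse to each other. -/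
theorem exists_smul_eq_of_mem_pluckerVectors {C : Gr K m W}
    {w w' : (Fin m → Module.Dual K W) → K} (hw : w ∈ pluckerVectors C)
    (hw' : w' ∈ pluckerVectors C) : ∃ s : K, s ≠ 0 ∧ w' = s • w := by
  obtain ⟨v, hv, hvC, rfl⟩ := hw
  obtain ⟨v', hv', hvC', rfl⟩ := hw'
  have key : ∀ {v v' : Fin m → W}, Submodule.span K (Set.range v) = C.1 →
      Submodule.span K (Set.range v') = C.1 →
      ∃ A : Matrix (Fin m) (Fin m) K, ∀ j, ∑ i, A i j • v i = v' j := by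
    intro v v' hvC hvC'
    have h : ∀ j, ∃ a : Fin m → K, ∑ i, a i • v i = v' j := fun j =>
      (Submodule.mem_span_range_iff_exists_fun K).1
        (hvC.trans hvC'.symm ▸ Submodule.subset_span ⟨j, rfl⟩)
    choose a ha using h
    exact ⟨fun i j => a j i, ha⟩
  obtain ⟨A, hA⟩ := key hvC hvC'
  obtain ⟨B, hB⟩ := key hvC' hvC
  have hmul : ∀ {v v' : Fin m → W} {A : Matrix (Fin m) (Fin m) K},
      (∀ j, ∑ i, A i j • v i = v' j) → ∀ φ : Fin m → Module.Dual K W,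
      (Matrix.of fun i j => φ i (v' j)) = (Matrix.of fun i j => φ i (v j)) * A := by
    intro v v' A hA φ
    ext i j
    rw [Matrix.mul_apply, Matrix.of_apply, ← hA j, map_sum]
    refine Finset.sum_congr rfl fun l _ => ?_
    rw [map_smul, smul_eq_mul, mul_comm, Matrix.of_apply]
  have hAB : A * B = 1 := by
    have h1 : ∀ j, ∑ i, (A * B) i j • v i = v j := by
      intro j
      rw [← hB j]
      simp only [Matrix.mul_apply, Finset.sum_smul, ← hA, Finset.smul_sum, smul_smul]
      rw [Finset.sum_comm]
      refine Finset.sum_congr rfl fun i _ => Finset.sum_congr rfl fun l _ => ?_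
      rw [mul_comm]
    ext i j
    have h2 : ∑ i, ((A * B) i j - (1 : Matrix (Fin m) (Fin m) K) i j) • v i = 0 := by
      simp only [sub_smul, Finset.sum_sub_distrib, h1 j, Matrix.one_apply, ite_smul, one_smul,
        zero_smul, Finset.sum_ite_eq', Finset.mem_univ, if_true, sub_self]
    exact sub_eq_zero.1 (Fintype.linearIndependent_iff.1 hv _ h2 i)
  refine ⟨A.det, fun h0 => ?_, funext fun φ => ?_⟩
  · have := congrArg Matrix.det hAB
    rw [Matrix.det_mul, h0, zero_mul, Matrix.det_one] at this
    exact zero_ne_one this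
  · rw [hmul hA φ, Matrix.det_mul, Pi.smul_apply, smul_eq_mul, mul_comm]

theorem exists_mem_pluckerVectors [FiniteDimensional K W] (C : Gr K m W) :
    (pluckerVectors C).Nonempty := by
  let b := Module.finBasisOfFinrankEq K C.1 C.2
  refine ⟨_, fun i => (b i : W), ?_, ?_, rfl⟩
  · exact b.linearIndependent.map' C.1.subtype (Submodule.ker_subtype _)
  · have h : (Set.range fun i => (b i : W)) = C.1.subtype '' Set.range b := by
      rw [← Set.range_comp]
      rfl
    rw [h, Submodule.span_image, b.span_eq, Submodule.map_top, Submodule.range_subtype]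

/-- A map to a set of points of the Grassmannian is a morphism if the subspaces have bases which
depend polynomially on the parameters. -/
theorem isMorphism_of_polynomial_basis {N X : Type*} {Y : Set (N → K)} {j : X → Gr K m W}
    {θ : Y → X} (u : Y → Fin m → W) (hu : ∀ c, LinearIndependent K (u c))
    (hspan : ∀ c, Submodule.span K (Set.range (u c)) = (j (θ c)).1)
    (hpoly : ∀ (φ : Module.Dual K W) (i : Fin m), ∃ P : MvPolynomial N K, ∀ c : Y,
      MvPolynomial.eval c.1 P = φ (u c i)) :
    IsMorphism (affineSubset Y) (ofFractions (pullFractions j (grassFractions K m W))) θ := by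
  choose P hP using hpoly
  -- The Plücker coordinates of the span of u(c) are polynomials in c. Substituting them in a
  -- homogeneous fraction gives a fraction of polynomials on affine space.
  let D : (Fin m → Module.Dual K W) → MvPolynomial N K := fun φ =>
    Matrix.det (Matrix.of fun i l => P (φ i) l)
  have hD : ∀ c : Y, (fun φ => MvPolynomial.eval c.1 (D φ)) ∈ pluckerVectors (j (θ c)) := by
    intro c
    refine ⟨u c, hu c, hspan c, funext fun φ => ?_⟩
    rw [RingHom.map_det]
    congr 1
    ext i l
    exact hP (φ i) l c
  have heval : ∀ (g : MvPolynomial (Fin m → Module.Dual K W) K) (c : Y),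
      MvPolynomial.eval c.1 (MvPolynomial.aeval D g) =
        MvPolynomial.eval (fun φ => MvPolynomial.eval c.1 (D φ)) g := by
    intro g c
    rw [MvPolynomial.eval, MvPolynomial.eval, MvPolynomial.aeval_def, MvPolynomial.coe_eval₂Hom,
      MvPolynomial.coe_eval₂Hom, ← MvPolynomial.coe_eval₂Hom (f := RingHom.id K),
      MvPolynomial.hom_eval₂]
    congr 1
    ext a
    simp
  refine isMorphism_ofFractions ?_
  rintro _ ⟨⟨D₁, f₁⟩, ⟨k, g, h, hg, hh, hdom, hval⟩, rfl⟩ x hx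
  dsimp only at hdom hval
  subst hdom
  refine ⟨_, ⟨(_, _), ⟨MvPolynomial.aeval D g, MvPolynomial.aeval D h, rfl, rfl⟩, rfl⟩, ?_, ?_⟩
  · obtain ⟨w, hw, hw0⟩ := hx
    obtain ⟨s, hs, rfl⟩ := exists_smul_eq_of_mem_pluckerVectors (hD x) hw
    rw [eval_smul_of_isHomogeneous hh] at hw0
    change MvPolynomial.eval x.1 (MvPolynomial.aeval D h) ≠ 0
    rw [heval]
    exact right_ne_zero_of_mul hw0
  · intro y hy
    have hy' : MvPolynomial.eval y.1 (MvPolynomial.aeval D h) ≠ 0 := hy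
    rw [heval] at hy'
    refine ⟨⟨_, hD y, hy'⟩, ?_⟩
    refine (hval _ _ (hD y) hy').trans ?_
    rw [← heval, ← heval]
    rfl

/-- Two Plücker vectors of C differ by a scalar s, and s^k cancels in the quotient. Where no Plücker
vector exists the value 0 is arbitrary. -/
theorem exists_grassFraction {k : ℕ} {g h : MvPolynomial (Fin m → Module.Dual K W) K}
    (hg : g.IsHomogeneous k) (hh : h.IsHomogeneous k) :
    ∃ f : Gr K m W → K, ∀ C, ∀ w ∈ pluckerVectors C, MvPolynomial.eval w h ≠ 0 →
      f C = MvPolynomial.eval w g / MvPolynomial.eval w h := by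
  classical
  refine ⟨fun C => if hC : (pluckerVectors C).Nonempty then
    MvPolynomial.eval hC.some g / MvPolynomial.eval hC.some h else 0, fun C w hw _ => ?_⟩
  have hC : (pluckerVectors C).Nonempty := ⟨w, hw⟩
  obtain ⟨s, hs, hsw⟩ := exists_smul_eq_of_mem_pluckerVectors hw hC.some_mem
  dsimp only
  rw [dif_pos hC, hsw, eval_smul_of_isHomogeneous hg, eval_smul_of_isHomogeneous hh,
    mul_div_mul_left _ _ (pow_ne_zero k hs)]

/-- A map from a set of points of the Grassmannian to affine space is a morphism if its coordinates
are quotients of linear forms in the Plücker coordinates. -/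
theorem isMorphism_of_plucker [FiniteDimensional K W] {N X : Type*} {Y : Set (N → K)}
    {j : X → Gr K m W} {ψ : X → Y} (H : MvPolynomial (Fin m → Module.Dual K W) K)
    (L : N → MvPolynomial (Fin m → Module.Dual K W) K) (hH : H.IsHomogeneous 1)
    (hL : ∀ ν, (L ν).IsHomogeneous 1)
    (hH0 : ∀ x, ∀ w ∈ pluckerVectors (j x), MvPolynomial.eval w H ≠ 0)
    (hval : ∀ x, ∀ w ∈ pluckerVectors (j x), ∀ ν,
      MvPolynomial.eval w (L ν) = MvPolynomial.eval w H * (ψ x).1 ν) :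
    IsMorphism (ofFractions (pullFractions j (grassFractions K m W))) (affineSubset Y) ψ := by
  -- This is the homogenisation H^k g(L/H) of g in degree k. By `hval` its value at a Plücker vector
  -- is H^k g(ψ x) if k is at least the degree of g, and common factors H^k cancel in fractions.
  let hom : ℕ → MvPolynomial N K → MvPolynomial (Fin m → Module.Dual K W) K := fun k g =>
    ∑ i ∈ Finset.range (k + 1),
      MvPolynomial.aeval L (MvPolynomial.homogeneousComponent i g) * H ^ (k - i)
  have hhom : ∀ k g, (hom k g).IsHomogeneous k := by
    intro k g
    refine MvPolynomial.IsHomogeneous.sum _ _ _ fun i hi => ?_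
    have h1 := (MvPolynomial.homogeneousComponent_isHomogeneous i g).aeval L hL
    have h2 := h1.mul (hH.pow (k - i))
    have hi' := Finset.mem_range.1 hi
    have h3 : 1 * i + 1 * (k - i) = k := by omega
    rwa [h3] at h2
  have heval : ∀ k g, MvPolynomial.totalDegree g ≤ k → ∀ x, ∀ w ∈ pluckerVectors (j x),
      MvPolynomial.eval w (hom k g) =
        MvPolynomial.eval w H ^ k * MvPolynomial.eval (ψ x).1 g := by
    intro k g hk x w hw
    have hLw : ∀ p : MvPolynomial N K, MvPolynomial.eval w (MvPolynomial.aeval L p) =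
        MvPolynomial.eval (MvPolynomial.eval w H • (ψ x).1) p := by
      intro p
      have h1 : (MvPolynomial.eval w H • (ψ x).1) = fun ν => MvPolynomial.eval w (L ν) :=
        funext fun ν => (hval x w hw ν).symm
      rw [h1]
      induction p using MvPolynomial.induction_on with
      | C a => rw [← MvPolynomial.algebraMap_eq, AlgHom.commutes]; simp
      | add p q hp hq => rw [map_add, map_add, map_add, hp, hq]
      | mul_X p ν hp =>
        rw [map_mul, map_mul, map_mul, hp, MvPolynomial.aeval_X, MvPolynomial.eval_X]
    have h2 : g = ∑ i ∈ Finset.range (k + 1), MvPolynomial.homogeneousComponent i g := by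
      conv_lhs => rw [← MvPolynomial.sum_homogeneousComponent g]
      refine Finset.sum_subset (Finset.range_mono (by omega)) fun i _ hi => ?_
      exact MvPolynomial.homogeneousComponent_eq_zero _ _ (by
        rw [Finset.mem_range] at hi; omega)
    conv_rhs => rw [h2]
    rw [map_sum, map_sum, Finset.mul_sum]
    refine Finset.sum_congr rfl fun i hi => ?_
    have hi' := Finset.mem_range.1 hi
    rw [map_mul, hLw, map_pow, eval_smul_of_isHomogeneous
      (MvPolynomial.homogeneousComponent_isHomogeneous i g), mul_right_comm, ← pow_add]
    congr 2
    omega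
  refine isMorphism_ofFractions ?_
  rintro _ ⟨⟨D, f₀⟩, ⟨g, h, hdom, hfun⟩, rfl⟩ x hx
  dsimp only at hdom hfun
  subst hdom hfun
  obtain ⟨k, hgk, hhk⟩ : ∃ k, g.totalDegree ≤ k ∧ h.totalDegree ≤ k :=
    ⟨_, le_max_left _ _, le_max_right _ _⟩
  obtain ⟨f, hf⟩ := exists_grassFraction (hhom k g) (hhom k h)
  refine ⟨_, ⟨(_, f), ⟨k, hom k g, hom k h, hhom k g, hhom k h, rfl, hf⟩, rfl⟩, ?_, ?_⟩
  · obtain ⟨w, hw⟩ := exists_mem_pluckerVectors (j x)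
    refine ⟨w, hw, ?_⟩
    rw [heval k h hhk x w hw]
    exact mul_ne_zero (pow_ne_zero _ (hH0 x w hw)) hx
  · rintro y ⟨w, hw, hw0⟩
    have hw1 := hw0
    rw [heval k h hhk y w hw] at hw1
    have hy : MvPolynomial.eval (ψ y).1 h ≠ 0 := right_ne_zero_of_mul hw1
    refine ⟨hy, ?_⟩
    change _ = f (j y)
    rw [hf _ w hw hw0, heval k g hgk y w hw, heval k h hhk y w hw,
      mul_div_mul_left _ _ (pow_ne_zero k (hH0 y w hw))]
    rfl

/-- Cramer's rule for a linear form on the span of `m` vectors. -/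
theorem apply_mul_det_eq_sum {v : Fin m → W} (φ : Fin m → Module.Dual K W)
    (l : Module.Dual K W) {y : W} (hy : y ∈ Submodule.span K (Set.range v)) :
    l y * Matrix.det (Matrix.of fun i j => φ i (v j)) =
      ∑ i, φ i y * Matrix.det (Matrix.of fun i' j => Function.update φ i l i' (v j)) := by
  obtain ⟨s, rfl⟩ := (Submodule.mem_span_range_iff_exists_fun K).1 hy
  set A : Matrix (Fin m) (Fin m) K := Matrix.of fun i j => φ i (v j) with hA
  -- Replacing φ_i by l replaces the i-th row, whereas `Matrix.cramer` replaces columns; hence the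
  -- transpose.
  have h1 : ∀ i, Matrix.det (Matrix.of fun i' j => Function.update φ i l i' (v j)) =
      Matrix.cramer A.transpose (fun j => l (v j)) i := by
    intro i
    rw [Matrix.cramer_transpose_apply]
    congr 1
    ext i' j
    by_cases h : i' = i
    · subst h
      rw [Matrix.updateRow_self, Matrix.of_apply, Function.update_self]
    · rw [Matrix.updateRow_ne h, Matrix.of_apply, Function.update_of_ne h, hA, Matrix.of_apply]
  have h2 := Matrix.mulVec_cramer A.transpose (fun j => l (v j))
  rw [Matrix.det_transpose] at h2
  simp only [h1]
  simp only [map_sum, map_smul, smul_eq_mul, Finset.sum_mul]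
  rw [Finset.sum_comm]
  refine Finset.sum_congr rfl fun j _ => ?_
  have h3 := congrFun h2 j
  rw [Pi.smul_apply, smul_eq_mul, Matrix.mulVec, dotProduct] at h3
  rw [mul_assoc, mul_comm (l (v j)), ← h3, Finset.mul_sum]
  refine Finset.sum_congr rfl fun i _ => ?_
  rw [Matrix.transpose_apply, hA, Matrix.of_apply, mul_assoc]

end Geometry

/-! ## `Grass(σ)` as a closed subset of affine space -/

section GrassAffine

variable {K V : Type*} [Field K] [Fintype V] [Quiver V] {I : Ideal (PathAlgebra K V)}
  [I.IsTwoSided] {t : ℕ} {e : Fin t → V} {σ : Finset (TopPath e)}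

/-- The coordinates of the elements of `P` with respect to `σ`, modulo `U(c)`. -/
def coordTop {c : CoordIndex σ → K} (hc : c ∈ annihilated I σ) :
    PCover e I →ₗ[K] ({q // q ∈ σ} → K) :=
  ((liftTop (M := CoeffModule hc) (topVec c)).restrictScalars K :
    PCover e I →ₗ[K] CoeffModule hc)

theorem coordTop_pathTop {c : CoordIndex σ → K} (hc : c ∈ annihilated I σ) (y : TopPath e) :
    coordTop hc (pathTop I y) = pathAt (act c) (topVec c) y := by
  change liftTop (M := CoeffModule hc) (topVec c) (pathTop I y) = _
  rw [pathTop, map_smul]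
  exact congrArg (fun v : CoeffModule hc => toLam I (ofPath K y.toQPath) • v)
    (liftTop_zTop (M := CoeffModule hc) (fun r => act_vertex_topVec c r) y.1)

open Classical in
theorem coordTop_of_mem (hσ : IsPathClosed σ) {c : CoordIndex σ → K}
    (hc : c ∈ annihilated I σ) (q : {q // q ∈ σ}) :
    coordTop hc (pathTop I q.1) = Pi.single q 1 := by
  rw [coordTop_pathTop, pathAt_act_single hσ]

theorem coordTop_sum (hσ : IsPathClosed σ) {c : CoordIndex σ → K} (hc : c ∈ annihilated I σ)
    (v : {q // q ∈ σ} → K) :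
    coordTop hc (∑ q : {q // q ∈ σ}, v q • pathTop I q.1) = v := by
  classical
  rw [map_sum]
  refine funext fun q => ?_
  rw [Finset.sum_apply, Finset.sum_eq_single q]
  · rw [map_smul, coordTop_of_mem hσ, Pi.smul_apply, Pi.single_eq_same, smul_eq_mul, mul_one]
  · intro q' _ hq'
    rw [map_smul, coordTop_of_mem hσ, Pi.smul_apply, Pi.single_eq_of_ne hq'.symm, smul_zero]
  · simp

/-- Modulo U(c) every element of P is a combination of paths in σ, and its coefficients are read off
by `coordTop`. -/
theorem coordTop_eq_zero_iff (hσ : IsPathClosed σ) {c : CoordIndex σ → K}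
    (hc : c ∈ annihilated I σ) (y : PCover e I) :
    coordTop hc y = 0 ↔ y ∈ USub I σ c := by
  have hle : USub I σ c ≤ LinearMap.ker (liftTop (M := CoeffModule hc) (topVec c)) := by
    refine Submodule.span_le.2 ?_
    rintro _ ⟨x, rfl⟩
    change coordTop hc (critDiff I σ c x) = 0
    rw [critDiff, map_sub, map_sum, coordTop_pathTop, relations_act hσ c x, sub_eq_zero]
    refine Finset.sum_congr rfl fun q _ => ?_
    rw [map_smul, coordTop_pathTop]
  refine ⟨fun h => ?_, fun h => hle h⟩
  obtain ⟨v, hv⟩ := exists_mkQ_eq_realize hσ (isCoeffFamily_USub (I := I) c) y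
  have h1 : (USub I σ c).mkQ y =
      (USub I σ c).mkQ (∑ q : {q // q ∈ σ}, v q • pathTop I q.1) := by
    rw [hv, realize, Fintype.linearCombination_apply, map_sum]
    refine Finset.sum_congr rfl fun q _ => ?_
    rw [map_pathAt (USub I σ c).mkQ]
    rfl
  have h2 : y - ∑ q : {q // q ∈ σ}, v q • pathTop I q.1 ∈ USub I σ c :=
    (Submodule.Quotient.eq _).1 h1
  have h3 : coordTop hc (y - ∑ q : {q // q ∈ σ}, v q • pathTop I q.1) = 0 := hle h2
  rw [map_sub, h, coordTop_sum hσ, zero_sub, neg_eq_zero] at h3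
  simpa [h3] using h2

/-- For fixed y = ∑ a_r z_r the coordinates are those of the a_r in the representation attached to
c, and these are values at c of the polynomials `coordPoly`. -/
theorem exists_coordTop_eq_eval (y : PCover e I) :
    ∃ P : {q // q ∈ σ} → MvPolynomial (CoordIndex σ) K,
      ∀ (c : CoordIndex σ → K) (hc : c ∈ annihilated I σ) (q : {q // q ∈ σ}),
        coordTop hc y q = MvPolynomial.eval c (P q) := by
  choose a ha using fun r => toLam_surjective I (y r).1
  refine ⟨fun q => ∑ r, coordPoly σ (a r) r q, fun c hc q => ?_⟩
  have h1 : coordTop hc y = ∑ r, act c (a r) (topVec c r) := by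
    change ∑ r, lamEnd hc (y r).1 (topVec c r) = _
    refine Finset.sum_congr rfl fun r _ => ?_
    rw [← ha]
    rfl
  rw [h1, Finset.sum_apply, map_sum]
  refine Finset.sum_congr rfl fun r _ => ?_
  rw [eval_coordPoly]

theorem sub_sum_mem_USub (hσ : IsPathClosed σ) {c : CoordIndex σ → K}
    (hc : c ∈ annihilated I σ) (y : PCover e I) :
    y - ∑ q : {q // q ∈ σ}, coordTop hc y q • pathTop I q.1 ∈ USub I σ c := by
  rw [← coordTop_eq_zero_iff hσ hc, map_sub, coordTop_sum hσ, sub_self]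

variable [∀ a b : V, Finite (a ⟶ b)]

/-- The complement spanned by σ does not depend on c, so a basis of one U(c₀) can be moved into all
U(c) by polynomial corrections, without passing to smaller open sets. -/
theorem isMorphism_USub (hI : IsAdmissible I) (hσ : IsAbstractSkeleton (maxLength I) σ) {d : ℕ}
    {Y : Set (CoordIndex σ → K)} (hY : Y ⊆ annihilated I σ) (θ : Y → Grass I σ d)
    (hθ : ∀ c, (θ c).1 = USub I σ c.1) :
    IsMorphism (affineSubset Y) (grassVariety I σ d) θ := by
  rcases isEmpty_or_nonempty Y with hemp | ⟨⟨c₀⟩⟩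
  · exact isMorphism_ofFractions fun p _ x => isEmptyElim x
  have := finite_pCover (e := e) hI
  have hfin : FiniteDimensional K (JP I e) :=
    inferInstanceAs (FiniteDimensional K ((JP I e).restrictScalars K))
  have hcl := hσ.isPathClosed
  let b := Module.finBasisOfFinrankEq K (toGr I σ d (θ c₀)).1 (toGr I σ d (θ c₀)).2
  have hb0 : ∀ i, coordTop (hY c₀.2) (b i).1.1 = 0 := fun i => by
    rw [coordTop_eq_zero_iff hcl, ← hθ]
    exact (b i).2
  have hU : ∀ c : Y, USub I σ c.1 ≤ JP I e := fun c => hθ c ▸ (θ c).2.1.1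
  -- The vector w c i is the projection to U(c), along the span of σ, of the i-th basis vector of
  -- U(c₀).
  let w : Y → Fin _ → PCover e I := fun c i => (b i).1.1 -
    ∑ q : {q // q ∈ σ}, coordTop (hY c.2) (b i).1.1 q • pathTop I q.1
  have hw : ∀ c i, w c i ∈ USub I σ c.1 := fun c i => sub_sum_mem_USub hcl (hY c.2) _
  have hw0 : ∀ c i, coordTop (hY c₀.2) (w c i) = - coordTop (hY c.2) (b i).1.1 := fun c i => by
    rw [map_sub, hb0, coordTop_sum hcl, zero_sub]
  let u : Y → Fin _ → JP I e := fun c i => ⟨w c i, hU c (hw c i)⟩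
  have hli : ∀ c, LinearIndependent K (u c) := by
    intro c
    rw [Fintype.linearIndependent_iff]
    intro s hs
    have h1 : ∑ i, s i • w c i = 0 := by
      have := congrArg Subtype.val hs
      rw [Submodule.coe_sum] at this
      exact this
    have h2 : ∑ i, s i • coordTop (hY c.2) (b i).1.1 = 0 := by
      have := congrArg (coordTop (hY c₀.2)) h1
      simp only [map_sum, map_smul, hw0, smul_neg, Finset.sum_neg_distrib, map_zero,
        neg_eq_zero] at this
      exact this
    -- If ∑ s_i w_i = 0, its σ-coordinates for c₀ vanish; by `hw0` they are minus those of ∑ s_i b_i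
    -- for c. So the correction terms vanish too and ∑ s_i b_i = 0.
    have h3 : ∑ i, s i • (b i).1.1 = 0 := by
      have h4 : ∑ i, s i • (b i).1.1 - ∑ i, s i • w c i =
          ∑ q : {q // q ∈ σ}, (∑ i, s i • coordTop (hY c.2) (b i).1.1) q • pathTop I q.1 := by
        rw [← Finset.sum_sub_distrib]
        simp only [Finset.sum_apply, Finset.sum_smul]
        rw [Finset.sum_comm]
        refine Finset.sum_congr rfl fun i _ => ?_
        rw [← smul_sub, sub_sub_cancel, Finset.smul_sum]
        refine Finset.sum_congr rfl fun q _ => ?_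
        rw [Pi.smul_apply, smul_assoc]
      rw [h1, h2, sub_zero] at h4
      rw [h4]
      simp
    refine Fintype.linearIndependent_iff.1 b.linearIndependent s (Subtype.ext (Subtype.ext ?_))
    rw [Submodule.coe_sum, Submodule.coe_sum]
    exact h3
  refine isMorphism_of_polynomial_basis u hli (fun c => ?_) fun φ i => ?_
  · refine Submodule.eq_of_le_of_finrank_eq (Submodule.span_le.2 ?_) ?_
    · rintro _ ⟨i, rfl⟩
      change w c i ∈ (θ c).1
      rw [hθ]
      exact hw c i
    · rw [finrank_span_eq_card (hli c), Fintype.card_fin, (toGr I σ d (θ c)).2]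
  -- The form is extended from JP to P so that it can be applied to every path in σ separately, the
  -- z_r included.
  · obtain ⟨φ', hφ'⟩ := LinearMap.exists_extend (p := (JP I e).restrictScalars K) φ
    obtain ⟨P, hP⟩ := exists_coordTop_eq_eval (σ := σ) (b i).1.1
    refine ⟨MvPolynomial.C (φ' (b i).1.1) - ∑ q : {q // q ∈ σ},
      P q * MvPolynomial.C (φ' (pathTop I q.1)), fun c => ?_⟩
    have h1 : φ (u c i) = φ' (w c i) := (LinearMap.congr_fun hφ' (u c i)).symm
    rw [h1, map_sub, map_sub, map_sum, map_sum, MvPolynomial.eval_C]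
    congr 1
    refine Finset.sum_congr rfl fun q _ => ?_
    rw [map_mul, MvPolynomial.eval_C, ← hP c.1 (hY c.2), map_smul, smul_eq_mul]

/-- The critical difference of x lies in C. Coordinate forms of the projection to C₀ along σ take
values on it which do not involve the coefficients, while a σ-coordinate form takes the value l'(x)
- c_{x,q}. Cramer's rule for forms on C then determines c_{x,q}. -/
theorem isMorphism_coeff (hI : IsAdmissible I) (hσ : IsAbstractSkeleton (maxLength I) σ) {d : ℕ}
    {Y : Set (CoordIndex σ → K)} (hY : Y ⊆ annihilated I σ) (ψ : Grass I σ d → Y)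
    (hψ : ∀ C, IsCoeffFamily I σ C.1 (ψ C).1) :
    IsMorphism (grassVariety I σ d) (affineSubset Y) ψ := by
  classical
  rcases isEmpty_or_nonempty (Grass I σ d) with hemp | ⟨⟨C₀⟩⟩
  · exact isMorphism_ofFractions fun p _ x => isEmptyElim x
  have := finite_pCover (e := e) hI
  have hfin : FiniteDimensional K (JP I e) :=
    inferInstanceAs (FiniteDimensional K ((JP I e).restrictScalars K))
  have hcl := hσ.isPathClosed
  have hU : ∀ C, USub I σ (ψ C).1 = C.1 := fun C => USub_eq_of_grass hI hσ C (hψ C)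
  have hc₀ : (ψ C₀).1 ∈ annihilated I σ := hY (ψ C₀).2
  let b := Module.finBasisOfFinrankEq K (toGr I σ d C₀).1 (toGr I σ d C₀).2
  -- The projection of P onto C₀ along the span of σ.
  let pr : PCover e I →ₗ[K] PCover e I := LinearMap.id -
    (Fintype.linearCombination K fun q : {q // q ∈ σ} => pathTop I q.1) ∘ₗ coordTop hc₀
  have hpr : ∀ y, pr y = y - ∑ q : {q // q ∈ σ}, coordTop hc₀ y q • pathTop I q.1 := fun y => rfl
  have hprU : ∀ y, pr y ∈ C₀.1 := fun y => by
    rw [← hU C₀]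
    exact sub_sum_mem_USub hcl hc₀ y
  have hpr0 : ∀ q ∈ σ, pr (pathTop I q) = 0 := fun q hq => by
    rw [hpr, coordTop_of_mem hcl hc₀ ⟨q, hq⟩, Finset.sum_eq_single ⟨q, hq⟩]
    · rw [Pi.single_eq_same, one_smul, sub_self]
    · intro q' _ hq'
      rw [Pi.single_eq_of_ne hq', zero_smul]
    · simp
  let pr' : PCover e I →ₗ[K] (toGr I σ d C₀).1 :=
    { toFun := fun y => ⟨⟨pr y, C₀.2.1.1 (hprU y)⟩, hprU y⟩
      map_add' := fun y z => Subtype.ext (Subtype.ext (map_add pr y z))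
      map_smul' := fun k y => Subtype.ext (Subtype.ext (map_smul pr k y)) }
  let incl : JP I e →ₗ[K] PCover e I := (JP I e).subtype.restrictScalars K
  let Φ' : Fin _ → Module.Dual K (PCover e I) := fun i => b.coord i ∘ₗ pr'
  let Φ : Fin _ → Module.Dual K (JP I e) := fun i => Φ' i ∘ₗ incl
  let l' : {q // q ∈ σ} → Module.Dual K (PCover e I) := fun q =>
    LinearMap.proj q ∘ₗ coordTop hc₀
  let l : {q // q ∈ σ} → Module.Dual K (JP I e) := fun q => l' q ∘ₗ incl
  let toσ : (ν : CoordIndex σ) → {q // q ∈ σ} := fun ν => ⟨ν.2.1, mem_of_mem_sigmaSet ν.2.2⟩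
  refine isMorphism_of_plucker (MvPolynomial.X Φ) (fun ν =>
    MvPolynomial.C (l' (toσ ν) (pathTop I ν.1.1)) * MvPolynomial.X Φ -
      ∑ i, MvPolynomial.C (Φ' i (pathTop I ν.1.1)) *
        MvPolynomial.X (Function.update Φ i (l (toσ ν)))) (MvPolynomial.isHomogeneous_X _ _) ?_ ?_ ?_
  · exact fun ν => (MvPolynomial.isHomogeneous_C_mul_X _ _).sub
      (MvPolynomial.IsHomogeneous.sum _ _ _ fun i _ => MvPolynomial.isHomogeneous_C_mul_X _ _)
  -- A singular matrix gives a combination y of the basis of C with pr y = 0, that is, an element of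
  -- C in the span of σ. Since σ is independent modulo C, y = 0, against the independence of the
  -- basis.
  · rintro C _ ⟨v, hv, hvC, rfl⟩ h0
    rw [MvPolynomial.eval_X] at h0
    obtain ⟨s, hs, hs0⟩ := Matrix.exists_mulVec_eq_zero_iff.2 h0
    apply hs
    let y : JP I e := ∑ j, s j • v j
    have hyC : y.1 ∈ C.1 := by
      have h1 : y ∈ (toGr I σ d C).1 := by
        rw [← hvC]
        exact Submodule.sum_mem _ fun j _ => Submodule.smul_mem _ _
          (Submodule.subset_span ⟨j, rfl⟩)
      exact h1
    have hΦ : ∀ i, Φ i y = 0 := fun i => by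
      rw [map_sum]
      refine Eq.trans ?_ (congrFun hs0 i)
      rw [Matrix.mulVec, dotProduct]
      refine Finset.sum_congr rfl fun j _ => ?_
      rw [map_smul, smul_eq_mul, mul_comm, Matrix.of_apply]
    have hpry : pr y.1 = 0 := by
      have h1 : pr' y.1 = 0 := b.ext_elem fun i => by
        rw [map_zero]
        exact hΦ i
      exact congrArg (fun z : (toGr I σ d C₀).1 => z.1.1) h1
    have hcy : coordTop (hY (ψ C).2) y.1 = 0 := by
      rw [coordTop_eq_zero_iff hcl, hU C]
      exact hyC
    rw [hpr, sub_eq_zero] at hpry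
    rw [hpry, coordTop_sum hcl] at hcy
    have hy0 : y = 0 := by
      refine Subtype.ext ?_
      rw [hpry, hcy]
      simp
    exact funext fun j => Fintype.linearIndependent_iff.1 hv s hy0 j
  · rintro C _ ⟨v, hv, hvC, rfl⟩ ⟨x, q⟩
    have hcrit : critDiff I σ (ψ C).1 x ∈ C.1 := by
      rw [← hU C]
      exact Submodule.subset_span ⟨x, rfl⟩
    let y : JP I e := ⟨critDiff I σ (ψ C).1 x, C.2.1.1 hcrit⟩
    have hy : y ∈ Submodule.span K (Set.range v) := by
      rw [hvC]
      exact hcrit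
    -- The projection kills the paths in σ, so the terms with unknown coefficients disappear from
    -- the critical difference.
    have hΦ : ∀ i, Φ i y = Φ' i (pathTop I x.1) := fun i => by
      change Φ' i (critDiff I σ (ψ C).1 x) = _
      rw [critDiff, map_sub, map_sum, Finset.sum_eq_zero, sub_zero]
      intro q' _
      rw [map_smul]
      have h1 : pr' (pathTop I q'.1) = 0 :=
        Subtype.ext (Subtype.ext (hpr0 _ (mem_of_mem_sigmaSet q'.2)))
      have h2 : Φ' i (pathTop I q'.1) = b.coord i (pr' (pathTop I q'.1)) := rfl
      rw [h2, h1, map_zero, smul_zero]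
    -- Among the paths of the σ-set only q itself contributes to the coordinate at q.
    have hl : l (toσ ⟨x, q⟩) y = l' (toσ ⟨x, q⟩) (pathTop I x.1) - (ψ C).1 ⟨x, q⟩ := by
      change l' (toσ ⟨x, q⟩) (critDiff I σ (ψ C).1 x) = _
      rw [critDiff, map_sub, map_sum]
      congr 1
      rw [Finset.sum_eq_single q]
      · rw [map_smul]
        change _ • coordTop hc₀ (pathTop I (toσ ⟨x, q⟩).1) (toσ ⟨x, q⟩) = _
        rw [coordTop_of_mem hcl hc₀, Pi.single_eq_same, smul_eq_mul, mul_one]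
      · intro q' _ hq'
        rw [map_smul]
        change _ • coordTop hc₀ (pathTop I (toσ ⟨x, q'⟩).1) (toσ ⟨x, q⟩) = _
        rw [coordTop_of_mem hcl hc₀, Pi.single_eq_of_ne, smul_zero]
        intro h
        exact hq' (Subtype.ext (congrArg (fun z : {q // q ∈ σ} => z.1) h).symm)
      · simp
    have hcr := apply_mul_det_eq_sum Φ (l (toσ ⟨x, q⟩)) hy
    rw [hl] at hcr
    simp only [map_sub, map_sum, map_mul, MvPolynomial.eval_C, MvPolynomial.eval_X]
    simp only [hΦ] at hcr
    rw [← hcr]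
    ring

end GrassAffine

/-! ## The algorithm on codes -/

section Codes

/-- The list of the pairs of starting point and end point of the arrows, the list of the vertices
`e(r)`, and the list of the codes of the paths in `σ`. -/
abbrev AlgEnv := List (ℕ × ℕ) × List ℕ × List PathCode

/-- Combinations of paths whose coefficients are sums of monomials, given by their codes. -/
abbrev CodeState := List (PathCode × List (PathCode × PathCode))

/-- The end point of a path in `P̂`. -/
def codeEnd (E : AlgEnv) (q : PathCode) : ℕ :=
  -- The last arrow determines the end point; a path of length zero ends in e(r). The default values
  -- are met only for lists that do not code a path.
  q.2.foldl (fun _ i => (E.1.getD i (0, 0)).2) (E.2.1.getD q.1 0)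

/-- The combination which represents a path in `σ`, or a critical path. -/
def codeNormalForm (E : AlgEnv) (y : PathCode) : CodeState :=
  -- Membership in the list is expressed by the index of y. There is no test of criticality: on
  -- codes of a skeleton only prolongations of paths in σ occur here, and those outside σ are
  -- critical.
  if @List.idxOf PathCode instBEqOfDecidableEq y E.2.2 < E.2.2.length then [(y, [])]
  else E.2.2.flatMap fun q =>
    if y.2.length ≤ q.2.length ∧ codeEnd E q = codeEnd E y then [(q, [(y, q)])] else []

/-- The action of an arrow on a combination. -/
def codeStep (E : AlgEnv) (S : CodeState) (i : ℕ) : CodeState :=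
  S.flatMap fun T =>
    if codeEnd E T.1 = (E.1.getD i (0, 0)).1 then
      (codeNormalForm E (T.1.1, T.1.2 ++ [i])).map fun T' => (T'.1, T.2 ++ T'.2)
    else []

/-- The action of a path on the element `ẑ_r`. -/
def codePathState (E : AlgEnv) (r : ℕ) (p : PathCode) : CodeState :=
  -- The start is ẑ_r with coefficient one, as ẑ_r belongs to σ; a path which starts in another
  -- vertex annihilates it.
  p.2.foldl (codeStep E) (if E.2.1.getD r 0 = p.1 then [((r, []), [])] else [])

-- This and the following computability lemmas show that the algorithm is primitive recursive: it is
-- composed of folds and maps over lists and of decidable comparisons, without unbounded search.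
open Primrec in
theorem primrec_codeEnd : Primrec₂ codeEnd := by
  refine list_foldl (f := fun x : AlgEnv × PathCode => x.2.2)
    (g := fun x : AlgEnv × PathCode => x.1.2.1.getD x.2.1 0)
    (h := fun (x : AlgEnv × PathCode) (y : ℕ × ℕ) => (x.1.1.getD y.2 (0, 0)).2) ?_ ?_ ?_
  · exact snd.comp snd
  · exact (list_getD 0).comp (fst.comp (snd.comp fst)) (fst.comp snd)
  · exact snd.comp ((list_getD (0, 0)).comp (fst.comp (fst.comp fst)) (snd.comp snd))

open Primrec in
theorem primrec_codeNormalForm : Primrec₂ codeNormalForm := by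
  have hsc : Primrec fun x : AlgEnv × PathCode => x.1.2.2 := snd.comp (snd.comp fst)
  refine ite ?_ ?_ ?_
  · exact nat_lt.comp (list_idxOf.comp snd hsc) (list_length.comp hsc)
  · exact list_cons.comp (Primrec.pair snd (const [])) (const [])
  · refine list_flatMap hsc ?_
    have h1 : Primrec fun z : (AlgEnv × PathCode) × PathCode => z.1.1 := fst.comp fst
    have h2 : Primrec fun z : (AlgEnv × PathCode) × PathCode => z.1.2 := snd.comp fst
    have h3 : Primrec fun z : (AlgEnv × PathCode) × PathCode => z.2 := snd
    refine ite (PrimrecPred.and ?_ ?_) ?_ (const [])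
    · exact nat_le.comp (list_length.comp (snd.comp h2)) (list_length.comp (snd.comp h3))
    · exact Primrec.eq.comp (primrec_codeEnd.comp h1 h3) (primrec_codeEnd.comp h1 h2)
    · exact list_cons.comp (Primrec.pair h3 (list_cons.comp (Primrec.pair h2 h3) (const [])))
        (const [])

open Primrec in
theorem primrec_codeStep :
    Primrec₂ fun (E : AlgEnv) (x : CodeState × ℕ) => codeStep E x.1 x.2 := by
  have hS : Primrec fun x : AlgEnv × CodeState × ℕ => x.2.1 := fst.comp snd
  refine list_flatMap hS ?_
  have hE : Primrec fun z : (AlgEnv × CodeState × ℕ) × (PathCode × List (PathCode × PathCode)) =>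
    z.1.1 := fst.comp fst
  have hi : Primrec fun z : (AlgEnv × CodeState × ℕ) × (PathCode × List (PathCode × PathCode)) =>
    z.1.2.2 := snd.comp (snd.comp fst)
  have hq : Primrec fun z : (AlgEnv × CodeState × ℕ) × (PathCode × List (PathCode × PathCode)) =>
    z.2.1 := fst.comp snd
  refine ite ?_ ?_ (const [])
  · exact Primrec.eq.comp (primrec_codeEnd.comp hE hq)
      (fst.comp ((list_getD (0, 0)).comp (fst.comp hE) hi))
  · refine list_map (primrec_codeNormalForm.comp hE (Primrec.pair (fst.comp hq)
      (list_append.comp (snd.comp hq) (list_cons.comp hi (const []))))) ?_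
    exact Primrec.pair (fst.comp snd) (list_append.comp (snd.comp (snd.comp fst)) (snd.comp snd))

open Primrec in
theorem primrec_codePathState :
    Primrec fun x : AlgEnv × ℕ × PathCode => codePathState x.1 x.2.1 x.2.2 := by
  refine list_foldl (f := fun x : AlgEnv × ℕ × PathCode => x.2.2.2)
    (g := fun x : AlgEnv × ℕ × PathCode =>
      (if x.1.2.1.getD x.2.1 0 = x.2.2.1 then [((x.2.1, []), [])] else [] : CodeState))
    (h := fun (x : AlgEnv × ℕ × PathCode) (y : CodeState × ℕ) => codeStep x.1 y.1 y.2) ?_ ?_ ?_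
  · exact snd.comp (snd.comp snd)
  · refine ite (Primrec.eq.comp ((list_getD 0).comp (fst.comp (snd.comp fst)) (fst.comp snd))
      (fst.comp (snd.comp snd))) ?_ (const [])
    exact list_cons.comp (Primrec.pair (Primrec.pair (fst.comp snd) (const [])) (const []))
      (const [])
  · exact primrec_codeStep.comp (fst.comp fst) snd

/-- The terms which a path contributes to the coefficient of `q`. -/
def codeTerms (k : ℕ) (q : PathCode) (S : CodeState) :
    List (ℤ × List ℕ × List (PathCode × PathCode)) :=
  S.flatMap fun T' => if T'.1 = q then [(1, [k], T'.2)] else []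

open Primrec in
theorem primrec_codeTerms :
    Primrec fun x : ℕ × PathCode × CodeState => codeTerms x.1 x.2.1 x.2.2 := by
  refine list_flatMap (f := fun x : ℕ × PathCode × CodeState => x.2.2)
    (g := fun (x : ℕ × PathCode × CodeState) T' =>
      if T'.1 = x.2.1 then [((1 : ℤ), [x.1], T'.2)] else []) (snd.comp snd) ?_
  have hx : Primrec fun z : (ℕ × PathCode × CodeState) ×
      (PathCode × List (PathCode × PathCode)) => z.1 := fst
  have hT : Primrec fun z : (ℕ × PathCode × CodeState) ×
      (PathCode × List (PathCode × PathCode)) => z.2 := snd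
  have hk : Primrec fun z : (ℕ × PathCode × CodeState) ×
      (PathCode × List (PathCode × PathCode)) => [z.1.1] :=
    list_cons.comp (fst.comp hx) (const [])
  refine ite (Primrec.eq.comp (fst.comp hT) (fst.comp (snd.comp hx))) ?_ (const [])
  exact list_cons.comp (Primrec.pair (const (1 : ℤ)) (Primrec.pair hk (snd.comp hT))) (const [])

/-- The coefficient of the path `q` in `ρ ẑ_r`. -/
def codeCoeff (E : AlgEnv) (r : ℕ) (q : PathCode) (ρ : List (ℕ × PathCode)) :
    List (ℤ × List ℕ × List (PathCode × PathCode)) :=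
  ρ.flatMap fun T => codeTerms T.1 q (codePathState E r T.2)

open Primrec in
theorem primrec_codeCoeff : Primrec fun x : (AlgEnv × ℕ) × PathCode × List (ℕ × PathCode) =>
    codeCoeff x.1.1 x.1.2 x.2.1 x.2.2 := by
  refine list_flatMap (f := fun x : (AlgEnv × ℕ) × PathCode × List (ℕ × PathCode) => x.2.2)
    (g := fun (x : (AlgEnv × ℕ) × PathCode × List (ℕ × PathCode)) T =>
      codeTerms T.1 x.2.1 (codePathState x.1.1 x.1.2 T.2)) (snd.comp snd) ?_
  have hx : Primrec fun z : ((AlgEnv × ℕ) × PathCode × List (ℕ × PathCode)) ×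
      (ℕ × PathCode) => z.1 := fst
  have hT : Primrec fun z : ((AlgEnv × ℕ) × PathCode × List (ℕ × PathCode)) ×
      (ℕ × PathCode) => z.2 := snd
  have hp : Primrec fun z : ((AlgEnv × ℕ) × PathCode × List (ℕ × PathCode)) ×
      (ℕ × PathCode) => ((z.1.1.1, z.1.1.2, z.2.2) : AlgEnv × ℕ × PathCode) :=
    Primrec.pair (fst.comp (fst.comp hx)) (Primrec.pair (snd.comp (fst.comp hx)) (snd.comp hT))
  have hS : Primrec fun z : ((AlgEnv × ℕ) × PathCode × List (ℕ × PathCode)) ×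
      (ℕ × PathCode) => codePathState z.1.1.1 z.1.1.2 z.2.2 :=
    Primrec.comp (f := fun x : AlgEnv × ℕ × PathCode => codePathState x.1 x.2.1 x.2.2)
      (g := fun z : ((AlgEnv × ℕ) × PathCode × List (ℕ × PathCode)) ×
        (ℕ × PathCode) => (z.1.1.1, z.1.1.2, z.2.2)) primrec_codePathState hp
  have hq : Primrec fun z : ((AlgEnv × ℕ) × PathCode × List (ℕ × PathCode)) ×
      (ℕ × PathCode) => ((z.2.1, z.1.2.1, codePathState z.1.1.1 z.1.1.2 z.2.2) :
        ℕ × PathCode × CodeState) :=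
    Primrec.pair (fst.comp hT) (Primrec.pair (fst.comp (snd.comp hx)) hS)
  exact Primrec.comp (f := fun x : ℕ × PathCode × CodeState => codeTerms x.1 x.2.1 x.2.2)
    (g := fun z : ((AlgEnv × ℕ) × PathCode × List (ℕ × PathCode)) ×
      (ℕ × PathCode) => (z.2.1, z.1.2.1, codePathState z.1.1.1 z.1.1.2 z.2.2))
    primrec_codeTerms hq

/-- The coefficients of `ρ ẑ_r`, for all indices `r`. -/
def codeCoeffs (E : AlgEnv) (ρ : List (ℕ × PathCode)) : AlgOutput :=
  (List.range E.2.1.length).flatMap fun r => E.2.2.map fun q => codeCoeff E r q ρ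

open Primrec in
theorem primrec_codeCoeffs : Primrec₂ codeCoeffs := by
  refine list_flatMap (f := fun x : AlgEnv × List (ℕ × PathCode) => List.range x.1.2.1.length)
    (g := fun (x : AlgEnv × List (ℕ × PathCode)) r =>
      x.1.2.2.map fun q => codeCoeff x.1 r q x.2)
    (list_range.comp (list_length.comp (fst.comp (snd.comp fst)))) ?_
  refine list_map (f := fun z : (AlgEnv × List (ℕ × PathCode)) × ℕ => z.1.1.2.2)
    (g := fun z q => codeCoeff z.1.1 z.2 q z.1.2) (snd.comp (snd.comp (fst.comp fst))) ?_
  have hz : Primrec fun w : ((AlgEnv × List (ℕ × PathCode)) × ℕ) × PathCode => w.1 := fst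
  exact primrec_codeCoeff.comp (Primrec.pair (Primrec.pair (fst.comp (fst.comp hz)) (snd.comp hz))
    (Primrec.pair snd (snd.comp (fst.comp hz))))

/-- The coefficients of all the elements `ρ ẑ_r`. -/
def skeletonAlgorithm (x : AlgInput) : AlgOutput :=
  x.2.2.2.flatMap fun ρ => codeCoeffs (x.1.2, x.2.1, x.2.2.1) ρ

open Primrec in
theorem primrec_skeletonAlgorithm : Primrec skeletonAlgorithm := by
  refine list_flatMap (f := fun x : AlgInput => x.2.2.2)
    (g := fun (x : AlgInput) ρ => codeCoeffs (x.1.2, x.2.1, x.2.2.1) ρ)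
    (snd.comp (snd.comp snd)) ?_
  have hE : Primrec fun x : AlgInput => ((x.1.2, x.2.1, x.2.2.1) : AlgEnv) :=
    Primrec.pair (snd.comp fst) (Primrec.pair (fst.comp snd) (fst.comp (snd.comp snd)))
  exact primrec_codeCoeffs.comp (hE.comp fst) snd

end Codes

/-! ## Correctness of the algorithm -/

/-! ### Formal combinations of paths in σ and their values -/

section Formal

variable {V : Type*} [Quiver V] {t : ℕ} {e : Fin t → V} {σ : Finset (TopPath e)}

/-- Combinations of the paths in `σ` whose coefficients are sums of monomials. -/
abbrev FormalState (σ : Finset (TopPath e)) := List ({q // q ∈ σ} × List (CoordIndex σ))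

open Classical in
/-- The formal combination which represents a path in `σ`, or a critical path. -/
def formalNormalForm (s : List (TopPath e)) (y : TopPath e) : FormalState σ :=
  if hy : y ∈ σ then [(⟨y, hy⟩, [])]
  else if hc : IsCritical σ y then
    s.flatMap fun q => if h : q ∈ sigmaSet σ y then
      [(⟨q, mem_of_mem_sigmaSet h⟩, [⟨⟨y, hc⟩, ⟨q, h⟩⟩])] else []
  else []

open Classical in
/-- The action of an arrow on a formal combination. -/
def formalStep (s : List (TopPath e)) {a b : V} (α : a ⟶ b) (S : FormalState σ) :
    FormalState σ :=
  S.flatMap fun T => if h : T.1.1.2.1 = a then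
    (formalNormalForm s (T.1.1.snoc h α)).map fun T' => (T'.1, T.2 ++ T'.2) else []

open Classical in
/-- The action of a path on the element `ẑ_r`, as a formal combination. -/
def formalPath (σ : Finset (TopPath e)) (s : List (TopPath e)) (r : Fin t) {a : V} :
    {b : V} → Quiver.Path a b → FormalState σ
  | _, Quiver.Path.nil => if e r = a then formalNormalForm s (topVertex e r) else []
  | _, Quiver.Path.cons p α => formalStep s α (formalPath σ s r p)

open Classical in
/-- The coefficient of the path `q` in `ρ ẑ_r`, as a formal polynomial. -/
def formalCoeff {k : ℕ} (s : List (TopPath e)) (ρ : List (Fin k × QPath V)) (r : Fin t)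
    (q : {q // q ∈ σ}) : FormalPoly k (CoordIndex σ) :=
  ρ.flatMap fun T => (formalPath σ s r T.2.2.2).flatMap fun T' =>
    if T'.1 = q then [(1, [T.1], T'.2)] else []

section Eval

variable {A : Type*} [CommRing A] (c : CoordIndex σ → A) {s : List (TopPath e)}

open Classical in
/-- The element of the free module on `σ` given by a formal combination. -/
def evalState (S : FormalState σ) : {q // q ∈ σ} → A :=
  (S.map fun T => (T.2.map c).prod • Pi.single T.1 (1 : A)).sum

theorem evalState_nil : evalState c [] = 0 := rfl

open Classical in
theorem evalState_cons (T : {q // q ∈ σ} × List (CoordIndex σ)) (S : FormalState σ) :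
    evalState c (T :: S) = (T.2.map c).prod • Pi.single T.1 (1 : A) + evalState c S := by
  rw [evalState, List.map_cons, List.sum_cons]
  rfl

theorem evalState_append (S S' : FormalState σ) :
    evalState c (S ++ S') = evalState c S + evalState c S' := by
  rw [evalState, List.map_append, List.sum_append]
  rfl

theorem evalState_flatMap {ι : Type*} (l : List ι) (f : ι → FormalState σ) :
    evalState c (l.flatMap f) = (l.map fun i => evalState c (f i)).sum := by
  induction l with
  | nil => rfl
  | cons i l ih => rw [List.flatMap_cons, evalState_append, ih, List.map_cons, List.sum_cons]

theorem evalState_mul (l : List (CoordIndex σ)) (S : FormalState σ) :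
    evalState c (S.map fun T => (T.1, l ++ T.2)) = (l.map c).prod • evalState c S := by
  induction S with
  | nil => rw [List.map_nil, evalState_nil, smul_zero]
  | cons T S ih =>
    rw [List.map_cons, evalState_cons, evalState_cons, ih, smul_add, smul_smul, List.map_append,
      List.prod_append]

/-- The list has no repetitions, so each member of the σ-set contributes exactly once. -/
theorem evalState_formalNormalForm (hn : s.Nodup) (hs : ∀ x, x ∈ s ↔ x ∈ σ) (y : TopPath e) :
    evalState c (formalNormalForm s y) = normalForm c y := by
  classical
  by_cases hy : y ∈ σ
  · rw [formalNormalForm, dif_pos hy, normalForm_of_mem c hy, evalState_cons, evalState_nil,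
      List.map_nil, List.prod_nil, one_smul, add_zero]
  by_cases hc : IsCritical σ y
  · rw [formalNormalForm, dif_neg hy, dif_pos hc, normalForm_of_critical c hc, evalState_flatMap,
      ← List.sum_toFinset _ hn]
    have h : s.toFinset = σ := Finset.ext fun x => by rw [List.mem_toFinset, hs]
    rw [h, ← Finset.sum_subset (s₁ := sigmaSet σ y) (fun q hq => mem_of_mem_sigmaSet hq)
      (fun q _ hq => by rw [dif_neg hq, evalState_nil]), ← Finset.sum_coe_sort]
    refine Finset.sum_congr rfl fun q _ => ?_
    rw [dif_pos q.2, evalState_cons, evalState_nil, List.map_singleton, List.prod_singleton,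
      add_zero]
  · rw [formalNormalForm, dif_neg hy, dif_neg hc, normalForm, dif_neg hy, dif_neg hc, evalState_nil]

theorem evalState_formalStep (hn : s.Nodup) (hs : ∀ x, x ∈ s ↔ x ∈ σ) {a b : V} (α : a ⟶ b)
    (S : FormalState σ) : evalState c (formalStep s α S) = arrowEnd c α (evalState c S) := by
  classical
  induction S with
  | nil => rw [evalState_nil, map_zero]; rfl
  | cons T S ih =>
    rw [formalStep, List.flatMap_cons, evalState_append, evalState_cons, map_add, map_smul,
      arrowEnd_single, ← ih]
    congr 1
    split_ifs with h
    · rw [evalState_mul, evalState_formalNormalForm c hn hs]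
    · rw [evalState_nil, smul_zero]

/-- Formal states mediate between codes and polynomials: their values are the coordinates in the
representation, and their codes are the states of the algorithm. -/
theorem evalState_formalPath (hσ : IsPathClosed σ) (hn : s.Nodup) (hs : ∀ x, x ∈ s ↔ x ∈ σ)
    (r : Fin t) {a b : V} (p : Quiver.Path a b) :
    evalState c (formalPath σ s r p) = pathEnd c p (topVec c r) := by
  classical
  induction p with
  | nil =>
    rw [formalPath, pathEnd, topVec, normalForm_of_mem c (hσ.top_mem r), vertexEnd_single,
      ← normalForm_of_mem c (hσ.top_mem r)]
    change evalState c (if e r = a then _ else _) = if e r = a then _ else _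
    split_ifs
    · exact evalState_formalNormalForm c hn hs _
    · rfl
  | cons p α ih =>
    rw [formalPath, evalState_formalStep c hn hs, ih]
    rfl

end Eval

section EvalPoly

variable {K : Type*} [Field K] {k : ℕ} (a : Fin k → K) {s : List (TopPath e)}

theorem evalPoly_append {N : Type*} (f g : FormalPoly k N) :
    evalPoly a (f ++ g) = evalPoly a f + evalPoly a g := by
  rw [evalPoly, List.map_append, List.sum_append]
  rfl

open Classical in
theorem evalPoly_flatMap_state (i : Fin k) (q : {q // q ∈ σ}) (S : FormalState σ) :
    evalPoly a (S.flatMap fun T => if T.1 = q then [((1 : ℤ), [i], T.2)] else []) =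
      MvPolynomial.C (a i) * evalState (MvPolynomial.X : CoordIndex σ → MvPolynomial _ K) S q := by
  induction S with
  | nil =>
    rw [evalState_nil, Pi.zero_apply, mul_zero]
    rfl
  | cons T S ih =>
    rw [List.flatMap_cons, evalPoly_append, ih, evalState_cons, Pi.add_apply, mul_add]
    congr 1
    rw [Pi.smul_apply, Pi.single_apply]
    by_cases h : T.1 = q
    · rw [if_pos h, if_pos h.symm]
      simp [evalPoly]
    · rw [if_neg h, if_neg (Ne.symm h), smul_zero, mul_zero]
      rfl

variable [Fintype V]

theorem coordPoly_zero (r : Fin t) (q : {q // q ∈ σ}) :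
    coordPoly σ (0 : PathAlgebra K V) r q = 0 := by
  rw [coordPoly, mapCoeff_zero, map_zero]
  rfl

theorem coordPoly_smul_ofPath_add (b : K) (p : QPath V) (x : PathAlgebra K V) (r : Fin t)
    (q : {q // q ∈ σ}) : coordPoly σ (b • ofPath K p + x) r q =
      MvPolynomial.C b * pathEnd MvPolynomial.X p.2.2 (topVec MvPolynomial.X r) q +
        coordPoly σ x r q := by
  rw [coordPoly, mapCoeff_add, map_add, mapCoeff_smul, map_smul, mapCoeff_ofPath, act_ofPath]
  rfl

theorem evalPoly_formalCoeff (hσ : IsPathClosed σ) (hn : s.Nodup) (hs : ∀ x, x ∈ s ↔ x ∈ σ)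
    (ρ : List (Fin k × QPath V)) (r : Fin t) (q : {q // q ∈ σ}) :
    evalPoly a (formalCoeff s ρ r q) = coordPoly σ (evalGen a ρ) r q := by
  classical
  induction ρ with
  | nil => exact (coordPoly_zero r q).symm
  | cons T ρ ih =>
    rw [evalGen, List.map_cons, List.sum_cons, coordPoly_smul_ofPath_add, ← evalGen, ← ih,
      formalCoeff, List.flatMap_cons, evalPoly_append, evalPoly_flatMap_state,
      evalState_formalPath _ hσ hn hs]
    rfl

end EvalPoly

end Formal

/-! ### Agreement of the algorithm with the formal computation -/

section CodeCorrect

variable {V : Type*} [Quiver V] {n m : ℕ} (numV : V ≃ Fin n) (numA : (Σ a b : V, a ⟶ b) ≃ Fin m)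
  {t : ℕ} {e : Fin t → V} {σ : Finset (TopPath e)} {s : List (TopPath e)}

theorem length_arrowWord {a b : V} (p : Quiver.Path a b) :
    (arrowWord numA p).length = p.length := by
  induction p with
  | nil => rfl
  | cons p α ih => rw [arrowWord, List.length_append, ih]; rfl

/-- The number of an arrow determines its starting point and end point. With a common starting
point, the words can thus be compared arrow by arrow from the end. -/
theorem arrowWord_injective {a b : V} (p : Quiver.Path a b) {b' : V} (p' : Quiver.Path a b')
    (h : arrowWord numA p = arrowWord numA p') :
    (⟨b, p⟩ : Σ b, Quiver.Path a b) = ⟨b', p'⟩ := by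
  induction p generalizing b' with
  | nil =>
    cases p' with
    | nil => rfl
    | cons p' α' => simp [arrowWord] at h
  | cons p α ih =>
    cases p' with
    | nil => simp [arrowWord] at h
    | cons p' α' =>
      obtain ⟨h1, h2⟩ := List.append_inj' h rfl
      have h3 := numA.injective (Fin.ext (List.singleton_inj.1 h2))
      cases h3
      cases ih p' h1
      rfl

theorem codeTopPath_injective :
    Function.Injective (codeTopPath numA : TopPath e → PathCode) := by
  rintro ⟨r, b, p⟩ ⟨r', b', p'⟩ h
  obtain ⟨h1, h2⟩ := Prod.mk.inj h
  cases Fin.ext h1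
  cases arrowWord_injective numA p p' h2
  rfl

/-- The data of the quiver, of the vertices `e(r)` and of the paths in `σ`. -/
def codeEnv (e : Fin t → V) (s : List (TopPath e)) : AlgEnv :=
  ((codeQuiver numV numA).2, List.ofFn (fun r => (numV (e r)).val), s.map (codeTopPath numA))

/-- The code of a formal combination. -/
def codeState (S : FormalState σ) : CodeState :=
  S.map fun T => (codeTopPath numA T.1.1,
    T.2.map fun ν => (codeTopPath numA ν.1.1, codeTopPath numA ν.2.1))

theorem getD_arrows {a b : V} (α : a ⟶ b) :
    (codeEnv numV numA e s).1.getD (numA ⟨a, b, α⟩).val (0, 0) = ((numV a).val, (numV b).val) := by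
  simp only [codeEnv, codeQuiver, List.getD_eq_getElem?_getD, List.getElem?_ofFn, Fin.is_lt,
    dite_true, Option.getD_some, Fin.eta]
  rw [numA.symm_apply_apply]

theorem getD_vertices (r : Fin t) :
    (codeEnv numV numA e s).2.1.getD r.val 0 = (numV (e r)).val := by
  simp [codeEnv]

theorem codeEnd_codeTopPath (q : TopPath e) :
    codeEnd (codeEnv numV numA e s) (codeTopPath numA q) = (numV q.2.1).val := by
  obtain ⟨r, b, p⟩ := q
  cases p with
  | nil => exact getD_vertices numV numA r
  | cons p α =>
    rw [codeEnd, codeTopPath, arrowWord, List.foldl_append, List.foldl_cons, List.foldl_nil,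
      getD_arrows]

theorem codeTopPath_snoc (q : TopPath e) {a b : V} (h : q.2.1 = a) (α : a ⟶ b) :
    codeTopPath numA (q.snoc h α) =
      ((codeTopPath numA q).1, (codeTopPath numA q).2 ++ [(numA ⟨a, b, α⟩).val]) := by
  subst h
  rfl

/-- Since coding is injective and preserves lengths and end points, the tests on codes decide
membership in σ and in the σ-set. -/
theorem codeNormalForm_codeTopPath (hs : ∀ x, x ∈ s ↔ x ∈ σ) {y : TopPath e}
    (hy : y ∈ σ ∨ IsCritical σ y) :
    codeNormalForm (codeEnv numV numA e s) (codeTopPath numA y) =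
      codeState numA (formalNormalForm s y : FormalState σ) := by
  classical
  have hm : (@List.idxOf PathCode instBEqOfDecidableEq (codeTopPath numA y)
      (codeEnv numV numA e s).2.2 < (codeEnv numV numA e s).2.2.length) ↔ y ∈ σ := by
    rw [← hs]
    exact (@List.idxOf_lt_length_iff PathCode instBEqOfDecidableEq _ _ _).trans
      (List.mem_map_of_injective (codeTopPath_injective numA))
  rw [codeNormalForm]
  by_cases h : y ∈ σ
  · rw [if_pos (hm.2 h), formalNormalForm, dif_pos h]
    rfl
  · have hc := hy.resolve_left h
    rw [if_neg (mt hm.1 h), formalNormalForm, dif_neg h, dif_pos hc, codeState, List.map_flatMap]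
    change List.flatMap _ (s.map (codeTopPath numA)) = _
    rw [List.flatMap_map]
    refine List.flatMap_congr fun q hq => ?_
    have hi : ((codeTopPath numA y).2.length ≤ (codeTopPath numA q).2.length ∧
        codeEnd (codeEnv numV numA e s) (codeTopPath numA q) =
          codeEnd (codeEnv numV numA e s) (codeTopPath numA y)) ↔ q ∈ sigmaSet σ y := by
      rw [codeEnd_codeTopPath, codeEnd_codeTopPath, mem_sigmaSet, ← hs,
        and_iff_right (a := q ∈ s) hq, codeTopPath, codeTopPath, length_arrowWord,
        length_arrowWord, Fin.val_inj, numV.apply_eq_iff_eq]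
      rfl
    by_cases hq' : q ∈ sigmaSet σ y
    · rw [if_pos (hi.2 hq'), dif_pos hq']
      rfl
    · rw [if_neg (mt hi.1 hq'), dif_neg hq']
      rfl

theorem codeStep_codeState (hs : ∀ x, x ∈ s ↔ x ∈ σ) {a b : V} (α : a ⟶ b)
    (S : FormalState σ) :
    codeStep (codeEnv numV numA e s) (codeState numA S) (numA ⟨a, b, α⟩).val =
      codeState numA (formalStep s α S) := by
  classical
  rw [codeStep, codeState, List.flatMap_map, codeState, formalStep, List.map_flatMap]
  refine List.flatMap_congr fun T _ => ?_
  rw [codeEnd_codeTopPath, getD_arrows]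
  by_cases h : T.1.1.2.1 = a
  · rw [if_pos (congrArg (fun v => (numV v).val) h), dif_pos h, ← codeTopPath_snoc numA T.1.1 h α,
      codeNormalForm_codeTopPath numV numA hs, codeState, List.map_map, List.map_map]
    · refine List.map_congr_left fun T' _ => ?_
      simp
    · by_cases h' : T.1.1.snoc h α ∈ σ
      · exact Or.inl h'
      · exact Or.inr (isCritical_snoc T.1.2 h α h')
  · rw [if_neg, dif_neg h]
    · rfl
    · exact fun h' => h (numV.injective (Fin.ext h'))

theorem codePathState_codePath (hσ : IsPathClosed σ) (hs : ∀ x, x ∈ s ↔ x ∈ σ) (r : Fin t)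
    {a b : V} (p : Quiver.Path a b) :
    codePathState (codeEnv numV numA e s) r.val (codePath numV numA ⟨a, b, p⟩) =
      codeState numA (formalPath σ s r p) := by
  classical
  induction p with
  | nil =>
    rw [codePathState, getD_vertices, formalPath]
    change (if (numV (e r)).val = (numV a).val then _ else _) = _
    by_cases h : e r = a
    · rw [if_pos (congrArg (fun v => (numV v).val) h), if_pos h, formalNormalForm,
        dif_pos (hσ.top_mem r)]
      rfl
    · rw [if_neg fun h' => h (numV.injective (Fin.ext h')), if_neg h]
      rfl
  | cons p α ih =>
    rw [formalPath, ← codeStep_codeState numV numA hs, ← ih, codePathState, codePathState, codePath,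
      arrowWord, List.foldl_append]
    rfl

theorem codeCoeff_code (hσ : IsPathClosed σ) (hs : ∀ x, x ∈ s ↔ x ∈ σ) (r : Fin t)
    (q : {q // q ∈ σ}) {k : ℕ} (ρ : List (Fin k × QPath V)) :
    codeCoeff (codeEnv numV numA e s) r.val (codeTopPath numA q.1)
        (ρ.map fun T => (T.1.val, codePath numV numA T.2)) =
      codePoly numA (formalCoeff s ρ r q) := by
  classical
  rw [codeCoeff, List.flatMap_map, codePoly, formalCoeff, List.map_flatMap]
  refine List.flatMap_congr fun T _ => ?_
  rw [codePathState_codePath numV numA hσ hs, codeTerms, codeState, List.flatMap_map,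
    List.map_flatMap]
  refine List.flatMap_congr fun T' _ => ?_
  by_cases h : T'.1 = q
  · rw [if_pos h, if_pos (congrArg (fun q => codeTopPath numA q.1) h)]
    rfl
  · rw [if_neg h, if_neg fun h' => h (Subtype.ext (codeTopPath_injective numA h'))]
    rfl

/-- The coefficients of the elements `ρ ẑ_r`, as formal polynomials. -/
def formalCoeffs (hs : ∀ x, x ∈ s ↔ x ∈ σ) {k : ℕ} (gens : List (List (Fin k × QPath V))) :
    List (FormalPoly k (CoordIndex σ)) :=
  gens.flatMap fun ρ => (List.finRange t).flatMap fun r =>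
    s.attach.map fun q => formalCoeff s ρ r ⟨q.1, (hs q.1).1 q.2⟩

theorem skeletonAlgorithm_codeInput (hσ : IsPathClosed σ) (hs : ∀ x, x ∈ s ↔ x ∈ σ) {k : ℕ}
    (gens : List (List (Fin k × QPath V))) :
    skeletonAlgorithm (codeInput numV numA e s gens) =
      (formalCoeffs hs gens).map (codePoly numA) := by
  change List.flatMap (fun ρ => codeCoeffs (codeEnv numV numA e s) ρ) (gens.map _) = _
  rw [List.flatMap_map, formalCoeffs, List.map_flatMap]
  refine List.flatMap_congr fun ρ _ => ?_
  have hl : (codeEnv numV numA e s).2.1.length = t := List.length_ofFn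
  rw [codeCoeffs, hl, ← List.map_coe_finRange_eq_range, List.flatMap_map, List.map_flatMap]
  refine List.flatMap_congr fun r _ => ?_
  change (s.map (codeTopPath numA)).map _ = _
  rw [List.map_map, List.map_map]
  refine Eq.trans (congrArg (List.map _) (List.attach_map_subtype_val s).symm) ?_
  rw [List.map_map]
  refine List.map_congr_left fun q _ => ?_
  exact codeCoeff_code numV numA hσ hs r ⟨q.1, (hs q.1).1 q.2⟩ ρ

theorem mem_formalCoeffs (hs : ∀ x, x ∈ s ↔ x ∈ σ) {k : ℕ}
    {gens : List (List (Fin k × QPath V))} {f : FormalPoly k (CoordIndex σ)} :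
    f ∈ formalCoeffs hs gens ↔ ∃ ρ ∈ gens, ∃ (r : Fin t) (q : {q // q ∈ σ}),
      f = formalCoeff s ρ r q := by
  rw [formalCoeffs, List.mem_flatMap]
  refine exists_congr fun ρ => and_congr_right fun _ => ?_
  rw [List.mem_flatMap]
  constructor
  · rintro ⟨r, -, h⟩
    obtain ⟨q, -, rfl⟩ := List.mem_map.1 h
    exact ⟨r, _, rfl⟩
  · rintro ⟨r, q, rfl⟩
    exact ⟨r, List.mem_finRange r, List.mem_map.2 ⟨⟨q.1, (hs q.1).2 q.2⟩, List.mem_attach _ _, rfl⟩⟩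

end CodeCorrect

/-! ### The computed polynomials generate the ideal -/

section SpanCorrect

variable {K V : Type*} [Field K] [Fintype V] [Quiver V] {t : ℕ} {e : Fin t → V}
  {σ : Finset (TopPath e)} {s : List (TopPath e)} {k : ℕ}

theorem span_evalPoly_formalCoeffs (hσ : IsPathClosed σ) (hn : s.Nodup)
    (hs : ∀ x, x ∈ s ↔ x ∈ σ) (a : Fin k → K) (gens : List (List (Fin k × QPath V))) :
    Ideal.span {g | ∃ f ∈ formalCoeffs hs gens, g = evalPoly a f} =
      skeletonIdeal σ {ρ | ∃ g ∈ gens, ρ = evalGen a g} := by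
  rw [skeletonIdeal_eq hσ]
  refine congrArg Ideal.span (Set.ext fun g => ⟨?_, ?_⟩)
  · rintro ⟨f, hf, rfl⟩
    obtain ⟨ρ, hρ, r, q, rfl⟩ := (mem_formalCoeffs hs).1 hf
    exact ⟨_, ⟨ρ, hρ, rfl⟩, r, q, evalPoly_formalCoeff a hσ hn hs ρ r q⟩
  · rintro ⟨_, ⟨ρ, hρ, rfl⟩, r, q, rfl⟩
    exact ⟨_, (mem_formalCoeffs hs).2 ⟨ρ, hρ, r, q, rfl⟩,
      (evalPoly_formalCoeff a hσ hn hs ρ r q).symm⟩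

/-- The same formal polynomial is evaluated with the symbols regarded as elements of K₀; its other
constants are integers. -/
theorem exists_map_eq_evalPoly {N : Type*} {a : Fin k → K} (K₀ : Subfield K)
    (ha : ∀ i, a i ∈ K₀) (f : FormalPoly k N) :
    ∃ g : MvPolynomial N K₀, MvPolynomial.map K₀.subtype g = evalPoly a f := by
  refine ⟨evalPoly (fun i => ⟨a i, ha i⟩) f, ?_⟩
  rw [evalPoly, evalPoly, map_list_sum, List.map_map]
  refine congrArg List.sum (List.map_congr_left fun T _ => ?_)
  simp only [Function.comp_apply, map_mul, map_intCast, map_list_prod, List.map_map]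
  congr 3
  · congr 1
    funext i
    exact MvPolynomial.map_C _ _
  · funext ν
    exact MvPolynomial.map_X _ ν

end SpanCorrect

theorem isClosed_zeroLocus {K N : Type*} [Field K] (J : Ideal (MvPolynomial N K)) :
    @IsClosed _ (affineSpace K N).topology (MvPolynomial.zeroLocus K J) := by
  let _ : TopologicalSpace (N → K) := (affineSpace K N).topology
  have h : MvPolynomial.zeroLocus K J =
      ⋂ g ∈ J, {x : N → K | MvPolynomial.eval x g ≠ 0}ᶜ := by
    ext x
    simp [MvPolynomial.mem_zeroLocus_iff, MvPolynomial.aeval_eq_eval]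
  rw [h]
  refine isClosed_biInter fun g _ => isClosed_compl_iff.2 ?_
  exact TopologicalSpace.isOpen_generateFrom_of_mem
    ⟨(_, fun x => MvPolynomial.eval x 0 / MvPolynomial.eval x g), ⟨0, g, rfl, rfl⟩, rfl⟩

end

end SkeletonGrass

/-! ### The assembled theorem -/

theorem theorem3p12 :
    ∃ F : AlgInput → AlgOutput, Computable F ∧
      ∀ (K : Type u) [Field K] [IsAlgClosed K] (V : Type v) [Fintype V] [Quiver.{w} V]
        [∀ a b : V, Finite (a ⟶ b)] (I : Ideal (PathAlgebra K V)) [I.IsTwoSided]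
        (_ : IsAdmissible I) (t : ℕ) (e : Fin t → V) (d : ℕ) (σ : Finset (TopPath e))
        (_ : IsAbstractSkeleton (maxLength I) σ) (_ : σ.card = d),
        ∃ (ψ : Grass I σ d → CoordIndex σ → K) (θ : Set.range ψ → Grass I σ d)
          (φ : Grass I σ d → skeletonIsoTypes I σ) (χ : Set.range ψ → skeletonIsoTypes I σ),
          -- `ψ C` is the unique family of coefficients of the critical paths modulo `C`
          (∀ (C : Grass I σ d) (c : CoordIndex σ → K), IsCoeffFamily I σ C.1 c ↔ c = ψ C) ∧
          -- the affine space is finite-dimensional and the image is closed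
          Finite (CoordIndex σ) ∧
          @IsClosed _ (affineSpace K (CoordIndex σ)).topology (Set.range ψ) ∧
          -- `ψ` is an isomorphism onto its image, with inverse `θ : c ↦ U(c)`
          IsMorphism (grassVariety I σ d) (affineSubset (Set.range ψ))
            (Set.rangeFactorization ψ) ∧
          IsMorphism (affineSubset (Set.range ψ)) (grassVariety I σ d) θ ∧
          Function.LeftInverse θ (Set.rangeFactorization ψ) ∧
          Function.RightInverse θ (Set.rangeFactorization ψ) ∧
          (∀ c : Set.range ψ, (θ c).1 = USub I σ c.1) ∧
          -- the commutative diagram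
          (∀ C : Grass I σ d, (φ C).1 = isoType I (PCover e I ⧸ C.1)) ∧
          (∀ c : Set.range ψ, (χ c).1 = isoType I (PCover e I ⧸ USub I σ c.1)) ∧
          χ = φ ∘ θ ∧
          Function.Surjective χ ∧
          -- for every set of left ideal generators, the image is the zero locus of `I(σ)`, and
          -- `I(σ)` is defined over every subfield over which the generators are defined
          (∀ R : Set (PathAlgebra K V), Ideal.span R = I →
            Set.range ψ = MvPolynomial.zeroLocus K (skeletonIdeal σ R) ∧
            ∀ K₀ : Subfield K, (∀ ρ ∈ R, ∀ p : QPath V, coeff ρ p ∈ K₀) →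
              ∃ S : Set (MvPolynomial (CoordIndex σ) K₀),
                Ideal.span (MvPolynomial.map K₀.subtype '' S) = skeletonIdeal σ R) ∧
          -- the algorithm computes generators of `I(σ)`
          (∀ (n m : ℕ) (numV : V ≃ Fin n) (numA : (Σ a b : V, a ⟶ b) ≃ Fin m)
            (s : List (TopPath e)) (_ : s.Nodup) (_ : ∀ x, x ∈ s ↔ x ∈ σ)
            (k : ℕ) (a : Fin k → K) (gens : List (List (Fin k × QPath V)))
            (_ : Ideal.span {ρ | ∃ g ∈ gens, ρ = evalGen a g} = I),
            ∃ polys : List (FormalPoly k (CoordIndex σ)),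
              F (codeInput numV numA e s gens) = polys.map (codePoly numA) ∧
              Ideal.span {g | ∃ f ∈ polys, g = evalPoly a f} =
                skeletonIdeal σ {ρ | ∃ g ∈ gens, ρ = evalGen a g} ∧
              Set.range ψ = {c | ∀ f ∈ polys, MvPolynomial.eval c (evalPoly a f) = 0} ∧
              ∀ K₀ : Subfield K, (∀ i, a i ∈ K₀) →
                ∀ f ∈ polys, ∃ g : MvPolynomial (CoordIndex σ) K₀,
                  MvPolynomial.map K₀.subtype g = evalPoly a f) := by
  -- The function acts on codes alone, so it is chosen before the field, the quiver and the
  -- skeleton.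
  refine ⟨skeletonAlgorithm, primrec_skeletonAlgorithm.to_comp, ?_⟩
  intro K _ _ V _ _ _ I _ hI t e d σ hσ hd
  have hc := hσ.isPathClosed
  choose ψ hψ using fun C : Grass I σ d => exists_coeffFamily hI hσ C
  have hψ' : ∀ C, IsCoeffFamily I σ C.1 (ψ C) := fun C => (hψ C _).2 rfl
  have hU : ∀ C, USub I σ (ψ C) = C.1 := fun C => USub_eq_of_grass hI hσ C (hψ' C)
  -- This identification of the image underlies all the remaining claims: closedness, both morphisms
  -- and the zero loci.
  have hrange : Set.range ψ = annihilated I σ := by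
    ext c
    rw [← exists_grass_iff hI hσ hd c]
    exact exists_congr fun C => eq_comm.trans (hψ C c).symm
  have hlocus : ∀ R : Set (PathAlgebra K V), Ideal.span R = I →
      Set.range ψ = MvPolynomial.zeroLocus K (skeletonIdeal σ R) := fun R hR =>
    hrange.trans (zeroLocus_skeletonIdeal hc R hR).symm
  have hmem : ∀ c : Set.range ψ, USub I σ c.1 ∈ Grass I σ d := by
    rintro ⟨_, C, rfl⟩
    exact (hU C).symm ▸ C.2
  let θ : Set.range ψ → Grass I σ d := fun c => ⟨USub I σ c.1, hmem c⟩
  let φ : Grass I σ d → skeletonIsoTypes I σ := fun C =>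
    ⟨isoType I (PCover e I ⧸ C.1), _, _, _, _, inferInstance, ⟨_, C.2.2⟩, rfl⟩
  have hleft : Function.LeftInverse θ (Set.rangeFactorization ψ) := fun C => Subtype.ext (hU C)
  have hright : Function.RightInverse θ (Set.rangeFactorization ψ) := by
    rintro ⟨_, C, rfl⟩
    exact congrArg (Set.rangeFactorization ψ) (hleft C)
  refine ⟨ψ, θ, φ, φ ∘ θ, hψ, finite_coordIndex σ, ?_, ?_, ?_, hleft, hright, fun _ => rfl,
    fun _ => rfl, fun _ => rfl, rfl, ?_, ?_, ?_⟩
  -- For closedness any generating set will do, and I generates itself.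
  · rw [hlocus I (Ideal.span_eq I)]
    exact isClosed_zeroLocus _
  · exact isMorphism_coeff hI hσ hrange.le _ hψ'
  · exact isMorphism_USub hI hσ hrange.le θ fun _ => rfl
  -- A module with skeleton σ relative to x is P/C for some C in Grass(σ), by the map z_r ↦ x_r;
  -- then c = ψ(C) is a preimage.
  · rintro ⟨_, M, _, _, _, _, ⟨x, hx⟩, rfl⟩
    obtain ⟨C, g, -⟩ := ((isSkeletonRel_iff hI hσ).1 hx).exists_grass hI hσ hd
    refine ⟨Set.rangeFactorization ψ C, Subtype.ext ?_⟩
    change (φ (θ (Set.rangeFactorization ψ C))).1 = isoType I M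
    rw [hleft C]
    exact Quotient.sound ⟨g.toModuleIso⟩
  · exact fun R hR => ⟨hlocus R hR, fun K₀ hK₀ => exists_span_map_eq_skeletonIdeal hc R K₀ hK₀⟩
  · intro n m numV numA s hn hs k a gens hgens
    refine ⟨formalCoeffs hs gens, skeletonAlgorithm_codeInput numV numA hc hs gens,
      span_evalPoly_formalCoeffs hc hn hs a gens, ?_,
      fun K₀ ha f _ => exists_map_eq_evalPoly K₀ ha f⟩
    rw [hlocus _ hgens, ← span_evalPoly_formalCoeffs hc hn hs a gens,
      MvPolynomial.zeroLocus_span]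
    ext c
    constructor
    · intro h f hf
      have h' := h _ ⟨f, hf, rfl⟩
      rwa [MvPolynomial.aeval_eq_eval] at h'
    · rintro h _ ⟨f, hf, rfl⟩
      rw [MvPolynomial.aeval_eq_eval]
      exact h f hf
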